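/- **Theorem 3.2.5.1.** Let $k$ be a commutative ring, $H$ a Hopf $k$-algebra and $A$ a $k$-algebra. Let $E=A\#_f H$ be a crossed product: there are a weak action $(h,a)\mapsto a^h$ of $H$ on $A$ (a bilinear map with $(ab)^h=a^{h^{(1)}}b^{h^{(2)}}$, $1^h=\epsilon(h)1$, $a^1=a$) and a $k$-linear map $f\colon H\otimes H\to A$ such that the product $(a\# h)(b\# l)=a\,b^{h^{(1)}}f(h^{(2)},l^{(1)})\# h^{(3)}l^{(2)}$ on $A\otimes H$ is associative with identity $1\# 1$. Assume that $f$ is convolution invertible. Let $S$ be a separable subalgebra of $A$ that is stable under the weak action ($s^h\in S$ for all $s\in S$, $h\in H$), and assume that $f(h,l)\in S$ for all $h,l\in H$. Let $M$ be an $E$-bimodule (with $k$ acting in the same way on both sides). Put $\widetilde A=A/S$, $\widetilde A^0=S$ and $\widetilde A^r=\widetilde A\otimes_S\cdots\otimes_S\widetilde A$ ($r$ times) for $r\ge1$, and let $S^e=S\otimes S^{\mathrm{op}}$. Let $(\operatorname{Hom}_{S^e}(\widetilde A^*,M),b^*)$ be the normalized $S$-relative Hochschild cochain complex: identifying $\operatorname{Hom}_{S^e}(S,M)$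 with $\{m\in M: sm=ms \text{ for } s\in S\}$ and $\varphi\in\operatorname{Hom}_{S^e}(\widetilde A^r,M)$ with a multilinear map on $A^r$, $$b\varphi(a_0,\dots,a_r)=a_0\varphi(a_1,\dots,a_r)+\sum_{j=0}^{r-1}(-1)^{j+1}\varphi(a_0,\dots,a_ja_{j+1},\dots,a_r)+(-1)^{r+1}\varphi(a_0,\dots,a_{r-1})a_r .$$ Then the map $h\mapsto 1\# h$ is convolution invertible, with inverse denoted $h\mapsto(1\# h)^{-1}$; the formula $$(\varphi\cdot h)(a_1,\dots,a_r)=(1\# h^{(1)})^{-1}\,\varphi\bigl(a_1^{h^{(2)}},\dots,a_r^{h^{(r+1)}}\bigr)\,(1\# h^{(r+2)})$$ makes $(\operatorname{Hom}_{S^e}(\widetilde A^*,M),b^*)$ a cochain complex of right $H$-modules; and for every $n\ge0$ the Hochschild cohomology $\operatorname{H}^n(E,M)$ is isomorphic, as a $k$-module, to the $n$-th cohomology of $H$ with coefficients in this cochain complex of right $H$-modules, that is, to the $n$-th cohomology of the total complex of the double complex $\operatorname{Hom}_k\bigl(H^{\otimes s},\operatorname{Hom}_{S^e}(\widetilde A^r,M)\bigr)$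 ($r,s\ge 0$), whose differentials are the one induced by $b$ and $(-1)^r\delta$, where $$\delta\psi(h_0,\dots,h_s)=\epsilon(h_0)\psi(h_1,\dots,h_s)+\sum_{j=0}^{s-1}(-1)^{j+1}\psi(h_0,\dots,h_jh_{j+1},\dots,h_s)+(-1)^{s+1}\psi(h_0,\dots,h_{s-1})\cdot h_s .$$ Here Hochschild cohomology over $k$ is the cohomology of the Hochschild cochain complex $\operatorname{Hom}_k(E^{\otimes *},M)$. -/

import Mathlib

open scoped TensorProduct

namespace HopfCrossed

noncomputable section

section Sweedler

variable {k H V : Type*} [CommRing k] [AddCommGroup H] [Module k H] [Coalgebra k H]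
  [AddCommGroup V] [Module k V]

/-- For a bilinear map `β` on a coalgebra, `sweedler β h = β (h⁽¹⁾, h⁽²⁾)` (summation understood). -/
def sweedler : (H →ₗ[k] H →ₗ[k] V) →ₗ[k] (H →ₗ[k] V) :=
  LinearMap.lcomp k V (Coalgebra.comul (R := k) (A := H)) ∘ₗ
    (TensorProduct.lift.equiv (.id k) H H V).toLinearMap

theorem sweedler_apply (β : H →ₗ[k] H →ₗ[k] V) (h : H) :
    sweedler β h = TensorProduct.lift β (Coalgebra.comul (R := k) h) := rfl

theorem sweedler_repr (β : H →ₗ[k] H →ₗ[k] V) {ι : Type*} {h : H} (R : Coalgebra.Repr k h ι) :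
    sweedler β h = ∑ i ∈ R.index, β (R.left i) (R.right i) := by
  rw [sweedler_apply, ← R.eq]; simp

end Sweedler

section Crossed

variable {k A H : Type*} [CommRing k] [Ring A] [Algebra k A] [Ring H] [HopfAlgebra k H]

/-- The map `H ⊗ H → A ⊗ H`, `h ⊗ l ↦ f(h⁽¹⁾, l⁽¹⁾) ⊗ h⁽²⁾ l⁽²⁾`. -/
def cocycleMul (f : H ⊗[k] H →ₗ[k] A) : H ⊗[k] H →ₗ[k] A ⊗[k] H :=
  TensorProduct.map f (LinearMap.mul' k H) ∘ₗ Coalgebra.comul (R := k) (A := H ⊗[k] H)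

/-- `(h, b ⊗ l) ↦ b^{h⁽¹⁾} f(h⁽²⁾, l⁽¹⁾) ⊗ h⁽³⁾ l⁽²⁾`, as a linear map in `h`. -/
def crossedMulAux (act : H →ₗ[k] A →ₗ[k] A) (f : H ⊗[k] H →ₗ[k] A) :
    A ⊗[k] H →ₗ[k] H →ₗ[k] A ⊗[k] H :=
  TensorProduct.lift <| LinearMap.mk₂ k
    (fun b l => sweedler <|
      (Algebra.lsmul k k (A ⊗[k] H)).toLinearMap.compl₁₂ (act.flip b)
        ((TensorProduct.curry (cocycleMul f)).flip l))
    (fun b b' l => by rw [← map_add]; congr 1; ext; simp [add_smul])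
    (fun c b l => by rw [← map_smul]; congr 1; ext; simp)
    (fun b l l' => by rw [← map_add]; congr 1; ext; simp)
    (fun c b l => by rw [← map_smul]; congr 1; ext; simp)

/-- The multiplication
`(a ⊗ h)(b ⊗ l) = a b^{h⁽¹⁾} f(h⁽²⁾, l⁽¹⁾) ⊗ h⁽³⁾ l⁽²⁾` on `A ⊗ H`. -/
def crossedMul (act : H →ₗ[k] A →ₗ[k] A) (f : H ⊗[k] H →ₗ[k] A) :
    A ⊗[k] H →ₗ[k] A ⊗[k] H →ₗ[k] A ⊗[k] H :=
  TensorProduct.lift <| LinearMap.mk₂ k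
    (fun a h => (Algebra.lsmul k k (A ⊗[k] H) a) ∘ₗ (crossedMulAux act f).flip h)
    (fun a a' h => by ext; simp [add_smul])
    (fun c a h => by ext; simp)
    (fun a h h' => by ext; simp)
    (fun c a h => by ext; simp [smul_comm a c])

theorem crossedMul_tmul (act : H →ₗ[k] A →ₗ[k] A) (f : H ⊗[k] H →ₗ[k] A) (a b : A) (h l : H)
    {ι : Type*} (R : Coalgebra.Repr k h ι) :
    crossedMul act f (a ⊗ₜ h) (b ⊗ₜ l) =
      ∑ i ∈ R.index, (a * act (R.left i) b) • cocycleMul f (R.right i ⊗ₜ l) := by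
  simp [crossedMul, crossedMulAux, sweedler_repr _ R, Finset.smul_sum, mul_smul]

end Crossed

open WithConv

/-- A crossed product `A #_f H`: a weak action of the Hopf algebra `H` on the algebra `A` and a
linear map `f : H ⊗ H → A` such that the multiplication
`(a ⊗ h)(b ⊗ l) = a b^{h⁽¹⁾} f(h⁽²⁾, l⁽¹⁾) ⊗ h⁽³⁾ l⁽²⁾` on `A ⊗ H` is associative with
identity `1 ⊗ 1`. Here `act h a` is `a^h`. -/
structure CrossedProduct (k A H : Type*) [CommRing k] [Ring A] [Algebra k A] [Ring H]
    [HopfAlgebra k H] where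
  /-- the weak action `act h a = a^h` -/
  act : H →ₗ[k] A →ₗ[k] A
  /-- `(a b)^h = a^{h⁽¹⁾} b^{h⁽²⁾}`, written with the convolution product of `Hom(H, A)` -/
  act_mul : ∀ a b : A, toConv (act.flip (a * b)) = toConv (act.flip a) * toConv (act.flip b)
  /-- `1^h = ε(h) 1` -/
  act_one : ∀ h : H, act h 1 = algebraMap k A (Coalgebra.counit h)
  /-- `a^1 = a` -/
  one_act : ∀ a : A, act 1 a = a
  /-- the cocycle -/
  f : H ⊗[k] H →ₗ[k] A
  crossed_assoc : ∀ x y z : A ⊗[k] H,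
    crossedMul act f (crossedMul act f x y) z = crossedMul act f x (crossedMul act f y z)
  one_crossed : ∀ x : A ⊗[k] H, crossedMul act f (1 ⊗ₜ 1) x = x
  crossed_one : ∀ x : A ⊗[k] H, crossedMul act f x (1 ⊗ₜ 1) = x

namespace CrossedProduct

variable {k A H : Type*} [CommRing k] [Ring A] [Algebra k A] [Ring H] [HopfAlgebra k H]
  (X : CrossedProduct k A H)

/-- The algebra `E = A #_f H`, with underlying module `A ⊗ H`. -/
def E (_X : CrossedProduct k A H) : Type _ := A ⊗[k] H

instance : AddCommGroup X.E := inferInstanceAs (AddCommGroup (A ⊗[k] H))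

instance : Module k X.E := inferInstanceAs (Module k (A ⊗[k] H))

instance : Ring X.E where
  __ := (inferInstance : AddCommGroup X.E)
  mul x y := crossedMul X.act X.f x y
  one := (1 ⊗ₜ[k] 1 : A ⊗[k] H)
  mul_assoc := X.crossed_assoc
  one_mul := X.one_crossed
  mul_one := X.crossed_one
  left_distrib x y z := map_add (crossedMul X.act X.f x) y z
  right_distrib x y z := LinearMap.map_add₂ (crossedMul X.act X.f) x y z
  zero_mul x := LinearMap.map_zero₂ (crossedMul X.act X.f) x
  mul_zero x := map_zero (crossedMul X.act X.f x)

instance : Algebra k X.E :=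
  Algebra.ofModule (fun c x y => LinearMap.map_smul₂ (crossedMul X.act X.f) c x y)
    (fun c x y => map_smul (crossedMul X.act X.f x) c y)

/-- The inclusion `A → E`, `a ↦ a # 1`. -/
def inclA : A →ₗ[k] X.E := (TensorProduct.mk k A H).flip 1

/-- The map `H → E`, `h ↦ 1 # h`. -/
def gamma : H →ₗ[k] X.E := TensorProduct.mk k A H 1

/-- The convolution inverse of `h ↦ 1 # h`, so that `gammaInv h` is `(1 # h)⁻¹`. -/
def gammaInv : H →ₗ[k] X.E := (Ring.inverse (toConv X.gamma)).ofConv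


end CrossedProduct

section Hochschild

variable {k B N : Type*} [CommRing k] [Ring B] [Algebra k B] [AddCommGroup N] [Module k N]

theorem contractNth_update {n : ℕ} (j : Fin n) (b : Fin (n + 1) → B) (p : Fin (n + 1))
    [DecidableEq (Fin (n + 1))] :
    ∃ (q : Fin n) (u : B →ₗ[k] B), ∀ x : B,
      Fin.contractNth j.castSucc (· * ·) (Function.update b p x) =
        Function.update (Fin.contractNth j.castSucc (· * ·) b) q (u x) := by
  have hp := p.2
  have hj := j.2
  rcases lt_trichotomy (p : ℕ) (j : ℕ) with h | h | h
  · refine ⟨⟨p, by omega⟩, .id, fun x => ?_⟩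
    ext i
    simp only [Fin.contractNth, Function.update_apply, Fin.ext_iff, Fin.val_castSucc, Fin.val_succ,
      LinearMap.id_apply]
    grind
  · refine ⟨⟨p, by omega⟩, LinearMap.mulRight k (b j.succ), fun x => ?_⟩
    ext i
    have : p = j.castSucc := Fin.ext h
    subst this
    by_cases hi : i = j
    · subst hi; simp [Fin.contractNth, Fin.ext_iff]
    · have : (i : ℕ) ≠ j := fun h => hi (Fin.ext h)
      simp [Fin.contractNth, Function.update_apply, Fin.ext_iff]
      grind
  · by_cases h' : (p : ℕ) = j + 1
    · refine ⟨j, LinearMap.mulLeft k (b j.castSucc), fun x => ?_⟩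
      ext i
      have : p = j.succ := Fin.ext h'
      subst this
      by_cases hi : i = j
      · subst hi; simp [Fin.contractNth, Fin.ext_iff]
      · have : (i : ℕ) ≠ j := fun h => hi (Fin.ext h)
        simp [Fin.contractNth, Function.update_apply, Fin.ext_iff]
        grind
    · refine ⟨⟨p - 1, by omega⟩, .id, fun x => ?_⟩
      ext i
      simp only [Fin.contractNth, Function.update_apply, Fin.ext_iff, Fin.val_castSucc,
        Fin.val_succ, LinearMap.id_apply]
      grind

/-- The multilinear map
`(b₀, …, bₙ) ↦ φ(b₀, …, bⱼ bⱼ₊₁, …, bₙ)`. -/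
def contractMap {n : ℕ} (j : Fin n) (φ : MultilinearMap k (fun _ : Fin n => B) N) :
    MultilinearMap k (fun _ : Fin (n + 1) => B) N where
  toFun b := φ (Fin.contractNth j.castSucc (· * ·) b)
  map_update_add' b p x y := by
    obtain ⟨q, u, h⟩ := contractNth_update (k := k) j b p
    simp [h]
  map_update_smul' b p c x := by
    obtain ⟨q, u, h⟩ := contractNth_update (k := k) j b p
    simp [h]

/-- The Hochschild coboundary. The left and right actions of `B` on the coefficients `N` are given
by the linear maps `L` and `R` (so `L b n = b n` and `R b n = n b`), and
`(d φ)(b₀, …, bₙ) = b₀ φ(b₁, …, bₙ) + ∑ⱼ (-1)^(j+1) φ(b₀, …, bⱼ bⱼ₊₁, …, bₙ)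
  + (-1)^(n+1) φ(b₀, …, bₙ₋₁) bₙ`, see `hochschildD_apply`. -/
def hochschildD (L R : B →ₗ[k] Module.End k N) (n : ℕ) :
    MultilinearMap k (fun _ : Fin n => B) N →ₗ[k] MultilinearMap k (fun _ : Fin (n + 1) => B) N where
  toFun φ :=
    LinearMap.uncurryLeft (M := fun _ : Fin (n + 1) => B)
      ⟨⟨fun b => (L b).compMultilinearMap φ, fun b b' => by ext; simp⟩, fun c b => by ext; simp⟩
    + ∑ j : Fin n, (-1 : k) ^ ((j : ℕ) + 1) • contractMap j φ
    + (-1 : k) ^ (n + 1) • MultilinearMap.uncurryRight (M := fun _ : Fin (n + 1) => B)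
      (R.flip.compMultilinearMap φ)
  map_add' φ ψ := by
    ext b
    simp [contractMap, Finset.sum_add_distrib]
    abel
  map_smul' c φ := by
    ext b
    simp [contractMap, Finset.smul_sum, smul_smul, mul_comm]

theorem hochschildD_apply (L R : B →ₗ[k] Module.End k N) (n : ℕ)
    (φ : MultilinearMap k (fun _ : Fin n => B) N) (b : Fin (n + 1) → B) :
    hochschildD L R n φ b =
      L (b 0) (φ fun i => b i.succ)
      + ∑ j : Fin n, (-1 : k) ^ ((j : ℕ) + 1) • φ (Fin.contractNth j.castSucc (· * ·) b)
      + (-1 : k) ^ (n + 1) • R (b (Fin.last n)) (φ fun i => b i.castSucc) := by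
  simp [hochschildD, contractMap]
  rfl

end Hochschild

section Cohomology

variable {k : Type*} [CommRing k] {C : ℕ → Type*} [∀ n, AddCommGroup (C n)] [∀ n, Module k (C n)]

/-- The coboundaries of a cochain complex `C⁰ → C¹ → C² → ⋯`. -/
def coboundaries (d : ∀ n, C n →ₗ[k] C (n + 1)) : ∀ n, Submodule k (C n)
  | 0 => ⊥
  | n + 1 => LinearMap.range (d n)

/-- The `n`-th cohomology module (cocycles modulo coboundaries) of a cochain complex
`C⁰ → C¹ → C² → ⋯`. -/
abbrev Cohomology (d : ∀ n, C n →ₗ[k] C (n + 1)) (n : ℕ) : Type _ :=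
  LinearMap.ker (d n) ⧸ (coboundaries d n).submoduleOf (LinearMap.ker (d n))

end Cohomology

section Relative

variable {k A N : Type*} [CommRing k] [Ring A] [Algebra k A] [AddCommGroup N] [Module k N]

/-- `φ : A^r → N` is an `S`-relative normalized cochain. Here `L` and `R` are the left and right
actions of `A` on `N`. For `r ≥ 1` the conditions say that `φ` vanishes when one of its arguments is
in `S`, is balanced over `S` between consecutive arguments, and is left (right) `S`-linear in the
first (last) argument. By the universal property of `⊗_S`, such `φ` are the `S`-bimodule maps
`Ã ⊗_S ⋯ ⊗_S Ã → N` (`r` factors), where `Ã = A/S`. For `r = 0`, `φ` is an element `n` of `N` and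
the condition is `s n = n s` for `s ∈ S`; such elements are the `S`-bimodule maps `S → N`
(take the image of `1`). -/
structure IsRelCochain (S : Subalgebra k A) (L R : A →ₗ[k] Module.End k N) {r : ℕ}
    (φ : MultilinearMap k (fun _ : Fin r => A) N) : Prop where
  map_left : ∀ i : Fin r, (i : ℕ) = 0 → ∀ s ∈ S, ∀ a : Fin r → A,
    φ (Function.update a i (s * a i)) = L s (φ a)
  map_right : ∀ i : Fin r, (i : ℕ) + 1 = r → ∀ s ∈ S, ∀ a : Fin r → A,
    φ (Function.update a i (a i * s)) = R s (φ a)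
  balanced : ∀ i j : Fin r, (j : ℕ) = i + 1 → ∀ s ∈ S, ∀ a : Fin r → A,
    φ (Function.update a i (a i * s)) = φ (Function.update a j (s * a j))
  normalized : ∀ i : Fin r, ∀ a : Fin r → A, a i ∈ S → φ a = 0
  central : r = 0 → ∀ s ∈ S, ∀ a : Fin r → A, L s (φ a) = R s (φ a)

namespace IsRelCochain

variable {S : Subalgebra k A} {L R : A →ₗ[k] Module.End k N} {r : ℕ}
    {φ : MultilinearMap k (fun _ : Fin r => A) N}

theorem map_left' (h : IsRelCochain S L R φ) (i : Fin r) (hi : (i : ℕ) = 0) (s : A) (hs : s ∈ S)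
    (v w : Fin r → A) (h1 : v i = s * w i) (h2 : ∀ t : Fin r, (t : ℕ) ≠ i → v t = w t) :
    φ v = L s (φ w) := by
  rw [← h.map_left i hi s hs]
  congr 1; ext t
  by_cases ht : t = i
  · subst ht; simp [h1]
  · simp [ht, h2 t (fun h => ht (Fin.ext h))]

theorem map_right' (h : IsRelCochain S L R φ) (i : Fin r) (hi : (i : ℕ) + 1 = r) (s : A)
    (hs : s ∈ S) (v w : Fin r → A) (h1 : v i = w i * s) (h2 : ∀ t : Fin r, (t : ℕ) ≠ i → v t = w t) :
    φ v = R s (φ w) := by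
  rw [← h.map_right i hi s hs]
  congr 1; ext t
  by_cases ht : t = i
  · subst ht; simp [h1]
  · simp [ht, h2 t (fun h => ht (Fin.ext h))]

theorem balanced' (h : IsRelCochain S L R φ) (i j : Fin r) (hij : (j : ℕ) = i + 1) (s : A)
    (hs : s ∈ S) (v w : Fin r → A) (h1 : v i = w i * s) (h1' : w j = s * v j)
    (h2 : ∀ t : Fin r, (t : ℕ) ≠ i → (t : ℕ) ≠ j → v t = w t) :
    φ v = φ w := by
  have hne : i ≠ j := fun h => by subst h; omega
  have key := h.balanced i j hij s hs (Function.update v i (w i))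
  convert key using 2
  · ext t
    by_cases ht : t = i
    · subst ht; simp [h1]
    · simp [ht]
  · ext t
    by_cases ht : t = j
    · subst ht; simp [h1', hne.symm]
    · by_cases ht' : t = i
      · subst ht'; simp [ht]
      · simp [ht, ht', h2 t (fun h => ht' (Fin.ext h)) (fun h => ht (Fin.ext h))]

end IsRelCochain

end Relative
section Stable

variable {k A N : Type*} [CommRing k] [Ring A] [Algebra k A] [AddCommGroup N] [Module k N]
variable {S : Subalgebra k A} {L R : A →ₗ[k] Module.End k N} {r : ℕ}
    {φ : MultilinearMap k (fun _ : Fin r => A) N}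

theorem IsRelCochain.hochschildD (hL : ∀ a b n, L (a * b) n = L a (L b n))
    (hR : ∀ a b n, R (a * b) n = R b (R a n)) (hLR : ∀ a b n, L a (R b n) = R b (L a n))
    (h : IsRelCochain S L R φ) : IsRelCochain S L R (hochschildD L R r φ) where
  map_left i hi s hs a := by
    have hi0 : i = 0 := Fin.ext hi
    subst hi0
    simp only [hochschildD_apply, map_add, map_sum, map_smul]
    congr 1
    · congr 1
      · simp [hL]
      · refine Finset.sum_congr rfl fun j _ => ?_
        have hj := j.2
        congr 1
        refine h.map_left' ⟨0, by omega⟩ rfl s hs _ _ ?_ ?_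
        · simp only [Fin.contractNth, Function.update_apply, Fin.ext_iff, Fin.val_castSucc,
            Fin.val_succ, Fin.val_zero]
          grind [Fin.castSucc_mk, Fin.mk_zero]
        · intro t ht
          simp only [Fin.contractNth, Function.update_apply, Fin.ext_iff, Fin.val_castSucc,
            Fin.val_succ, Fin.val_zero]
          grind
    · congr 1
      by_cases hr : r = 0
      · subst hr
        simp [hR]
        rw [hLR, h.central rfl s hs]
        congr 3
        exact Subsingleton.elim _ _
      · rw [hLR]
        congr 1
        · simp [Function.update_apply, Fin.ext_iff, hr]
        · refine h.map_left' ⟨0, by omega⟩ rfl s hs _ _ ?_ ?_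
          · simp [Function.update_apply, Fin.ext_iff]
          · intro t ht
            simp at ht
            simp [Function.update_apply, Fin.ext_iff, ht]
  map_right i hi s hs a := by
    have hi0 : i = Fin.last r := Fin.ext (by simpa using hi)
    subst hi0
    simp only [hochschildD_apply, map_add, map_sum, map_smul]
    congr 1
    · congr 1
      · by_cases hr : r = 0
        · subst hr
          simp [hL]
          rw [← hLR, ← h.central rfl s hs]
        · rw [← hLR]
          have h0 : (0 : ℕ) ≠ r := fun h => hr h.symm
          congr 2
          · simp [Function.update_apply, Fin.ext_iff, h0]
          · refine h.map_right' ⟨r - 1, by omega⟩ (by simp; omega) s hs _ _ ?_ ?_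
            · simp only [Function.update_apply, Fin.ext_iff, Fin.val_succ, Fin.val_last]
              grind
            · intro t ht
              simp only [Function.update_apply, Fin.ext_iff, Fin.val_succ, Fin.val_last]
              grind
      · refine Finset.sum_congr rfl fun j _ => ?_
        have hj := j.2
        congr 1
        refine h.map_right' ⟨r - 1, by omega⟩ (by simp; omega) s hs _ _ ?_ ?_
        · simp only [Fin.contractNth, Function.update_apply, Fin.ext_iff, Fin.val_castSucc,
            Fin.val_succ, Fin.val_last]
          grind
        · intro t ht
          simp only [Fin.contractNth, Function.update_apply, Fin.ext_iff, Fin.val_castSucc,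
            Fin.val_succ, Fin.val_last]
          grind
    · congr 1
      simp [hR, Function.update_apply, Fin.ext_iff, (Nat.ne_of_lt (Fin.is_lt _))]
  balanced i j hij s hs a := by
    have hj := j.2
    simp only [hochschildD_apply]
    congr 1
    · congr 1
      · by_cases hi : (i : ℕ) = 0
        · have hi0 : i = 0 := Fin.ext hi
          subst hi0
          have hj0 : (0 : ℕ) ≠ j := by omega
          have e : (φ fun t => Function.update a j (s * a j) t.succ) =
              L s (φ fun t => Function.update a 0 (a 0 * s) t.succ) := by
            refine h.map_left' ⟨0, by omega⟩ rfl s hs _ _ ?_ ?_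
            · simp only [Function.update_apply, Fin.ext_iff, Fin.val_succ, Fin.val_zero]
              grind
            · intro t ht
              simp only [Function.update_apply, Fin.ext_iff, Fin.val_succ, Fin.val_zero]
              grind
          rw [e, ← hL]
          simp [Fin.ext_iff, hj0]
        · have h0 : (0 : ℕ) ≠ i := fun h => hi h.symm
          have h0' : (0 : ℕ) ≠ j := by omega
          congr 1
          · simp [Fin.ext_iff, h0, h0']
          · refine h.balanced' ⟨i - 1, by omega⟩ ⟨i, by omega⟩ (by simp; omega) s hs _ _ ?_ ?_ ?_
            · simp only [Function.update_apply, Fin.ext_iff, Fin.val_succ]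
              grind
            · simp only [Function.update_apply, Fin.ext_iff, Fin.val_succ]
              grind
            · intro t ht ht'
              simp only [Function.update_apply, Fin.ext_iff, Fin.val_succ]
              grind
      · refine Finset.sum_congr rfl fun t _ => ?_
        have ht := t.2
        congr 1
        rcases lt_trichotomy (t : ℕ) (i : ℕ) with hti | hti | hti
        · refine h.balanced' ⟨i - 1, by omega⟩ ⟨i, by omega⟩ (by simp; omega) s hs _ _ ?_ ?_ ?_
          · simp only [Fin.contractNth, Function.update_apply, Fin.ext_iff, Fin.val_castSucc,
              Fin.val_succ]
            grind
          · simp only [Fin.contractNth, Function.update_apply, Fin.ext_iff, Fin.val_castSucc,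
              Fin.val_succ]
            grind
          · intro u hu hu'
            simp only [Fin.contractNth, Function.update_apply, Fin.ext_iff, Fin.val_castSucc,
              Fin.val_succ]
            grind
        · congr 1
          ext u
          have hi0 : i = t.castSucc := Fin.ext hti.symm
          have hj0 : j = t.succ := Fin.ext (by simp; omega)
          subst hi0 hj0
          by_cases hu : u = t
          · subst hu; simp [Fin.contractNth, Fin.ext_iff, mul_assoc]
          · have hu' : (u : ℕ) ≠ t := fun e => hu (Fin.ext e)
            simp only [Fin.contractNth, Function.update_apply, Fin.ext_iff, Fin.val_castSucc,
              Fin.val_succ]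
            grind
        · have p1 : (i : ℕ) < r := by omega
          have p2 : (i : ℕ) + 1 < r := by omega
          have e1 : Fin.castSucc (⟨i, p1⟩ : Fin r) = i := rfl
          have e2 : Fin.succ (⟨i, p1⟩ : Fin r) = j := Fin.ext hij.symm
          have e3 : Fin.castSucc (⟨i + 1, p2⟩ : Fin r) = j := Fin.ext hij.symm
          refine h.balanced' ⟨i, p1⟩ ⟨i + 1, p2⟩ (by simp) s hs _ _ ?_ ?_ ?_
          · simp only [Fin.contractNth, Function.update_apply, Fin.ext_iff, Fin.val_castSucc,
              Fin.val_succ]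
            grind
          · simp only [Fin.contractNth, Function.update_apply, Fin.ext_iff, Fin.val_castSucc,
              Fin.val_succ]
            grind
          · intro u hu hu'
            simp only [Fin.contractNth, Function.update_apply, Fin.ext_iff, Fin.val_castSucc,
              Fin.val_succ]
            grind
    · congr 1
      by_cases hjr : (j : ℕ) = r
      · have hj0 : j = Fin.last r := Fin.ext hjr
        subst hj0
        have hi0 : r ≠ (i : ℕ) := by omega
        have e : (φ fun t => Function.update a i (a i * s) t.castSucc) =
            R s (φ fun t => Function.update a (Fin.last r) (s * a (Fin.last r)) t.castSucc) := by
          have p1 : (i : ℕ) < r := by omega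
          have e1 : Fin.castSucc (⟨i, p1⟩ : Fin r) = i := rfl
          refine h.map_right' ⟨i, p1⟩ (by simp; omega) s hs _ _ ?_ ?_
          · simp only [Function.update_apply, Fin.ext_iff, Fin.val_castSucc, Fin.val_last]
            grind
          · intro t ht
            simp only [Function.update_apply, Fin.ext_iff, Fin.val_castSucc, Fin.val_last]
            grind
        rw [e, ← hR]
        simp [Fin.ext_iff, hi0]
      · have h0 : r ≠ (i : ℕ) := by omega
        have h0' : r ≠ (j : ℕ) := by omega
        congr 1
        · simp [Fin.ext_iff, h0, h0']
        · have p1 : (i : ℕ) < r := by omega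
          have p2 : (j : ℕ) < r := by omega
          have e1 : Fin.castSucc (⟨i, p1⟩ : Fin r) = i := rfl
          have e2 : Fin.castSucc (⟨j, p2⟩ : Fin r) = j := rfl
          refine h.balanced' ⟨i, p1⟩ ⟨j, p2⟩ (by simp; omega) s hs _ _ ?_ ?_ ?_
          · simp only [Function.update_apply, Fin.ext_iff, Fin.val_castSucc]
            grind
          · simp only [Function.update_apply, Fin.ext_iff, Fin.val_castSucc]
            grind
          · intro t ht ht'
            simp only [Function.update_apply, Fin.ext_iff, Fin.val_castSucc]
            grind
  normalized i a hi := by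
    have hi' := i.2
    -- the `m`-th face of `φ` at `a`
    let F : ℕ → N := fun m =>
      if m = 0 then L (a 0) (φ fun t => a t.succ)
      else if hm : m - 1 < r then
        φ (Fin.contractNth (Fin.castSucc ⟨m - 1, hm⟩) (· * ·) a)
      else R (a (Fin.last r)) (φ fun t => a t.castSucc)
    have hsum : HopfCrossed.hochschildD L R r φ a =
        ∑ m ∈ Finset.range (r + 2), (-1 : k) ^ m • F m := by
      rw [hochschildD_apply, Finset.sum_range_succ, Finset.sum_range_succ', ← Fin.sum_univ_eq_sum_range
        (fun m => (-1 : k) ^ (m + 1) • F (m + 1))]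
      rw [add_comm (∑ _ : Fin r, _) ((-1 : k) ^ 0 • F 0)]
      simp [F]
      rfl
    have hzero : ∀ m, m < r + 2 → m ≠ i → m ≠ i + 1 → F m = 0 := by
      intro m hm h1 h2
      by_cases h0 : m = 0
      · simp only [F, h0, if_true]
        rw [h.normalized ⟨i - 1, by omega⟩ _ _, map_zero]
        have e1 : Fin.succ (⟨i - 1, by omega⟩ : Fin r) = i := Fin.ext (by simp; omega)
        rwa [e1]
      · by_cases hmr : m - 1 < r
        · simp only [F, h0, if_false, hmr, dif_pos]
          by_cases him : (i : ℕ) < m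
          · have p1 : (i : ℕ) < r := by omega
            have e1 : Fin.castSucc (⟨i, p1⟩ : Fin r) = i := rfl
            refine h.normalized ⟨i, p1⟩ _ ?_
            convert hi
            simp only [Fin.contractNth]
            grind
          · have p1 : (i : ℕ) - 1 < r := by omega
            have e1 : Fin.succ (⟨i - 1, p1⟩ : Fin r) = i := Fin.ext (by simp; omega)
            refine h.normalized ⟨i - 1, p1⟩ _ ?_
            convert hi
            simp only [Fin.contractNth]
            grind
        · simp only [F, h0, if_false, hmr, dif_neg, not_false_eq_true]
          rw [h.normalized ⟨i, by omega⟩ _ _, map_zero]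
          exact hi
    have heq : F i = F (i + 1) := by
      by_cases h0 : (i : ℕ) = 0
      · have hi0 : i = 0 := Fin.ext h0
        subst hi0
        by_cases hr : r = 0
        · subst hr
          simp only [F]
          simp only [Fin.val_zero, if_true, Nat.lt_irrefl, dif_neg, not_false_eq_true, zero_add,
            one_ne_zero, if_false, Nat.sub_self]
          rw [h.central rfl _ hi]
          congr 2
          exact Subsingleton.elim _ _
        · have hr' : 0 < r := Nat.pos_of_ne_zero hr
          simp only [F]
          simp only [Fin.val_zero, if_true, zero_add, one_ne_zero, if_false, Nat.sub_self, hr',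
            dif_pos]
          refine (h.map_left' ⟨0, hr'⟩ rfl _ hi _ _ ?_ ?_).symm
          · simp [Fin.contractNth, Fin.ext_iff]
          · intro t ht
            simp only [Fin.contractNth]
            grind
      · have h1 : (i : ℕ) - 1 < r := by omega
        by_cases hir : (i : ℕ) < r
        · simp only [F, h0, if_false, h1, dif_pos, Nat.add_sub_cancel, hir, Nat.succ_ne_zero]
          refine h.balanced' ⟨i - 1, h1⟩ ⟨i, hir⟩ (by simp; omega) _ hi _ _ ?_ ?_ ?_
          · simp only [Fin.contractNth]
            grind
          · simp only [Fin.contractNth]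
            grind
          · intro t ht ht'
            simp only [Fin.contractNth]
            grind
        · have hil : i = Fin.last r := Fin.ext (by simp; omega)
          simp only [F, h0, if_false, h1, dif_pos, Nat.add_sub_cancel, hir, dif_neg,
            not_false_eq_true, Nat.succ_ne_zero]
          rw [← hil]
          refine h.map_right' ⟨i - 1, h1⟩ (by simp; omega) _ hi _ _ ?_ ?_
          · simp only [Fin.contractNth]
            grind
          · intro t ht
            simp only [Fin.contractNth]
            grind
    rw [hsum, Finset.sum_eq_add (i : ℕ) (i + 1) (by omega)
      (fun m hm hne => by
        rw [hzero m (Finset.mem_range.mp hm) hne.1 hne.2, smul_zero])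
      (fun h => absurd (Finset.mem_range.mpr (by omega)) h)
      (fun h => absurd (Finset.mem_range.mpr (by omega)) h), heq, ← add_smul]
    simp [pow_succ]
  central h0 := by omega

end Stable
section Sweedler2

variable {k H V W : Type*} [CommRing k] [AddCommGroup H] [Module k H] [Coalgebra k H]
  [AddCommGroup V] [Module k V] [AddCommGroup W] [Module k W]

theorem comp_sweedler (g : V →ₗ[k] W) (β : H →ₗ[k] H →ₗ[k] V) :
    g ∘ₗ sweedler β = sweedler (β.compr₂ g) := by
  ext h
  simp [sweedler_repr _ (Coalgebra.Repr.arbitrary k h)]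

theorem sweedler_coassoc (T : H →ₗ[k] H →ₗ[k] H →ₗ[k] V) :
    sweedler (sweedler ∘ₗ T) = sweedler (sweedler T) := by
  have key : ∀ z : H ⊗[k] H ⊗[k] H,
      TensorProduct.lift (TensorProduct.lift T) z =
      TensorProduct.lift ((TensorProduct.lift.equiv (.id k) H H V).toLinearMap ∘ₗ T)
        (TensorProduct.assoc k H H H z) := by
    intro z
    rw [← LinearEquiv.coe_toLinearMap, ← LinearMap.comp_apply]
    congr 1
    ext
    simp
  have h1 : ∀ z : H ⊗[k] H, TensorProduct.lift (sweedler T) z =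
      TensorProduct.lift (TensorProduct.lift T) ((Coalgebra.comul (R := k)).rTensor H z) := by
    intro z
    rw [← LinearMap.comp_apply]
    congr 1
    ext
    simp [sweedler_apply]
  have h2 : ∀ z : H ⊗[k] H, TensorProduct.lift (sweedler ∘ₗ T) z =
      TensorProduct.lift ((TensorProduct.lift.equiv (.id k) H H V).toLinearMap ∘ₗ T)
        ((Coalgebra.comul (R := k)).lTensor H z) := by
    intro z
    rw [← LinearMap.comp_apply]
    congr 1
    ext
    simp [sweedler_apply]
    rfl
  ext h
  rw [sweedler_apply, sweedler_apply, h1, h2, key, Coalgebra.coassoc_apply]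

end Sweedler2

section Twist

variable {k A H M : Type*} [CommRing k] [Ring A] [Algebra k A] [AddCommGroup H] [Module k H]
  [Coalgebra k H] [AddCommGroup M] [Module k M]

/-- Postcomposition of a multilinear map with an endomorphism of the target. -/
def postComp (r : ℕ) : Module.End k M →ₗ[k]
    MultilinearMap k (fun _ : Fin r => A) M →ₗ[k] MultilinearMap k (fun _ : Fin r => A) M :=
  LinearMap.mk₂ k (fun g φ => g.compMultilinearMap φ)
    (fun _ _ _ => by ext; simp) (fun _ _ _ => by ext; simp)
    (fun _ _ _ => by ext; simp) (fun _ _ _ => by ext; simp)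

@[simp] theorem postComp_apply (r : ℕ) (g : Module.End k M)
    (φ : MultilinearMap k (fun _ : Fin r => A) M) (a : Fin r → A) :
    postComp r g φ a = g (φ a) := rfl

/-- `(twist act G r φ h)(a₁, …, aᵣ) = G(h⁽ʳ⁺¹⁾) (φ(a₁^{h⁽¹⁾}, …, aᵣ^{h⁽ʳ⁾}))`, by recursion on `r`:
the first argument is acted upon by `h⁽¹⁾`, and `h⁽²⁾` is passed on to the others. -/
def twist (act : H →ₗ[k] A →ₗ[k] A) (G : H →ₗ[k] Module.End k M) : ∀ r : ℕ,
    MultilinearMap k (fun _ : Fin r => A) M →ₗ[k] H →ₗ[k] MultilinearMap k (fun _ : Fin r => A) M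
  | 0 => (postComp 0 ∘ₗ G).flip
  | r + 1 => LinearMap.mk₂ k
      (fun φ h => LinearMap.uncurryLeft (M := fun _ : Fin (r + 1) => A)
        ⟨⟨fun a => sweedler (twist act G r ∘ₗ φ.curryLeft ∘ₗ act.flip a) h,
          fun a b => by simp [LinearMap.comp_add]⟩,
          fun c a => by simp [LinearMap.comp_smul]⟩)
      (fun φ ψ h => by
        ext a
        have : (φ + ψ).curryLeft = φ.curryLeft + ψ.curryLeft := rfl
        simp [this, LinearMap.comp_add, LinearMap.add_comp])
      (fun c φ h => by
        ext a
        have : (c • φ).curryLeft = c • φ.curryLeft := rfl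
        simp [this, LinearMap.comp_smul, LinearMap.smul_comp])
      (fun φ h l => by ext a; simp)
      (fun c φ h => by ext a; simp)

/-- `(diagonalAct act P G r h φ)(a₁, …, aᵣ) = P(h⁽¹⁾) G(h⁽ʳ⁺²⁾) (φ(a₁^{h⁽²⁾}, …, aᵣ^{h⁽ʳ⁺¹⁾}))`, where
`P` and `G` are linear maps from `H` to the endomorphisms of the target. -/
def diagonalAct (act : H →ₗ[k] A →ₗ[k] A) (P G : H →ₗ[k] Module.End k M) (r : ℕ) :
    H →ₗ[k] MultilinearMap k (fun _ : Fin r => A) M →ₗ[k]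
      MultilinearMap k (fun _ : Fin r => A) M :=
  LinearMap.flip <| sweedler ∘ₗ
    ⟨⟨fun φ => (postComp r ∘ₗ P).compl₂ (twist act G r φ), fun φ ψ => by ext; simp⟩,
      fun c φ => by ext; simp⟩

variable {act : H →ₗ[k] A →ₗ[k] A} {P G : H →ₗ[k] Module.End k M}

/-- evaluation of a multilinear map -/
def evalAt {r : ℕ} (a : Fin r → A) : MultilinearMap k (fun _ : Fin r => A) M →ₗ[k] M where
  toFun φ := φ a
  map_add' _ _ := rfl
  map_smul' _ _ := rfl

theorem twist_zero (φ : MultilinearMap k (fun _ : Fin 0 => A) M) (h : H) (a : Fin 0 → A) :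
    twist act G 0 φ h a = G h (φ a) := rfl

theorem twist_succ {r : ℕ} (φ : MultilinearMap k (fun _ : Fin (r + 1) => A) M) (h : H)
    (a : Fin (r + 1) → A) :
    twist act G (r + 1) φ h a =
      sweedler (((twist act G r ∘ₗ φ.curryLeft).compr₂ (evalAt (Fin.tail a))) ∘ₗ act.flip (a 0)) h := by
  simp [twist, sweedler_repr _ (Coalgebra.Repr.arbitrary k h), evalAt]

theorem diagonalAct_apply {r : ℕ} (φ : MultilinearMap k (fun _ : Fin r => A) M) (h : H)
    (a : Fin r → A) :
    diagonalAct act P G r h φ a = sweedler (P.compl₂ (evalAt a ∘ₗ twist act G r φ)) h := by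
  simp [diagonalAct, sweedler_repr _ (Coalgebra.Repr.arbitrary k h), evalAt]


/-- `(x, b₁, …) ↦ ψ(s x, b₁, …)` -/
def mulFirst {r : ℕ} (ψ : MultilinearMap k (fun _ : Fin (r + 1) => A) M) :
    A →ₗ[k] MultilinearMap k (fun _ : Fin (r + 1) => A) M where
  toFun s := LinearMap.uncurryLeft (M := fun _ : Fin (r + 1) => A)
    (ψ.curryLeft ∘ₗ LinearMap.mulLeft k s)
  map_add' s t := by ext; simp [add_mul]
  map_smul' c s := by ext; simp

theorem act_mul_sweedler
    (hact : ∀ a b : A, toConv (act.flip (a * b)) = toConv (act.flip a) * toConv (act.flip b))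
    (a b : A) :
    act.flip (a * b) = sweedler ((LinearMap.mul k A).compl₁₂ (act.flip a) (act.flip b)) := by
  ext h
  have := congrArg (fun g => g h) (hact a b)
  simp only [LinearMap.convMul_apply] at this
  simp only [sweedler_repr _ (Coalgebra.Repr.arbitrary k h)]
  change act.flip (a * b) h = _ at this
  rw [this, ← (Coalgebra.Repr.arbitrary k h).eq]
  simp

theorem sweedler_act_mul {V : Type*} [AddCommGroup V] [Module k V]
    (hact : ∀ a b : A, toConv (act.flip (a * b)) = toConv (act.flip a) * toConv (act.flip b))
    (a b : A) (Λ : A →ₗ[k] H →ₗ[k] V) :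
    sweedler (Λ ∘ₗ act.flip (a * b)) =
      sweedler (sweedler ∘ₗ ((LinearMap.mul k A).compl₁₂ (act.flip a) (act.flip b)).compr₂ Λ) := by
  rw [act_mul_sweedler hact, comp_sweedler, sweedler_coassoc]

theorem twist_mul_first
    (hact : ∀ a b : A, toConv (act.flip (a * b)) = toConv (act.flip a) * toConv (act.flip b))
    {r : ℕ} (ψ : MultilinearMap k (fun _ : Fin (r + 1) => A) M) (h : H)
    (a b : Fin (r + 1) → A) (s : A) (hb0 : b 0 = s * a 0) (hb : Fin.tail b = Fin.tail a) :
    twist act G (r + 1) ψ h b =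
      sweedler (((twist act G (r + 1)).compr₂ (evalAt a) ∘ₗ mulFirst ψ) ∘ₗ act.flip s) h := by
  rw [twist_succ, hb0, hb, sweedler_act_mul hact]
  congr 2
  ext h1 h2
  simp only [LinearMap.comp_apply, LinearMap.compr₂_apply]
  change _ = twist act G (r + 1) (mulFirst ψ (act h1 s)) h2 a
  rw [twist_succ]
  congr 2

end Twist
section Preserve

variable {k A H M : Type*} [CommRing k] [Ring A] [Algebra k A] [AddCommGroup H] [Module k H]
  [Coalgebra k H] [AddCommGroup M] [Module k M]
variable {act : H →ₗ[k] A →ₗ[k] A} {P G : H →ₗ[k] Module.End k M}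
variable {S : Subalgebra k A} {L R : A →ₗ[k] Module.End k M}

theorem twist_normalized (hS : ∀ h, ∀ s ∈ S, act h s ∈ S) {r : ℕ}
    (φ : MultilinearMap k (fun _ : Fin r => A) M)
    (hφ : ∀ i : Fin r, ∀ a : Fin r → A, a i ∈ S → φ a = 0)
    (h : H) (i : Fin r) (a : Fin r → A) (ha : a i ∈ S) : twist act G r φ h a = 0 := by
  induction r generalizing h with
  | zero => exact i.elim0
  | succ r ih =>
    rw [twist_succ]
    suffices e : (((twist act G r ∘ₗ φ.curryLeft).compr₂ (evalAt (Fin.tail a))) ∘ₗ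
        act.flip (a 0)) = 0 by rw [e]; simp
    ext h1 h2
    change twist act G r (φ.curryLeft (act h1 (a 0))) h2 (Fin.tail a) = 0
    refine Fin.cases (fun ha => ?_) (fun i ha => ?_) i ha
    · have : φ.curryLeft (act h1 (a 0)) = 0 := by
        ext b
        exact hφ 0 _ (by simpa using hS h1 _ ha)
      rw [this]; simp
    · refine ih _ (fun j b hb => ?_) h2 i _ ha
      exact hφ j.succ _ (by simpa using hb)

theorem twist_balanced
    (hact : ∀ a b : A, toConv (act.flip (a * b)) = toConv (act.flip a) * toConv (act.flip b))
    {r : ℕ} (φ : MultilinearMap k (fun _ : Fin r => A) M) (s : A) (T : Set A)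
    (hT : s ∈ T) (hS : ∀ h, ∀ s ∈ T, act h s ∈ T)
    (hφ : ∀ i j : Fin r, (j : ℕ) = i + 1 → ∀ s ∈ T, ∀ a : Fin r → A,
      φ (Function.update a i (a i * s)) = φ (Function.update a j (s * a j)))
    (h : H) (i j : Fin r) (hij : (j : ℕ) = i + 1) (a : Fin r → A) :
    twist act G r φ h (Function.update a i (a i * s)) =
      twist act G r φ h (Function.update a j (s * a j)) := by
  induction r generalizing h with
  | zero => exact i.elim0
  | succ r ih =>
    obtain ⟨j, rfl⟩ : ∃ j' : Fin r, j = j'.succ :=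
      ⟨⟨j - 1, by have := j.2; omega⟩, Fin.ext (by simp; omega)⟩
    by_cases hi : (i : ℕ) = 0
    · obtain rfl : i = 0 := Fin.ext hi
      have hj0 : (j : ℕ) = 0 := by simpa using hij
      obtain ⟨r, rfl⟩ : ∃ r', r = r' + 1 := ⟨r - 1, by have := j.2; omega⟩
      obtain rfl : j = 0 := Fin.ext hj0
      rw [twist_succ, twist_succ]
      simp only [Function.update_self, Fin.tail_update_zero]
      rw [sweedler_act_mul hact]
      congr 2
      ext h1 : 1
      have e : Function.update a (Fin.succ 0) (s * a (Fin.succ 0)) 0 = a 0 := by simp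
      rw [e]
      ext h2
      simp only [Fin.tail_update_succ]
      change _ = twist act G (r + 1) (φ.curryLeft (act h1 (a 0))) h2
        (Function.update (Fin.tail a) 0 (s * (Fin.tail a) 0))
      rw [twist_mul_first hact _ h2 (Fin.tail a) _ s (by simp) (by simp)]
      simp only [LinearMap.comp_apply]
      congr 2
      ext h3 h4
      change twist act G (r + 1) (φ.curryLeft (act h1 (a 0) * act h3 s)) h4 (Fin.tail a) =
        twist act G (r + 1) (mulFirst (φ.curryLeft (act h1 (a 0))) (act h3 s)) h4 (Fin.tail a)
      congr 3
      ext b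
      have := hφ 0 (Fin.succ 0) rfl _ (hS h3 s hT) (Fin.cons (act h1 (a 0)) b)
      simp only [Fin.cons_zero, Fin.update_cons_zero, Fin.cons_succ, ← Fin.cons_update] at this
      change φ (Fin.cons _ b) = φ (Fin.cons _ (Fin.cons (act h3 s * b 0) (Fin.tail b)))
      rw [this]
      congr 2
      nth_rewrite 1 [← Fin.cons_self_tail b]
      rw [Fin.update_cons_zero]
    · obtain ⟨i, rfl⟩ : ∃ i' : Fin r, i = i'.succ :=
        ⟨⟨i - 1, by have := i.2; omega⟩, Fin.ext (by simp; omega)⟩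
      rw [twist_succ, twist_succ]
      have e : ∀ (t : Fin r) (x : A), Function.update a t.succ x 0 = a 0 :=
        fun t x => Function.update_of_ne (Fin.succ_ne_zero t).symm _ _
      rw [e, e]
      congr 2
      ext h1 h2
      simp only [Fin.tail_update_succ]
      refine ih (φ.curryLeft (act h1 (a 0))) (fun i j hij s hs b => ?_) h2 i j (by simpa using hij)
        (Fin.tail a)
      have := hφ i.succ j.succ (by simpa using hij) s hs (Fin.cons (act h1 (a 0)) b)
      simp only [← Fin.cons_update, Fin.cons_succ] at this
      exact this

theorem twist_postComp (T : Module.End k M) (hT : ∀ h m, G h (T m) = T (G h m)) {r : ℕ}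
    (φ : MultilinearMap k (fun _ : Fin r => A) M) (h : H) (a : Fin r → A) :
    twist act G r (postComp r T φ) h a = T (twist act G r φ h a) := by
  induction r generalizing h with
  | zero => simp [twist_zero, hT]
  | succ r ih =>
    rw [twist_succ, twist_succ, ← LinearMap.comp_apply, comp_sweedler]
    congr 2
    ext h1 h2
    exact ih (φ.curryLeft (act h1 (a 0))) h2 (Fin.tail a)

theorem twist_right
    (hact : ∀ a b : A, toConv (act.flip (a * b)) = toConv (act.flip a) * toConv (act.flip b))
    {r : ℕ} (φ : MultilinearMap k (fun _ : Fin r => A) M) (s : A) (T : Set A)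
    (hT : s ∈ T) (hS : ∀ h, ∀ s ∈ T, act h s ∈ T)
    (hGR : sweedler ((LinearMap.mul k (Module.End k M)).flip.compl₁₂ (R ∘ₗ act.flip s) G) =
      LinearMap.mulLeft k (R s) ∘ₗ G)
    (hφ : ∀ i : Fin r, (i : ℕ) + 1 = r → ∀ s ∈ T, ∀ a : Fin r → A,
      φ (Function.update a i (a i * s)) = R s (φ a))
    (h : H) (i : Fin r) (hi : (i : ℕ) + 1 = r) (a : Fin r → A) :
    twist act G r φ h (Function.update a i (a i * s)) = R s (twist act G r φ h a) := by
  induction r generalizing h with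
  | zero => exact i.elim0
  | succ r ih =>
    by_cases hr : r = 0
    · subst hr
      obtain rfl : i = 0 := Fin.ext (by simp)
      rw [twist_succ, twist_succ]
      simp only [Function.update_self, Fin.tail_update_zero]
      rw [sweedler_act_mul hact, ← LinearMap.comp_apply, comp_sweedler]
      congr 2
      ext h1 h2
      have e := congrArg (fun g => g h2 (φ (fun _ => act h1 (a 0)))) hGR
      simp only [LinearMap.comp_apply, LinearMap.mulLeft_apply, Module.End.mul_apply] at e
      have e2 : ∀ x : A, φ (Fin.cons x (Fin.tail a)) = φ (fun _ => x) := by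
        intro x; congr 1; ext t; obtain rfl : t = 0 := Fin.ext (by simp); rfl
      change _ = R s (G h2 (φ (Fin.cons (act h1 (a 0)) (Fin.tail a))))
      rw [e2, ← e]
      simp only [LinearMap.comp_apply]
      simp only [sweedler_repr _ (Coalgebra.Repr.arbitrary k h2), LinearMap.sum_apply]
      refine Finset.sum_congr rfl fun t _ => ?_
      change G _ (φ (Fin.cons (act h1 (a 0) * act _ s) (Fin.tail a))) = G _ (R (act _ s) _)
      congr 1
      rw [← hφ 0 rfl _ (hS _ _ hT)]
      congr 1
      ext u
      obtain rfl : u = 0 := Fin.ext (by simp)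
      simp
    · obtain ⟨i, rfl⟩ : ∃ i' : Fin r, i = i'.succ :=
        ⟨⟨i - 1, by have := i.2; omega⟩, Fin.ext (by simp; omega)⟩
      rw [twist_succ, twist_succ, ← LinearMap.comp_apply, comp_sweedler]
      have e : ∀ (t : Fin r) (x : A), Function.update a t.succ x 0 = a 0 :=
        fun t x => Function.update_of_ne (Fin.succ_ne_zero t).symm _ _
      rw [e]
      congr 2
      ext h1 h2
      simp only [Fin.tail_update_succ]
      refine ih (φ.curryLeft (act h1 (a 0))) (fun i hi s hs b => ?_) h2 i (by simpa using hi)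
        (Fin.tail a)
      have := hφ i.succ (by simpa using hi) s hs (Fin.cons (act h1 (a 0)) b)
      simp only [← Fin.cons_update, Fin.cons_succ] at this
      exact this


theorem IsRelCochain.diagonalAct
    (hact : ∀ a b : A, toConv (act.flip (a * b)) = toConv (act.flip a) * toConv (act.flip b))
    (hS : ∀ h, ∀ s ∈ S, act h s ∈ S)
    (hPL : ∀ s ∈ S, sweedler ((LinearMap.mul k (Module.End k M)).compl₁₂ P (L ∘ₗ act.flip s)) =
      LinearMap.mulLeft k (L s) ∘ₗ P)
    (hGR : ∀ s ∈ S,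
      sweedler ((LinearMap.mul k (Module.End k M)).flip.compl₁₂ (R ∘ₗ act.flip s) G) =
        LinearMap.mulLeft k (R s) ∘ₗ G)
    (hGL : ∀ h a m, G h (L a m) = L a (G h m)) (hPR : ∀ h a m, P h (R a m) = R a (P h m))
    {r : ℕ} {φ : MultilinearMap k (fun _ : Fin r => A) M} (hφ : IsRelCochain S L R φ) (h : H) :
    IsRelCochain S L R (HopfCrossed.diagonalAct act P G r h φ) where
  map_left i hi s hs a := by
    obtain ⟨r, rfl⟩ : ∃ r', r = r' + 1 := ⟨r - 1, by have := i.2; omega⟩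
    obtain rfl : i = 0 := Fin.ext hi
    rw [diagonalAct_apply, diagonalAct_apply, ← LinearMap.comp_apply, comp_sweedler]
    have e : evalAt (Function.update a 0 (s * a 0)) ∘ₗ twist act G (r + 1) φ =
        sweedler ((L ∘ₗ act.flip s).compl₂ (evalAt a ∘ₗ twist act G (r + 1) φ)) := by
      ext h1
      change twist act G (r + 1) φ h1 (Function.update a 0 (s * a 0)) = _
      rw [twist_mul_first hact φ h1 a _ s (by simp) (by simp)]
      congr 2
      ext h2 h3
      change twist act G (r + 1) (mulFirst φ (act h2 s)) h3 a =
        L (act h2 s) (twist act G (r + 1) φ h3 a)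
      rw [← twist_postComp (L (act h2 s)) (fun h m => hGL h _ m)]
      congr 3
      ext b
      have := hφ.map_left 0 rfl _ (hS h2 s hs) b
      change φ (Fin.cons (act h2 s * b 0) (Fin.tail b)) = L (act h2 s) (φ b)
      rw [← this]
      congr 1
      nth_rewrite 3 [← Fin.cons_self_tail b]
      rw [Fin.update_cons_zero]
    rw [e]
    have e2 : P.compl₂ (sweedler ((L ∘ₗ act.flip s).compl₂ (evalAt a ∘ₗ twist act G (r + 1) φ))) =
        sweedler ∘ₗ (((LinearMap.mul k (Module.End k M)).compl₁₂ P (L ∘ₗ act.flip s)).compr₂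
          (LinearMap.lcomp k M (evalAt a ∘ₗ twist act G (r + 1) φ))) := by
      ext h1 h2
      simp [sweedler_repr _ (Coalgebra.Repr.arbitrary k h2)]
    rw [e2, sweedler_coassoc, ← comp_sweedler, hPL s hs]
    congr 2
  map_right i hi s hs a := by
    rw [diagonalAct_apply, diagonalAct_apply, ← LinearMap.comp_apply, comp_sweedler]
    congr 2
    ext h1 h2
    change P h1 (twist act G r φ h2 _) = R s (P h1 (twist act G r φ h2 a))
    rw [twist_right hact φ s S hs hS (hGR s hs) hφ.map_right h2 i hi a, hPR]
  balanced i j hij s hs a := by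
    rw [diagonalAct_apply, diagonalAct_apply]
    congr 3
    ext h1
    exact twist_balanced hact φ s S hs hS hφ.balanced h1 i j hij a
  normalized i a ha := by
    rw [diagonalAct_apply]
    have e : evalAt a ∘ₗ twist act G r φ = 0 := by
      ext h1
      exact twist_normalized hS φ hφ.normalized h1 i a ha
    have e2 : P.compl₂ (0 : H →ₗ[k] M) = 0 := by ext; simp
    rw [e, e2, map_zero, LinearMap.zero_apply]
  central hr s hs a := by
    subst hr
    rw [diagonalAct_apply]
    have e : ∀ g : H →ₗ[k] Module.End k M, evalAt a ∘ₗ twist act g 0 φ =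
        LinearMap.applyₗ (φ a) ∘ₗ g := fun g => by ext; rfl
    have hGR' : LinearMap.applyₗ (φ a) ∘ₗ LinearMap.mulLeft k (R s) ∘ₗ G =
        sweedler ((L ∘ₗ act.flip s).compl₂ (LinearMap.applyₗ (φ a) ∘ₗ G)) := by
      rw [← hGR s hs, comp_sweedler]
      congr 1
      ext h1 h2
      change G h2 (R (act h1 s) (φ a)) = L (act h1 s) (G h2 (φ a))
      rw [← hφ.central rfl _ (hS h1 s hs), hGL]
    have e2 : P.compl₂ (sweedler ((L ∘ₗ act.flip s).compl₂ (LinearMap.applyₗ (φ a) ∘ₗ G))) =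
        sweedler ∘ₗ (((LinearMap.mul k (Module.End k M)).compl₁₂ P (L ∘ₗ act.flip s)).compr₂
          (LinearMap.lcomp k M (LinearMap.applyₗ (φ a) ∘ₗ G))) := by
      ext h1 h2
      simp [sweedler_repr _ (Coalgebra.Repr.arbitrary k h2)]
    have e3 : R s ∘ₗ sweedler (P.compl₂ (LinearMap.applyₗ (φ a) ∘ₗ G)) =
        sweedler (P.compl₂ (LinearMap.applyₗ (φ a) ∘ₗ LinearMap.mulLeft k (R s) ∘ₗ G)) := by
      rw [comp_sweedler]
      congr 1
      ext h1 h2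
      exact (hPR h1 s (G h2 (φ a))).symm
    rw [e, ← LinearMap.comp_apply (R s), e3, hGR', e2, sweedler_coassoc, ← LinearMap.comp_apply,
      comp_sweedler, ← comp_sweedler (LinearMap.lcomp k M _), hPL s hs]
    congr 2

end Preserve
section HCohomology

variable {k H : Type*} [CommRing k] [Ring H] [HopfAlgebra k H]
variable {C : ℕ → Type*} [∀ r, AddCommGroup (C r)] [∀ r, Module k (C r)]

/-- The `n`-cochains `⨁_{r+s=n} Hom_k(H^{⊗ s}, C^r)` of the total complex computing the cohomology
of `H` with coefficients in `(C^r)_r`. -/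
abbrev TotCochain (k H : Type*) [CommRing k] [Ring H] [HopfAlgebra k H]
    (C : ℕ → Type*) [∀ r, AddCommGroup (C r)] [∀ r, Module k (C r)] (n : ℕ) : Type _ :=
  ∀ p : {p : ℕ × ℕ // p.1 + p.2 = n}, MultilinearMap k (fun _ : Fin p.1.2 => H) (C p.1.1)

/-- The component in `Hom_k(H^{⊗ s}, C^r)` of a cochain of the total complex. -/
def cochainProj (n r s : ℕ) (h : r + s = n) :
    TotCochain k H C n →ₗ[k] MultilinearMap k (fun _ : Fin s => H) (C r) where
  toFun x := x ⟨(r, s), h⟩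
  map_add' _ _ := rfl
  map_smul' _ _ := rfl

/-- The coboundary `Hom_k(H^{⊗ s}, C) → Hom_k(H^{⊗ (s+1)}, C)` of the bar complex of a right
`H`-module `C`, whose right action is given by `ρ`:
`(δ ψ)(h₀, …, hₛ) = ε(h₀) ψ(h₁, …, hₛ) + ∑ⱼ (-1)^(j+1) ψ(h₀, …, hⱼ hⱼ₊₁, …, hₛ)
  + (-1)^(s+1) ψ(h₀, …, hₛ₋₁) · hₛ`. -/
def barD {N : Type*} [AddCommGroup N] [Module k N] (ρ : H →ₗ[k] Module.End k N) (s : ℕ) :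
    MultilinearMap k (fun _ : Fin s => H) N →ₗ[k] MultilinearMap k (fun _ : Fin (s + 1) => H) N :=
  hochschildD ((Coalgebra.counit (R := k) (A := H)).smulRight (1 : Module.End k N)) ρ s

/-- The part of the total differential that is induced by the differential `d` of `C`. -/
def totHor (d : ∀ r, C r →ₗ[k] C (r + 1)) (n : ℕ) : ∀ r s : ℕ, r + s = n + 1 →
    (TotCochain k H C n →ₗ[k] MultilinearMap k (fun _ : Fin s => H) (C r))
  | 0, _, _ => 0
  | r + 1, s, h => (d r).compMultilinearMapₗ k ∘ₗ cochainProj n r s (by omega)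

/-- The part of the total differential that is induced by the bar coboundary of `H`, with the
sign `(-1)^r`. -/
def totVer (ρ : ∀ r, H →ₗ[k] Module.End k (C r)) (n : ℕ) : ∀ r s : ℕ, r + s = n + 1 →
    (TotCochain k H C n →ₗ[k] MultilinearMap k (fun _ : Fin s => H) (C r))
  | _, 0, _ => 0
  | r, s + 1, h => (-1 : k) ^ r • (barD (ρ r) s ∘ₗ cochainProj n r s (by omega))

/-- The differential of the total complex. -/
def totD (d : ∀ r, C r →ₗ[k] C (r + 1)) (ρ : ∀ r, H →ₗ[k] Module.End k (C r)) (n : ℕ) :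
    TotCochain k H C n →ₗ[k] TotCochain k H C (n + 1) :=
  LinearMap.pi fun p => totHor d n p.1.1 p.1.2 p.2 + totVer ρ n p.1.1 p.1.2 p.2

/-- `(C, d)`, with the maps `ρ r : H → End(C^r)`, is a cochain complex of right `H`-modules;
here `ρ r h x` is `x · h`. -/
structure IsRightModuleComplex (d : ∀ r, C r →ₗ[k] C (r + 1))
    (ρ : ∀ r, H →ₗ[k] Module.End k (C r)) : Prop where
  d_comp_d : ∀ r x, d (r + 1) (d r x) = 0
  act_one : ∀ r x, ρ r 1 x = x
  act_mul : ∀ r h l x, ρ r (h * l) x = ρ r l (ρ r h x)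
  d_act : ∀ r h x, d r (ρ r h x) = ρ (r + 1) h (d r x)

/-- The cohomology of `H` with coefficients in a cochain complex `(C, d)` of right `H`-modules
(with right actions given by `ρ`): the cohomology of the total complex of the double complex
`Hom_k(H^{⊗ s}, C^r)`. -/
abbrev HopfCohomology (d : ∀ r, C r →ₗ[k] C (r + 1)) (ρ : ∀ r, H →ₗ[k] Module.End k (C r))
    (n : ℕ) : Type _ :=
  Cohomology (totD d ρ) n

end HCohomology

section Bimodule

variable (k B N : Type*) [CommRing k] [Ring B] [Algebra k B] [AddCommGroup N] [Module k N]
  [Module B N] [Module Bᵐᵒᵖ N] [IsScalarTower k B N] [IsScalarTower k Bᵐᵒᵖ N]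

/-- The left action of `B` on a `B`-bimodule, `b ↦ (n ↦ b n)`. -/
def leftMul : B →ₗ[k] Module.End k N := (Algebra.lsmul k k N).toLinearMap

/-- The right action of `B` on a `B`-bimodule, `b ↦ (n ↦ n b)`. -/
def rightMul : B →ₗ[k] Module.End k N :=
  (Algebra.lsmul k k N : Bᵐᵒᵖ →ₐ[k] Module.End k N).toLinearMap ∘ₗ
    (MulOpposite.opLinearEquiv k).toLinearMap

/-- The Hochschild cohomology `H^n(B, N)` of a `k`-algebra `B` with coefficients in a
`B`-bimodule `N`. -/
abbrev HochschildCohomology (n : ℕ) : Type _ :=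
  Cohomology (hochschildD (leftMul k B N) (rightMul k B N)) n

/-- `B` is a separable `k`-algebra: it has a separability idempotent, that is, an element `e` of
`B ⊗ B` with `μ(e) = 1` and `b e = e b` for all `b`. -/
def IsSeparableAlgebra (k B : Type*) [CommRing k] [Ring B] [Algebra k B] : Prop :=
  ∃ e : B ⊗[k] B, LinearMap.mul' k B e = 1 ∧ ∀ b : B, (b ⊗ₜ 1) * e = e * (1 ⊗ₜ b)

end Bimodule

namespace CrossedProduct

variable {k A H : Type*} [CommRing k] [Ring A] [Algebra k A] [Ring H] [HopfAlgebra k H]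
  (X : CrossedProduct k A H)

theorem sum_smul_counit {h : H} {ι : Type*} (R : Coalgebra.Repr k h ι) :
    ∑ i ∈ R.index, Coalgebra.counit (R := k) (R.right i) • R.left i = h := by
  have := congrArg (TensorProduct.rid k H) (Coalgebra.sum_tmul_counit_eq R)
  simp only [map_sum, TensorProduct.rid_tmul, one_smul] at this
  exact this

theorem cocycleMul_one (h : H) : cocycleMul X.f (h ⊗ₜ 1) = 1 ⊗ₜ h := by
  have e := X.crossed_one (1 ⊗ₜ h)
  rw [crossedMul_tmul _ _ _ _ _ _ (Coalgebra.Repr.arbitrary k h)] at e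
  simp only [X.act_one, one_mul, algebraMap_smul] at e
  rw [← e]
  have := congrArg (fun z => cocycleMul X.f (z ⊗ₜ 1))
    (Coalgebra.sum_counit_smul (Coalgebra.Repr.arbitrary k h))
  simp only [TensorProduct.sum_tmul, ← TensorProduct.smul_tmul', map_sum, map_smul] at this
  exact this.symm

theorem inclA_mul_gamma (a : A) (h : H) : X.inclA a * X.gamma h = (a ⊗ₜ h : A ⊗[k] H) := by
  have e := X.one_crossed (1 ⊗ₜ h)
  have key : ∀ a : A, crossedMul X.act X.f (a ⊗ₜ 1) (1 ⊗ₜ h) = a • cocycleMul X.f (1 ⊗ₜ h) := by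
    intro a
    let R : Coalgebra.Repr k (1 : H) Unit := ⟨{()}, fun _ => 1, fun _ => 1, by simp; rfl⟩
    rw [crossedMul_tmul _ _ _ _ _ _ R]
    simp [R, X.one_act]
  rw [key, one_smul] at e
  change crossedMul X.act X.f (a ⊗ₜ 1) (1 ⊗ₜ h) = _
  rw [key, e, TensorProduct.smul_tmul']
  simp

theorem gamma_mul_inclA (h : H) (a : A) :
    X.gamma h * X.inclA a =
      sweedler ((LinearMap.mul k X.E).compl₁₂ (X.inclA ∘ₗ X.act.flip a) X.gamma) h := by
  change crossedMul X.act X.f (1 ⊗ₜ h) (a ⊗ₜ 1) = _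
  rw [crossedMul_tmul _ _ _ _ _ _ (Coalgebra.Repr.arbitrary k h),
    sweedler_repr _ (Coalgebra.Repr.arbitrary k h)]
  refine Finset.sum_congr rfl fun i _ => ?_
  change _ = X.inclA _ * X.gamma _
  rw [inclA_mul_gamma, cocycleMul_one, TensorProduct.smul_tmul']
  simp
  rfl

theorem inclA_mul (a b : A) : X.inclA (a * b) = X.inclA a * X.inclA b := by
  change _ = crossedMul X.act X.f (a ⊗ₜ 1) (b ⊗ₜ 1)
  let R : Coalgebra.Repr k (1 : H) Unit := ⟨{()}, fun _ => 1, fun _ => 1, by simp; rfl⟩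
  rw [crossedMul_tmul _ _ _ _ _ _ R]
  simp only [R, Finset.sum_singleton, X.one_act, cocycleMul_one, TensorProduct.smul_tmul']
  simp [inclA]
  rfl

theorem conv_eq (a : A) :
    toConv (X.inclA ∘ₗ X.act.flip a) * toConv X.gamma =
      toConv X.gamma *
        toConv ((Coalgebra.counit (R := k) (A := H)).smulRight (X.inclA a)) := by
  ext h
  have R := Coalgebra.Repr.arbitrary k h
  have e1 := R.convMul_apply (toConv (X.inclA ∘ₗ X.act.flip a)) (toConv X.gamma)
  have e2 := R.convMul_apply (toConv X.gamma)
    (toConv ((Coalgebra.counit (R := k) (A := H)).smulRight (X.inclA a)))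
  have e3 := X.gamma_mul_inclA h a
  rw [sweedler_repr _ R] at e3
  have e4 : X.gamma h * X.inclA a =
      ∑ i ∈ R.index, X.gamma (R.left i) * (Coalgebra.counit (R := k) (R.right i) • X.inclA a) := by
    nth_rewrite 1 [← sum_smul_counit R]
    simp only [map_sum, map_smul, Finset.sum_mul, smul_mul_assoc, mul_smul_comm]
  exact e1.trans (e3.symm.trans (e4.trans e2.symm))

theorem gammaInv_conv (a : A) :
    toConv X.gammaInv * toConv (X.inclA ∘ₗ X.act.flip a) =
      toConv ((Coalgebra.counit (R := k) (A := H)).smulRight (X.inclA a)) * toConv X.gammaInv := by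
  have hg : toConv X.gammaInv = Ring.inverse (toConv X.gamma) := rfl
  rw [hg]
  by_cases hu : IsUnit (toConv X.gamma)
  · have h1 := Ring.inverse_mul_cancel _ hu
    have h2 := Ring.mul_inverse_cancel _ hu
    calc _ = Ring.inverse (toConv X.gamma) * (toConv (X.inclA ∘ₗ X.act.flip a) *
          (toConv X.gamma * Ring.inverse (toConv X.gamma))) := by rw [h2, mul_one]
      _ = Ring.inverse (toConv X.gamma) * ((toConv (X.inclA ∘ₗ X.act.flip a) *
          toConv X.gamma) * Ring.inverse (toConv X.gamma)) := by rw [mul_assoc (toConv (_ ∘ₗ _))]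
      _ = _ := by rw [conv_eq, mul_assoc, ← mul_assoc, h1, one_mul]
  · rw [Ring.inverse_non_unit _ hu, zero_mul, mul_zero]

theorem sweedler_gammaInv (a : A) :
    sweedler ((LinearMap.mul k X.E).compl₁₂ X.gammaInv (X.inclA ∘ₗ X.act.flip a)) =
      LinearMap.mulLeft k (X.inclA a) ∘ₗ X.gammaInv := by
  ext h
  have R := Coalgebra.Repr.arbitrary k h
  rw [sweedler_repr _ R]
  have e0 := congrArg (fun g => g h) (X.gammaInv_conv a)
  have e1 := R.convMul_apply (toConv X.gammaInv) (toConv (X.inclA ∘ₗ X.act.flip a))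
  have e2 := R.convMul_apply
    (toConv ((Coalgebra.counit (R := k) (A := H)).smulRight (X.inclA a))) (toConv X.gammaInv)
  have e4 : X.inclA a * X.gammaInv h =
      ∑ i ∈ R.index, (Coalgebra.counit (R := k) (R.left i) • X.inclA a) * X.gammaInv (R.right i) := by
    nth_rewrite 1 [← Coalgebra.sum_counit_smul R]
    simp only [map_sum, map_smul, Finset.mul_sum, smul_mul_assoc, mul_smul_comm]
  exact e1.symm.trans (e0.trans (e2.trans e4.symm))

variable (M : Type*) [AddCommGroup M] [Module k M] [Module X.E M] [Module X.Eᵐᵒᵖ M]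
  [IsScalarTower k X.E M] [IsScalarTower k X.Eᵐᵒᵖ M]

/-- The left action of `A` on an `E`-bimodule `M`. -/
def leftA : A →ₗ[k] Module.End k M := leftMul k X.E M ∘ₗ X.inclA

/-- The right action of `A` on an `E`-bimodule `M`. -/
def rightA : A →ₗ[k] Module.End k M := rightMul k X.E M ∘ₗ X.inclA

/-- The module `Hom_{S^e}(Ã^r, M)`, where `Ã^r` is the `r`-fold tensor power over `S` of the
`S`-bimodule `Ã = A/S` (and `Ã^0 = S`). An `S`-bimodule map on `Ã^r` is given as the corresponding
multilinear map `φ` on `A^r`, see `IsRelCochain`. -/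
def RelCochain (S : Subalgebra k A) (r : ℕ) :
    Submodule k (MultilinearMap k (fun _ : Fin r => A) M) where
  carrier := {φ | IsRelCochain S (X.leftA M) (X.rightA M) φ}
  add_mem' {φ ψ} hφ hψ :=
    ⟨fun i hi s hs a => by simp [hφ.map_left i hi s hs a, hψ.map_left i hi s hs a],
      fun i hi s hs a => by simp [hφ.map_right i hi s hs a, hψ.map_right i hi s hs a],
      fun i j hij s hs a => by simp [hφ.balanced i j hij s hs a, hψ.balanced i j hij s hs a],
      fun i a ha => by simp [hφ.normalized i a ha, hψ.normalized i a ha],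
      fun h s hs a => by simp [hφ.central h s hs a, hψ.central h s hs a]⟩
  zero_mem' := ⟨by simp, by simp, by simp, by simp, by simp⟩
  smul_mem' c φ hφ :=
    ⟨fun i hi s hs a => by simp [hφ.map_left i hi s hs a],
      fun i hi s hs a => by simp [hφ.map_right i hi s hs a],
      fun i j hij s hs a => by simp [hφ.balanced i j hij s hs a],
      fun i a ha => by simp [hφ.normalized i a ha],
      fun h s hs a => by simp [hφ.central h s hs a]⟩

variable [SMulCommClass X.E X.Eᵐᵒᵖ M]

/-- The coboundary `b^r : Hom_{S^e}(Ã^r, M) → Hom_{S^e}(Ã^{r+1}, M)`. -/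
def relD (S : Subalgebra k A) (r : ℕ) : X.RelCochain M S r →ₗ[k] X.RelCochain M S (r + 1) :=
  (hochschildD (X.leftA M) (X.rightA M) r).restrict fun _ hφ =>
    IsRelCochain.hochschildD
      (fun a b m => by simp [leftA, leftMul, inclA_mul, mul_smul])
      (fun a b m => by simp [rightA, rightMul, inclA_mul, mul_smul])
      (fun a b m => by simp [leftA, rightA, leftMul, rightMul, smul_comm]) hφ

/-- The right action of `H` on `Hom_{S^e}(Ã^r, M)`:
`(φ · h)(a₁, …, aᵣ) = (1 # h⁽¹⁾)⁻¹ φ(a₁^{h⁽²⁾}, …, aᵣ^{h⁽ʳ⁺¹⁾}) (1 # h⁽ʳ⁺²⁾)`. -/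
def relAct (S : Subalgebra k A) (hS : ∀ h, ∀ s ∈ S, X.act h s ∈ S) (r : ℕ) :
    H →ₗ[k] Module.End k (X.RelCochain M S r) where
  toFun h := (diagonalAct X.act (leftMul k X.E M ∘ₗ X.gammaInv) (rightMul k X.E M ∘ₗ X.gamma) r
    h).restrict fun _ hφ => IsRelCochain.diagonalAct X.act_mul hS
      (fun s _ => by
        ext h m
        have := congrArg (fun g => g h • m) (X.sweedler_gammaInv s)
        simpa [sweedler_repr _ (Coalgebra.Repr.arbitrary k h), Finset.sum_smul, leftA, leftMul,
          mul_smul] using this)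
      (fun s _ => by
        ext h m
        have := congrArg (fun g => MulOpposite.op g • m) (X.gamma_mul_inclA h s)
        simpa [sweedler_repr _ (Coalgebra.Repr.arbitrary k h), Finset.sum_smul, rightA, rightMul,
          mul_smul] using this.symm)
      (fun h a m => by simp [leftA, leftMul, rightMul, smul_comm])
      (fun h a m => by simp [rightA, leftMul, rightMul, smul_comm]) hφ h
  map_add' h l := by ext; simp; rfl
  map_smul' c h := by ext; simp; rfl

end CrossedProduct
end
end HopfCrossed

/-!
The map `b ⊗ c ↦ b u(c⁽¹⁾) ⊗ c⁽²⁾` of `B ⊗ C` is bijective exactly when `u : C → B` is convolution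
invertible. Up to an isomorphism, this map for `γ(h) = 1 # h` is the composite of the maps for `f`
and for the identity of `H`, whose convolution inverse is the antipode; hence `γ` is invertible.

The comparison of the cohomologies is by dimension shifting. An `E`-bimodule `N` embeds into the
coinduced bimodule `Hom(E, N)` through `m ↦ (x ↦ m x)`, and a separability idempotent of `S` gives
a left `E`-linear, right `S`-linear retraction, so that the embedding induces split short exact
sequences of both the Hochschild complexes and the total complexes. For coinduced coefficients both
complexes are exact in positive degrees: the rows of the double complex contract, which leaves the
bar complex of `H` with coefficients in the cocycles of column `0`, and these form a coinduced
`H`-module. In degree `0` both cohomologies are the center of the bimodule, and the connecting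
isomorphisms reach all higher degrees by passing from `N` to the cokernel of the embedding.
-/

namespace HopfCrossed

noncomputable section

open WithConv

section HochschildCalculus

variable {k B N N' : Type*} [CommRing k] [Ring B] [Algebra k B] [AddCommGroup N] [Module k N]
  [AddCommGroup N'] [Module k N']

/-- `L` and `R` are commuting left and right actions of `B` on `N`. They are not required to be
unital: the right action `homShiftRight` is not. -/
structure IsActionPair (L R : B →ₗ[k] Module.End k N) : Prop where
  left_mul : ∀ a b n, L (a * b) n = L a (L b n)
  right_mul : ∀ a b n, R (a * b) n = R b (R a n)
  comm : ∀ a b n, L a (R b n) = R b (L a n)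

/-- The left action of `B` on `Hom(C, N)` through the values. -/
def homLeft {C : Type*} [AddCommGroup C] [Module k C] (L : B →ₗ[k] Module.End k N) :
    B →ₗ[k] Module.End k (C →ₗ[k] N) :=
  LinearMap.mk₂ k (fun b ξ => L b ∘ₗ ξ) (fun _ _ _ => by ext; simp) (fun _ _ _ => by ext; simp)
    (fun _ _ _ => by ext; simp) (fun _ _ _ => by ext; simp)

@[simp] theorem homLeft_apply {C : Type*} [AddCommGroup C] [Module k C]
    (L : B →ₗ[k] Module.End k N) (b : B) (ξ : C →ₗ[k] N) (x : C) :
    homLeft L b ξ x = L b (ξ x) := rfl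

/-- The right action of `B` on `Hom(B, N)` through the argument. Together with `homLeft` it makes
`Hom(B, N)` the coinduced bimodule. -/
def homRight : B →ₗ[k] Module.End k (B →ₗ[k] N) :=
  LinearMap.mk₂ k (fun b ξ => ξ ∘ₗ LinearMap.mulLeft k b) (fun _ _ _ => by ext; simp [add_mul])
    (fun _ _ _ => by ext; simp) (fun _ _ _ => by ext; simp) (fun _ _ _ => by ext; simp)

@[simp] theorem homRight_apply (b : B) (ξ : B →ₗ[k] N) (x : B) :
    homRight (k := k) b ξ x = ξ (b * x) := rfl

/-- The right action `(ξ b)(x) = ξ(b x) - ξ(b) x` of `B` on `Hom(B, N)`. With it, separating the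
last variable identifies Hochschild `(n + 1)`-cochains with values in `N` with `n`-cochains with
values in `Hom(B, N)`, compatibly with the coboundaries; see `hochschildD_curryRight`. -/
def homShiftRight (R : B →ₗ[k] Module.End k N) : B →ₗ[k] Module.End k (B →ₗ[k] N) :=
  homRight - LinearMap.mk₂ k (fun b ξ => R.flip (ξ b)) (fun _ _ _ => by ext; simp)
    (fun _ _ _ => by ext; simp) (fun _ _ _ => by ext; simp) (fun _ _ _ => by ext; simp)

theorem homShiftRight_eq_sub (R : B →ₗ[k] Module.End k N) (b : B) (ξ : B →ₗ[k] N) :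
    homShiftRight R b ξ = homRight b ξ - R.flip (ξ b) := rfl

@[simp] theorem homShiftRight_apply (R : B →ₗ[k] Module.End k N) (b : B) (ξ : B →ₗ[k] N) (x : B) :
    homShiftRight R b ξ x = ξ (b * x) - R x (ξ b) := rfl

theorem IsActionPair.homShift {L R : B →ₗ[k] Module.End k N} (h : IsActionPair L R) :
    IsActionPair (homLeft L) (homShiftRight R) where
  left_mul a b n := by ext; simp [h.left_mul]
  right_mul a b n := by ext; simp [h.right_mul, mul_assoc]
  comm a b n := by ext; simp [h.comm]

theorem snoc_comp_succ {α : Type*} {n : ℕ} (b : Fin (n + 1) → α) (x : α) :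
    (fun i : Fin (n + 1) => (Fin.snoc b x : Fin (n + 2) → α) i.succ) =
      (Fin.snoc (fun i : Fin n => b i.succ) x : Fin (n + 1) → α) := by
  ext t
  refine Fin.lastCases ?_ (fun t => ?_) t
  · rw [Fin.succ_last, Fin.snoc_last, Fin.snoc_last]
  · rw [Fin.succ_castSucc, Fin.snoc_castSucc, Fin.snoc_castSucc]

theorem contractNth_castSucc_snoc {α : Type*} {n : ℕ} (op : α → α → α) (j : Fin n)
    (b : Fin (n + 1) → α) (x : α) :
    Fin.contractNth j.castSucc.castSucc op (Fin.snoc b x : Fin (n + 2) → α) =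
      (Fin.snoc (Fin.contractNth j.castSucc op b) x : Fin (n + 1) → α) := by
  ext t
  refine Fin.lastCases ?_ (fun t => ?_) t
  · simp only [Fin.snoc_last]
    rw [Fin.contractNth_apply_of_gt _ _ _ _ (by simp), Fin.succ_last, Fin.snoc_last]
  · simp only [Fin.snoc_castSucc, Fin.contractNth, Fin.val_castSucc, Fin.succ_castSucc]

theorem contractNth_last_snoc {α : Type*} {n : ℕ} (op : α → α → α)
    (b : Fin (n + 1) → α) (x : α) :
    Fin.contractNth (Fin.last n).castSucc op (Fin.snoc b x : Fin (n + 2) → α) =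
      (Fin.snoc (Fin.init b) (op (b (Fin.last n)) x) : Fin (n + 1) → α) := by
  ext t
  refine Fin.lastCases ?_ (fun t => ?_) t
  · rw [Fin.contractNth_apply_of_eq _ _ _ _ (by simp), Fin.succ_last, Fin.snoc_last,
      Fin.snoc_castSucc, Fin.snoc_last]
  · rw [Fin.contractNth_apply_of_lt _ _ _ _ (by simp), Fin.snoc_castSucc, Fin.snoc_castSucc]
    rfl

theorem curryRight_init_last {n : ℕ} (φ : MultilinearMap k (fun _ : Fin (n + 1) => B) N)
    (b : Fin (n + 1) → B) : φ.curryRight (Fin.init b) (b (Fin.last n)) = φ b := by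
  rw [MultilinearMap.curryRight_apply]
  exact congrArg φ (Fin.snoc_init_self b)

theorem hochschildD_curryRight (L R : B →ₗ[k] Module.End k N) (n : ℕ)
    (φ : MultilinearMap k (fun _ : Fin (n + 1) => B) N) :
    (hochschildD L R (n + 1) φ).curryRight =
      hochschildD (homLeft L) (homShiftRight R) n φ.curryRight := by
  ext b x
  have init_last : φ (Fin.snoc (fun i : Fin n => b i.castSucc) (b (Fin.last n))) = φ b :=
    curryRight_init_last φ b
  rw [MultilinearMap.curryRight_apply, hochschildD_apply, hochschildD_apply,
    Fin.sum_univ_castSucc, snoc_comp_succ, ← Fin.castSucc_zero, Fin.snoc_castSucc]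
  simp only [LinearMap.add_apply, LinearMap.sum_apply, LinearMap.smul_apply, homLeft_apply,
    homShiftRight_apply, MultilinearMap.curryRight_apply, contractNth_castSucc_snoc,
    contractNth_last_snoc, Fin.snoc_last, Fin.snoc_castSucc, Fin.val_castSucc, Fin.val_last,
    init_last, smul_sub, pow_succ (-1 : k) (n + 1), mul_neg, mul_one, neg_smul]
  unfold Fin.init
  abel

theorem hochschildD_hochschildD_zero {L R : B →ₗ[k] Module.End k N} (h : IsActionPair L R)
    (φ : MultilinearMap k (fun _ : Fin 0 => B) N) :
    hochschildD L R 1 (hochschildD L R 0 φ) = 0 := by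
  ext b
  have apply_eq (c : Fin 0 → B) : φ c = φ 0 := congrArg φ (Subsingleton.elim c 0)
  simp [hochschildD_apply, apply_eq, h.left_mul, h.right_mul, h.comm, Fin.contractNth]
  abel

theorem hochschildD_hochschildD_succ {L R : B →ₗ[k] Module.End k N} {n : ℕ}
    (h : ∀ φ, hochschildD (homLeft (C := B) L) (homShiftRight R) (n + 1)
      (hochschildD (homLeft L) (homShiftRight R) n φ) = 0)
    (φ : MultilinearMap k (fun _ : Fin (n + 1) => B) N) :
    hochschildD L R (n + 2) (hochschildD L R (n + 1) φ) = 0 := by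
  rw [← MultilinearMap.uncurry_curryRight (hochschildD L R (n + 1 + 1) _),
    hochschildD_curryRight, hochschildD_curryRight, h]
  ext; simp

/- The induction replaces `N` by `Hom(B, N)`, so the universe of `N` has to absorb that of `B`. -/
theorem hochschildD_hochschildD_of_universe.{u, v} {B : Type u} [Ring B] [Algebra k B] (n : ℕ)
    {N : Type (max u v)} [AddCommGroup N] [Module k N] {L R : B →ₗ[k] Module.End k N}
    (h : IsActionPair L R) (φ : MultilinearMap k (fun _ : Fin n => B) N) :
    hochschildD L R (n + 1) (hochschildD L R n φ) = 0 := by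
  induction n generalizing N with
  | zero => exact hochschildD_hochschildD_zero h φ
  | succ n ih => exact hochschildD_hochschildD_succ (ih h.homShift) φ

theorem hochschildD_hochschildD {L R : B →ₗ[k] Module.End k N} (h : IsActionPair L R) (n : ℕ)
    (φ : MultilinearMap k (fun _ : Fin n => B) N) :
    hochschildD L R (n + 1) (hochschildD L R n φ) = 0 := by
  cases n with
  | zero => exact hochschildD_hochschildD_zero h φ
  | succ n =>
    exact hochschildD_hochschildD_succ (hochschildD_hochschildD_of_universe n h.homShift) φ

theorem hochschildD_compMultilinearMap {L R : B →ₗ[k] Module.End k N}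
    {L' R' : B →ₗ[k] Module.End k N'} (g : N →ₗ[k] N') (hL : ∀ b n, g (L b n) = L' b (g n))
    (hR : ∀ b n, g (R b n) = R' b (g n)) (n : ℕ) (φ : MultilinearMap k (fun _ : Fin n => B) N) :
    hochschildD L' R' n (g.compMultilinearMap φ) = g.compMultilinearMap (hochschildD L R n φ) := by
  ext b
  simp [hochschildD_apply, hL, hR]

/-- The operator `(K φ)(b₁, …, bₙ) = K (x ↦ φ(b₁, …, bₙ, x))` from `(n + 1)`-cochains to
`n`-cochains. All contracting homotopies below are of this form. -/
def contractLast (K : (B →ₗ[k] N) →ₗ[k] N') (n : ℕ) :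
    MultilinearMap k (fun _ : Fin (n + 1) => B) N →ₗ[k]
      MultilinearMap k (fun _ : Fin n => B) N' where
  toFun φ := K.compMultilinearMap φ.curryRight
  map_add' φ ψ := by
    ext b
    exact map_add K (φ.curryRight b) (ψ.curryRight b)
  map_smul' c φ := by
    ext b
    exact map_smul K c (φ.curryRight b)

theorem contractLast_apply (K : (B →ₗ[k] N) →ₗ[k] N') (n : ℕ)
    (φ : MultilinearMap k (fun _ : Fin (n + 1) => B) N) (b : Fin n → B) :
    contractLast K n φ b = K (φ.curryRight b) := rfl

/- `K` is a morphism for the coinduced right action `homRight`; the correction term measures the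
difference of `homRight` and `homShiftRight`. -/
theorem contractLast_hochschildD {L R : B →ₗ[k] Module.End k N} {L' R' : B →ₗ[k] Module.End k N'}
    (K : (B →ₗ[k] N) →ₗ[k] N') (hL : ∀ b ξ, K (homLeft L b ξ) = L' b (K ξ))
    (hR : ∀ b ξ, K (homRight b ξ) = R' b (K ξ)) (n : ℕ)
    (φ : MultilinearMap k (fun _ : Fin (n + 1) => B) N) :
    contractLast K (n + 1) (hochschildD L R (n + 1) φ) =
      hochschildD L' R' n (contractLast K n φ) +
        (-1 : k) ^ n • (K ∘ₗ R.flip).compMultilinearMap φ := by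
  ext b
  have init_last : φ.curryRight (fun i => b i.castSucc) (b (Fin.last n)) = φ b :=
    curryRight_init_last φ b
  rw [contractLast_apply, hochschildD_curryRight, hochschildD_apply, add_apply,
    hochschildD_apply]
  simp only [map_add, map_sum, map_smul, hL, hR, homShiftRight_eq_sub, map_sub, init_last,
    contractLast_apply, smul_sub, smul_apply]
  simp only [pow_succ (-1 : k) n, mul_neg, mul_one, neg_smul, LinearMap.compMultilinearMap_apply,
    LinearMap.comp_apply]
  abel

theorem hochschildD_contractLast {L R : B →ₗ[k] Module.End k N} {K : (B →ₗ[k] N) →ₗ[k] N}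
    (hL : ∀ b ξ, K (homLeft L b ξ) = L b (K ξ)) (hR : ∀ b ξ, K (homRight b ξ) = R b (K ξ)) {n : ℕ}
    {φ : MultilinearMap k (fun _ : Fin (n + 1) => B) N}
    (hK : (K ∘ₗ R.flip).compMultilinearMap φ = φ) (hφ : hochschildD L R (n + 1) φ = 0) :
    hochschildD L R n ((-1 : k) ^ (n + 1) • contractLast K n φ) = φ := by
  have homotopy := contractLast_hochschildD (R := R) K hL hR n φ
  rw [hφ, map_zero, hK] at homotopy
  have d_contract : hochschildD L R n (contractLast K n φ) = -((-1 : k) ^ n • φ) :=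
    eq_neg_of_add_eq_zero_left homotopy.symm
  rw [map_smul, d_contract, smul_neg, smul_smul, ← neg_smul, pow_succ, mul_neg_one, neg_mul,
    neg_neg, ← mul_pow, neg_one_mul, neg_neg, one_pow, one_smul]

end HochschildCalculus

section CohomologyShift

variable {k : Type*} [CommRing k]
  {C' C C'' : ℕ → Type*} [∀ n, AddCommGroup (C' n)] [∀ n, Module k (C' n)]
  [∀ n, AddCommGroup (C n)] [∀ n, Module k (C n)]
  [∀ n, AddCommGroup (C'' n)] [∀ n, Module k (C'' n)]
  {d' : ∀ n, C' n →ₗ[k] C' (n + 1)} {d : ∀ n, C n →ₗ[k] C (n + 1)}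
  {d'' : ∀ n, C'' n →ₗ[k] C'' (n + 1)}

/-- A degreewise split short exact sequence `0 → C' → C → C'' → 0` of cochain complexes: `i` and
`p` are maps of complexes, while the splittings `r` of `i` and `t` of `p` need not commute with the
coboundaries. -/
structure SplitExact (d' : ∀ n, C' n →ₗ[k] C' (n + 1)) (d : ∀ n, C n →ₗ[k] C (n + 1))
    (d'' : ∀ n, C'' n →ₗ[k] C'' (n + 1)) (i : ∀ n, C' n →ₗ[k] C n) (p : ∀ n, C n →ₗ[k] C'' n)
    (r : ∀ n, C n →ₗ[k] C' n) (t : ∀ n, C'' n →ₗ[k] C n) : Prop where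
  i_d : ∀ n x, d n (i n x) = i (n + 1) (d' n x)
  p_d : ∀ n x, d'' n (p n x) = p (n + 1) (d n x)
  p_i : ∀ n x, p n (i n x) = 0
  r_i : ∀ n x, r n (i n x) = x
  p_t : ∀ n x, p n (t n x) = x
  split : ∀ n x, i n (r n x) + t n (p n x) = x

variable {i : ∀ n, C' n →ₗ[k] C n} {p : ∀ n, C n →ₗ[k] C'' n}
  {r : ∀ n, C n →ₗ[k] C' n} {t : ∀ n, C'' n →ₗ[k] C n}

namespace SplitExact

theorem i_r_of_p_eq_zero (h : SplitExact d' d d'' i p r t) {n : ℕ} {x : C n} (hx : p n x = 0) :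
    i n (r n x) = x := by
  simpa only [hx, map_zero, add_zero] using h.split n x

theorem i_injective (h : SplitExact d' d d'' i p r t) (n : ℕ) : Function.Injective (i n) :=
  Function.LeftInverse.injective (h.r_i n)

theorem i_r_d_t (h : SplitExact d' d d'' i p r t) {n : ℕ} {z : C'' n} (hz : d'' n z = 0) :
    i (n + 1) (r (n + 1) (d n (t n z))) = d n (t n z) :=
  h.i_r_of_p_eq_zero (by rw [← h.p_d, h.p_t, hz])

theorem d'_r_d_t (h : SplitExact d' d d'' i p r t) (hd : ∀ n x, d (n + 1) (d n x) = 0) {n : ℕ}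
    {z : C'' n} (hz : d'' n z = 0) : d' (n + 1) (r (n + 1) (d n (t n z))) = 0 := by
  apply h.i_injective
  rw [← h.i_d, h.i_r_d_t hz, hd, map_zero]

/-- The connecting homomorphism, on cocycles. -/
def connecting (h : SplitExact d' d d'' i p r t) (hd : ∀ n x, d (n + 1) (d n x) = 0) (n : ℕ) :
    LinearMap.ker (d'' n) →ₗ[k] Cohomology d' (n + 1) :=
  Submodule.mkQ _ ∘ₗ ((r (n + 1) ∘ₗ d n ∘ₗ t n) ∘ₗ Submodule.subtype _).codRestrict _
    (fun z => h.d'_r_d_t hd z.2)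

theorem connecting_eq_zero_iff (h : SplitExact d' d d'' i p r t)
    (hd : ∀ n x, d (n + 1) (d n x) = 0) {n : ℕ} (z : LinearMap.ker (d'' n)) :
    h.connecting hd n z = 0 ↔ ∃ x, d n x = 0 ∧ p n x = z := by
  have mem_range : h.connecting hd n z = 0 ↔ ∃ y, d' n y = r (n + 1) (d n (t n z)) :=
    Submodule.Quotient.mk_eq_zero _
  rw [mem_range]
  constructor
  · rintro ⟨y, hy⟩
    refine ⟨t n z - i n y, ?_, ?_⟩
    · rw [map_sub, h.i_d, hy, h.i_r_d_t z.2, sub_self]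
    · rw [map_sub, h.p_t, h.p_i, sub_zero]
  · rintro ⟨x, hx, hp⟩
    refine ⟨-r n x, h.i_injective _ ?_⟩
    have split : t n z = x - i n (r n x) := by rw [eq_sub_iff_add_eq', ← hp, h.split]
    rw [h.i_r_d_t z.2, split, map_sub, hx, zero_sub, h.i_d, map_neg, map_neg]

theorem ker_connecting (h : SplitExact d' d d'' i p r t)
    (hd : ∀ n x, d (n + 1) (d n x) = 0) (n : ℕ) :
    LinearMap.ker (h.connecting hd n) =
      ((LinearMap.ker (d n)).map (p n)).submoduleOf (LinearMap.ker (d'' n)) := by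
  ext z
  exact h.connecting_eq_zero_iff hd z

theorem connecting_surjective (h : SplitExact d' d d'' i p r t)
    (hd : ∀ n x, d (n + 1) (d n x) = 0) {n : ℕ} (hC : Function.Exact (d n) (d (n + 1))) :
    Function.Surjective (h.connecting hd n) := by
  intro z
  obtain ⟨⟨z, hz⟩, rfl⟩ := Submodule.mkQ_surjective _ z
  obtain ⟨y, hy⟩ := (hC (i (n + 1) z)).mp (by rw [h.i_d, LinearMap.mem_ker.mp hz, map_zero])
  have hpy : d'' n (p n y) = 0 := by rw [h.p_d, hy, h.p_i]
  refine ⟨⟨p n y, hpy⟩, (Submodule.Quotient.eq _).mpr ⟨-r n y, h.i_injective _ ?_⟩⟩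
  change i (n + 1) (d' n (-r n y)) = i (n + 1) (r (n + 1) (d n (t n (p n y))) - z)
  have split : t n (p n y) = y - i n (r n y) := by rw [eq_sub_iff_add_eq', h.split]
  rw [map_sub, h.i_r_d_t hpy, split, map_sub, hy, h.i_d, map_neg, map_neg]
  abel

/-- The connecting isomorphism out of degree `n`, if the middle complex is exact in degree
`n + 1`. -/
def shiftEquiv (h : SplitExact d' d d'' i p r t) (hd : ∀ n x, d (n + 1) (d n x) = 0) {n : ℕ}
    (hC : Function.Exact (d n) (d (n + 1))) :
    Cohomology d' (n + 1) ≃ₗ[k] LinearMap.ker (d'' n) ⧸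
      ((LinearMap.ker (d n)).map (p n)).submoduleOf (LinearMap.ker (d'' n)) :=
  ((h.connecting hd n).quotKerEquivOfSurjective (h.connecting_surjective hd hC)).symm ≪≫ₗ
    Submodule.quotEquivOfEq _ _ (h.ker_connecting hd n)

theorem map_ker_eq_coboundaries (h : SplitExact d' d d'' i p r t) {n : ℕ}
    (hC : Function.Exact (d n) (d (n + 1))) :
    (LinearMap.ker (d (n + 1))).map (p (n + 1)) = coboundaries d'' (n + 1) := by
  rw [hC.linearMap_ker_eq]
  ext z
  constructor
  · rintro ⟨_, ⟨y, rfl⟩, rfl⟩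
    exact ⟨p n y, h.p_d n y⟩
  · rintro ⟨y, rfl⟩
    exact ⟨d n (t n y), ⟨_, rfl⟩, by rw [← h.p_d, h.p_t]⟩

/-- The connecting isomorphism out of a positive degree, if the middle complex is exact in positive
degrees. -/
def shiftSuccEquiv (h : SplitExact d' d d'' i p r t)
    (hC : ∀ n, Function.Exact (d n) (d (n + 1))) (n : ℕ) :
    Cohomology d' (n + 2) ≃ₗ[k] Cohomology d'' (n + 1) :=
  h.shiftEquiv (fun n => (hC n).apply_apply_eq_zero) (hC (n + 1)) ≪≫ₗ
    Submodule.quotEquivOfEq _ _ (by rw [h.map_ker_eq_coboundaries (hC n)])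

end SplitExact

end CohomologyShift

section Galois

variable {k B C V : Type*} [CommRing k] [Ring B] [Algebra k B] [AddCommGroup C] [Module k C]
  [AddCommGroup V] [Module k V]

theorem sum_coassoc [Coalgebra k C] (T : C →ₗ[k] C →ₗ[k] C →ₗ[k] V) {c : C}
    {ι : Type*} {κ μ : ι → Type*} (r : Coalgebra.Repr k c ι)
    (r₁ : ∀ i, Coalgebra.Repr k (r.left i) (κ i)) (r₂ : ∀ i, Coalgebra.Repr k (r.right i) (μ i)) :
    ∑ i ∈ r.index, ∑ j ∈ (r₁ i).index, T ((r₁ i).left j) ((r₁ i).right j) (r.right i) =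
      ∑ i ∈ r.index, ∑ j ∈ (r₂ i).index, T (r.left i) ((r₂ i).left j) ((r₂ i).right j) := by
  have coassoc := LinearMap.congr_fun (sweedler_coassoc T) c
  simpa only [sweedler_repr _ r, LinearMap.comp_apply, sweedler_repr _ (r₂ _),
    sweedler_repr _ (r₁ _), LinearMap.sum_apply] using coassoc.symm

/-- The `B`-linear map `b ⊗ c ↦ b g(c)` on `B ⊗ C` that extends the `k`-linear map `g`. Unlike in
`LinearMap.liftBaseChange`, the algebra `B` may be noncommutative. -/
def extendScalars [Module B V] [IsScalarTower k B V]
    (g : C →ₗ[k] V) : B ⊗[k] C →ₗ[B] V :=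
  TensorProduct.AlgebraTensorModule.lift
    { toFun := fun b => b • g
      map_add' := fun b b' => add_smul b b' g
      map_smul' := fun b b' => mul_smul b b' g }

@[simp] theorem extendScalars_tmul [Module B V] [IsScalarTower k B V]
    (g : C →ₗ[k] V) (b : B) (c : C) : extendScalars g (b ⊗ₜ[k] c) = b • g c := rfl

theorem extendScalars_injective :
    Function.Injective (extendScalars : (C →ₗ[k] B) → B ⊗[k] C →ₗ[B] B) := fun g g' h => by
  ext c
  simpa using LinearMap.congr_fun h (1 ⊗ₜ c)

theorem ext_one_tmul [Module B V] [IsScalarTower k B V]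
    {g g' : B ⊗[k] C →ₗ[B] V} (h : ∀ c, g (1 ⊗ₜ c) = g' (1 ⊗ₜ c)) : g = g' := by
  refine TensorProduct.AlgebraTensorModule.ext fun b c => ?_
  rw [← mul_one b, ← smul_eq_mul, ← TensorProduct.smul_tmul', map_smul, map_smul, h]

variable [Coalgebra k C]

/-- The map `b ⊗ c ↦ b u(c⁽¹⁾) ⊗ c⁽²⁾`, which is bijective if and only if `u` is invertible for the
convolution product. -/
def galois (u : C →ₗ[k] B) : B ⊗[k] C →ₗ[B] B ⊗[k] C :=
  extendScalars (u.rTensor C ∘ₗ Coalgebra.comul)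

theorem galois_tmul (u : C →ₗ[k] B) (b : B) {c : C} {ι : Type*} (r : Coalgebra.Repr k c ι) :
    galois u (b ⊗ₜ c) = ∑ i ∈ r.index, (b * u (r.left i)) ⊗ₜ[k] r.right i := by
  simp [galois, ← r.eq, Finset.smul_sum, TensorProduct.smul_tmul']

theorem extendScalars_comp_galois (u v : WithConv (C →ₗ[k] B)) :
    extendScalars v.ofConv ∘ₗ galois u.ofConv = extendScalars (u * v).ofConv := by
  refine ext_one_tmul fun c => ?_
  have r := Coalgebra.Repr.arbitrary k c
  simp only [LinearMap.comp_apply, galois_tmul _ _ r, map_sum, extendScalars_tmul, one_mul,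
    smul_eq_mul]
  exact (r.convMul_apply u v).symm

theorem galois_one : galois (1 : WithConv (C →ₗ[k] B)).ofConv = .id := by
  refine ext_one_tmul fun c => ?_
  have r := Coalgebra.Repr.arbitrary k c
  calc galois (1 : WithConv (C →ₗ[k] B)).ofConv (1 ⊗ₜ c)
      = ∑ i ∈ r.index, (1 : B) ⊗ₜ[k] (Coalgebra.counit (R := k) (r.left i) • r.right i) := by
        simp [galois_tmul _ _ r, Algebra.algebraMap_eq_smul_one,
          TensorProduct.smul_tmul]
    _ = 1 ⊗ₜ c := by rw [← TensorProduct.tmul_sum, Coalgebra.sum_counit_smul]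

theorem galois_comp_galois (u v : WithConv (C →ₗ[k] B)) :
    galois u.ofConv ∘ₗ galois v.ofConv = galois (v * u).ofConv := by
  refine ext_one_tmul fun c => ?_
  have r := Coalgebra.Repr.arbitrary k c
  have coassoc := sum_coassoc (((LinearMap.mul k B).compl₁₂ v.ofConv u.ofConv).compr₂
    (TensorProduct.mk k B C)) r (fun i => Coalgebra.Repr.arbitrary k _)
    (fun i => Coalgebra.Repr.arbitrary k _)
  have convMul (x : C) : (v * u).ofConv x = _ := (Coalgebra.Repr.arbitrary k x).convMul_apply v u
  simp only [LinearMap.compr₂_apply, LinearMap.compl₁₂_apply, LinearMap.mul_apply',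
    TensorProduct.mk_apply] at coassoc
  simp only [LinearMap.comp_apply, galois_tmul _ _ r, map_sum, one_mul, convMul,
    galois_tmul _ _ (Coalgebra.Repr.arbitrary k (r.right _)), TensorProduct.sum_tmul, ← coassoc]

theorem galois_bijective {u : WithConv (C →ₗ[k] B)} (hu : IsUnit u) :
    Function.Bijective (galois u.ofConv) := by
  obtain ⟨u, rfl⟩ := hu
  refine Function.bijective_iff_has_inverse.mpr ⟨galois (↑u⁻¹ : WithConv (C →ₗ[k] B)).ofConv,
    fun x => ?_, fun x => ?_⟩
  · rw [← LinearMap.comp_apply, galois_comp_galois, u.mul_inv, galois_one, LinearMap.id_apply]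
  · rw [← LinearMap.comp_apply, galois_comp_galois, u.inv_mul, galois_one, LinearMap.id_apply]

theorem isUnit_of_galois_bijective {u : WithConv (C →ₗ[k] B)}
    (hu : Function.Bijective (galois u.ofConv)) : IsUnit u := by
  let e := LinearEquiv.ofBijective _ hu
  let v : WithConv (C →ₗ[k] B) :=
    toConv ((extendScalars (1 : WithConv (C →ₗ[k] B)).ofConv ∘ₗ
      e.symm.toLinearMap).restrictScalars k ∘ₗ TensorProduct.mk k B C 1)
  have extend_v : extendScalars v.ofConv =
      extendScalars (1 : WithConv (C →ₗ[k] B)).ofConv ∘ₗ e.symm.toLinearMap :=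
    ext_one_tmul fun c => one_smul B _
  have mul_eq_one : u * v = 1 := ofConv_injective <| extendScalars_injective <| by
    rw [← extendScalars_comp_galois, extend_v]
    exact LinearMap.ext fun x => congrArg _ (e.symm_apply_apply x)
  have galois_v_u : galois v.ofConv ∘ₗ galois u.ofConv = .id := by
    rw [galois_comp_galois, mul_eq_one, galois_one]
  have right_inv : Function.RightInverse (galois v.ofConv) (galois u.ofConv) :=
    Function.LeftInverse.rightInverse_of_surjective (LinearMap.congr_fun galois_v_u) hu.surjective
  have galois_u_v : galois u.ofConv ∘ₗ galois v.ofConv = .id := LinearMap.ext fun x => right_inv x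
  have mul_eq_one' : v * u = 1 := ofConv_injective <| extendScalars_injective <| by
    rw [← mul_one (v * u), ← extendScalars_comp_galois, ← galois_comp_galois, galois_u_v,
      LinearMap.comp_id]
  exact ⟨⟨u, v, mul_eq_one, mul_eq_one'⟩, rfl⟩

end Galois

namespace CrossedProduct

variable {k A H : Type*} [CommRing k] [Ring A] [Algebra k A] [Ring H] [HopfAlgebra k H]
  (X : CrossedProduct k A H)

theorem cocycleMul_repr (f : H ⊗[k] H →ₗ[k] A) {l h : H} {ι κ : Type*} (r : Coalgebra.Repr k l ι)
    (s : Coalgebra.Repr k h κ) : cocycleMul f (l ⊗ₜ h) = ∑ i ∈ r.index, ∑ j ∈ s.index,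
      f (r.left i ⊗ₜ s.left j) ⊗ₜ[k] (r.right i * s.right j) := by
  simp only [cocycleMul, LinearMap.comp_apply]
  rw [← (r.tmul s).eq, map_sum]
  simp [Finset.sum_product]

theorem gamma_mul_gamma {l h : H} {ι κ : Type*} (r : Coalgebra.Repr k l ι)
    (s : Coalgebra.Repr k h κ) : X.gamma l * X.gamma h = ∑ i ∈ r.index, ∑ j ∈ s.index,
      X.inclA (X.f (r.left i ⊗ₜ s.left j)) * X.gamma (r.right i * s.right j) := by
  have sum_counit := congrArg (fun z => cocycleMul X.f (z ⊗ₜ h)) (Coalgebra.sum_counit_smul r)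
  simp only [TensorProduct.sum_tmul, ← TensorProduct.smul_tmul', map_sum, map_smul] at sum_counit
  have gamma_mul : X.gamma l * X.gamma h = cocycleMul X.f (l ⊗ₜ h) := by
    refine (crossedMul_tmul X.act X.f 1 1 l h r).trans ?_
    simpa only [X.act_one, one_mul, algebraMap_smul] using sum_counit
  rw [gamma_mul, cocycleMul_repr X.f r s]
  simp only [X.inclA_mul_gamma]
  rfl

/-- The associativity isomorphism `A ⊗ (H ⊗ H) ≃ (A ⊗ H) ⊗ H = E ⊗ H`. -/
def assocE : A ⊗[k] (H ⊗[k] H) ≃ₗ[k] X.E ⊗[k] H := (TensorProduct.assoc k A H H).symm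

theorem assocE_tmul (a : A) (l h : H) :
    X.assocE (a ⊗ₜ (l ⊗ₜ h)) = (X.inclA a * X.gamma l) ⊗ₜ[k] h := by
  rw [inclA_mul_gamma]; rfl

/-- The map `h ⊗ l ↦ h l⁽¹⁾ ⊗ l⁽²⁾` of `H ⊗ H`, tensored with `A`. -/
def galoisId (k A H : Type*) [CommRing k] [Ring A] [Algebra k A] [Ring H] [HopfAlgebra k H] :
    A ⊗[k] (H ⊗[k] H) →ₗ[k] A ⊗[k] (H ⊗[k] H) :=
  ((galois (LinearMap.id : H →ₗ[k] H)).restrictScalars k).lTensor A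

theorem galois_gamma_assocE_tmul (a : A) (l h : H) {ι κ : Type*} {κ' : κ → Type*}
    (r : Coalgebra.Repr k l ι) (s : Coalgebra.Repr k h κ)
    (s₁ : ∀ j, Coalgebra.Repr k (s.left j) (κ' j)) :
    galois X.gamma (X.assocE (a ⊗ₜ (l ⊗ₜ h))) =
      ∑ i ∈ r.index, ∑ j ∈ s.index, ∑ t ∈ (s₁ j).index,
        (X.inclA a * X.inclA (X.f (r.left i ⊗ₜ (s₁ j).left t)) *
          X.gamma (r.right i * (s₁ j).right t)) ⊗ₜ[k] s.right j := by
  rw [assocE_tmul, galois_tmul _ _ s, Finset.sum_comm]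
  simp only [mul_assoc, X.gamma_mul_gamma r (s₁ _), Finset.mul_sum, TensorProduct.sum_tmul]

theorem assocE_galoisId_galois_tmul (a : A) (l h : H) {ι κ : Type*} {κ' : κ → Type*}
    (r : Coalgebra.Repr k l ι) (s : Coalgebra.Repr k h κ)
    (s₂ : ∀ j, Coalgebra.Repr k (s.right j) (κ' j)) :
    X.assocE (galoisId k A H (galois X.f (a ⊗ₜ (l ⊗ₜ h)))) =
      ∑ i ∈ r.index, ∑ j ∈ s.index, ∑ t ∈ (s₂ j).index,
        (X.inclA a * X.inclA (X.f (r.left i ⊗ₜ s.left j)) *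
          X.gamma (r.right i * (s₂ j).left t)) ⊗ₜ[k] (s₂ j).right t := by
  have galois_f : galois X.f (a ⊗ₜ (l ⊗ₜ h)) = ∑ i ∈ r.index, ∑ j ∈ s.index,
      (a * X.f (r.left i ⊗ₜ s.left j)) ⊗ₜ[k] (r.right i ⊗ₜ[k] s.right j) :=
    (galois_tmul _ _ (r.tmul s)).trans (Finset.sum_product _ _ _)
  simp only [galois_f, galoisId, map_sum, LinearMap.lTensor_tmul, LinearMap.coe_restrictScalars,
    galois_tmul _ _ (s₂ _), TensorProduct.tmul_sum, assocE_tmul, inclA_mul, LinearMap.id_apply]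

theorem galois_gamma_assocE (x : A ⊗[k] (H ⊗[k] H)) :
    galois X.gamma (X.assocE x) = X.assocE (galoisId k A H (galois X.f x)) := by
  induction x with
  | zero => simp only [map_zero]
  | add x y hx hy => simp only [map_add, hx, hy]
  | tmul a x =>
    induction x with
    | zero => simp only [TensorProduct.tmul_zero, map_zero]
    | add x y hx hy => simp only [TensorProduct.tmul_add, map_add, hx, hy]
    | tmul l h =>
      have r := Coalgebra.Repr.arbitrary k l
      have s := Coalgebra.Repr.arbitrary k h
      rw [X.galois_gamma_assocE_tmul a l h r s fun j => Coalgebra.Repr.arbitrary k _,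
        X.assocE_galoisId_galois_tmul a l h r s fun j => Coalgebra.Repr.arbitrary k _]
      exact Finset.sum_congr rfl fun i _ => sum_coassoc (((LinearMap.mul k X.E).compl₁₂
        (LinearMap.mulLeft k (X.inclA a) ∘ₗ X.inclA ∘ₗ X.f ∘ₗ TensorProduct.mk k H H (r.left i))
        (X.gamma ∘ₗ LinearMap.mulLeft k (r.right i))).compr₂ (TensorProduct.mk k X.E H)) s _ _

theorem galoisId_bijective (k A H : Type*) [CommRing k] [Ring A] [Algebra k A] [Ring H]
    [HopfAlgebra k H] : Function.Bijective (galoisId k A H) := by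
  have isUnit_id : IsUnit (toConv (LinearMap.id : H →ₗ[k] H)) :=
    ⟨⟨toConv LinearMap.id, toConv (HopfAlgebra.antipode k), LinearMap.id_mul_antipode,
      LinearMap.antipode_mul_id⟩, rfl⟩
  let e := (LinearEquiv.ofBijective _ (galois_bijective isUnit_id)).restrictScalars k
  exact (e.lTensor A).bijective

theorem isUnit_gamma (hinv : IsUnit (toConv X.f)) : IsUnit (toConv X.gamma) := by
  apply isUnit_of_galois_bijective
  have comp_eq : galois X.gamma ∘ X.assocE = X.assocE ∘ galoisId k A H ∘ galois X.f :=
    funext X.galois_gamma_assocE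
  have galois_f : Function.Bijective (galois X.f) := galois_bijective (u := toConv X.f) hinv
  have bij : Function.Bijective (galois X.gamma ∘ X.assocE) := by
    rw [comp_eq]
    exact X.assocE.bijective.comp ((galoisId_bijective k A H).comp galois_f)
  exact (Function.Bijective.of_comp_iff _ X.assocE.bijective).mp bij

end CrossedProduct

section TwistComplex

variable {k A H M : Type*} [CommRing k] [Ring A] [Algebra k A] [AddCommGroup H] [Module k H]
  [Coalgebra k H] [AddCommGroup M] [Module k M]
  {act : H →ₗ[k] A →ₗ[k] A} {P G : H →ₗ[k] Module.End k M} {L R : A →ₗ[k] Module.End k M}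

/-- The first term `a₀ φ(a₁, …, aᵣ)` of the Hochschild coboundary. -/
def leftTerm (L : A →ₗ[k] Module.End k M) {r : ℕ} (φ : MultilinearMap k (fun _ : Fin r => A) M) :
    MultilinearMap k (fun _ : Fin (r + 1) => A) M :=
  LinearMap.uncurryLeft (M := fun _ : Fin (r + 1) => A) ((postComp r).flip φ ∘ₗ L)

theorem leftTerm_apply {r : ℕ} (φ : MultilinearMap k (fun _ : Fin r => A) M)
    (a : Fin (r + 1) → A) : leftTerm L φ a = L (a 0) (φ fun i => a i.succ) := rfl

theorem leftTerm_curryLeft {r : ℕ} (φ : MultilinearMap k (fun _ : Fin r => A) M) (x : A) :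
    (leftTerm L φ).curryLeft x = postComp r (L x) φ := by
  ext a
  rw [MultilinearMap.curryLeft_apply, leftTerm_apply]
  simp

/-- The last term `φ(a₀, …, aᵣ₋₁) aᵣ` of the Hochschild coboundary. -/
def rightTerm (R : A →ₗ[k] Module.End k M) {r : ℕ} (φ : MultilinearMap k (fun _ : Fin r => A) M) :
    MultilinearMap k (fun _ : Fin (r + 1) => A) M :=
  MultilinearMap.uncurryRight (M := fun _ : Fin (r + 1) => A) (R.flip.compMultilinearMap φ)

theorem rightTerm_apply {r : ℕ} (φ : MultilinearMap k (fun _ : Fin r => A) M)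
    (a : Fin (r + 1) → A) :
    rightTerm R φ a = R (a (Fin.last r)) (φ fun i => a i.castSucc) := rfl

theorem rightTerm_curryLeft {r : ℕ} (φ : MultilinearMap k (fun _ : Fin (r + 1) => A) M) (x : A) :
    (rightTerm R φ).curryLeft x = rightTerm R (φ.curryLeft x) := by
  ext a
  rw [MultilinearMap.curryLeft_apply, rightTerm_apply, rightTerm_apply,
    MultilinearMap.curryLeft_apply]
  congr 2
  ext t
  refine Fin.cases ?_ (fun t => ?_) t <;> simp

theorem hochschildD_eq_terms {r : ℕ} (φ : MultilinearMap k (fun _ : Fin r => A) M) :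
    hochschildD L R r φ = leftTerm L φ + ∑ j : Fin r, (-1 : k) ^ ((j : ℕ) + 1) • contractMap j φ
      + (-1 : k) ^ (r + 1) • rightTerm R φ := rfl

theorem contractMap_apply {r : ℕ} (j : Fin r) (φ : MultilinearMap k (fun _ : Fin r => A) M)
    (a : Fin (r + 1) → A) : contractMap j φ a = φ (Fin.contractNth j.castSucc (· * ·) a) := rfl

theorem tail_contractNth_succ {α : Type*} {n : ℕ} (op : α → α → α) (j : Fin (n + 1))
    (b : Fin (n + 2) → α) :
    Fin.tail (Fin.contractNth j.succ op b) = Fin.contractNth j op (Fin.tail b) := by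
  ext t
  simp only [Fin.tail, Fin.contractNth, Fin.val_succ, Fin.succ_castSucc]
  simp

theorem contractMap_zero_curryLeft {r : ℕ} (φ : MultilinearMap k (fun _ : Fin (r + 1) => A) M)
    (x : A) : (contractMap 0 φ).curryLeft x = mulFirst φ x := by
  ext a
  rw [MultilinearMap.curryLeft_apply, contractMap_apply]
  change _ = φ (Fin.cons (x * a 0) (Fin.tail a))
  congr 1
  ext t
  refine Fin.cases ?_ (fun t => ?_) t
  · simp [Fin.contractNth]
  · simp [Fin.contractNth, Fin.tail]

theorem contractMap_succ_curryLeft {r : ℕ} (j : Fin r)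
    (φ : MultilinearMap k (fun _ : Fin (r + 1) => A) M) (x : A) :
    (contractMap j.succ φ).curryLeft x = contractMap j (φ.curryLeft x) := by
  ext a
  rw [MultilinearMap.curryLeft_apply, contractMap_apply, contractMap_apply,
    MultilinearMap.curryLeft_apply]
  congr 1
  rw [← Fin.succ_castSucc, ← Fin.cons_self_tail (Fin.contractNth _ _ _), tail_contractNth_succ,
    Fin.tail_cons]
  congr 1

theorem twist_leftTerm (hGL : ∀ h a m, G h (L a m) = L a (G h m)) {r : ℕ}
    (φ : MultilinearMap k (fun _ : Fin r => A) M) (h : H) (a : Fin (r + 1) → A) :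
    twist act G (r + 1) (leftTerm L φ) h a =
      sweedler ((L ∘ₗ act.flip (a 0)).compl₂ (evalAt (Fin.tail a) ∘ₗ twist act G r φ)) h := by
  rw [twist_succ]
  congr 2
  ext x y
  change twist act G r ((leftTerm L φ).curryLeft (act x (a 0))) y (Fin.tail a) =
    L (act x (a 0)) (twist act G r φ y (Fin.tail a))
  rw [leftTerm_curryLeft, twist_postComp _ fun h m => hGL h _ m]

theorem twist_contractMap
    (hact : ∀ a b : A, toConv (act.flip (a * b)) = toConv (act.flip a) * toConv (act.flip b))
    {r : ℕ} (j : Fin r) (φ : MultilinearMap k (fun _ : Fin r => A) M) (h : H)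
    (a : Fin (r + 1) → A) :
    twist act G (r + 1) (contractMap j φ) h a =
      twist act G r φ h (Fin.contractNth j.castSucc (· * ·) a) := by
  induction r generalizing h with
  | zero => exact j.elim0
  | succ r ih =>
    rw [twist_succ]
    refine Fin.cases ?_ (fun j => ?_) j
    · rw [twist_mul_first hact φ h (Fin.tail a) _ (a 0)]
      · congr 2
        ext x y
        change twist act G (r + 1) ((contractMap 0 φ).curryLeft (act x (a 0))) y (Fin.tail a) = _
        rw [contractMap_zero_curryLeft]
        rfl
      · simp [Fin.contractNth, Fin.tail]
      · ext t
        simp [Fin.contractNth, Fin.tail]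
    · rw [twist_succ, ← Fin.succ_castSucc, tail_contractNth_succ]
      have head_eq : Fin.contractNth j.castSucc.succ (· * ·) a 0 = a 0 := by
        simp [Fin.contractNth]
      rw [head_eq]
      congr 2
      ext x y
      change twist act G (r + 1) ((contractMap j.succ φ).curryLeft (act x (a 0))) y (Fin.tail a) =
        twist act G r (φ.curryLeft (act x (a 0))) y _
      rw [contractMap_succ_curryLeft, ih]

theorem twist_rightTerm
    (hGR : ∀ s, sweedler ((LinearMap.mul k (Module.End k M)).flip.compl₁₂ (R ∘ₗ act.flip s) G) =
      LinearMap.mulLeft k (R s) ∘ₗ G)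
    {r : ℕ} (φ : MultilinearMap k (fun _ : Fin r => A) M) (h : H) (a : Fin (r + 1) → A) :
    twist act G (r + 1) (rightTerm R φ) h a =
      R (a (Fin.last r)) (twist act G r φ h fun i => a i.castSucc) := by
  induction r generalizing h with
  | zero =>
    rw [twist_succ, twist_zero]
    have hGR_apply := congrArg (fun g => g h (φ fun i => a i.castSucc)) (hGR (a 0))
    simp only [sweedler_repr _ (Coalgebra.Repr.arbitrary k h), LinearMap.sum_apply]
      at hGR_apply ⊢
    refine Eq.trans (Finset.sum_congr rfl fun i _ => ?_) hGR_apply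
    change G _ ((rightTerm R φ).curryLeft _ _) = G _ (R (act _ (a 0)) (φ _))
    rw [MultilinearMap.curryLeft_apply, rightTerm_apply]
    congr 2
    congr 1
    exact Subsingleton.elim _ _
  | succ r ih =>
    rw [twist_succ, twist_succ, ← LinearMap.comp_apply, comp_sweedler]
    congr 2
    ext x y
    change twist act G (r + 1) ((rightTerm R φ).curryLeft (act x (a 0))) y (Fin.tail a) =
      R _ (twist act G r (φ.curryLeft (act x (a 0))) y _)
    rw [rightTerm_curryLeft, ih]
    rfl

theorem diagonalAct_leftTerm
    (hPL : ∀ s, sweedler ((LinearMap.mul k (Module.End k M)).compl₁₂ P (L ∘ₗ act.flip s)) =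
      LinearMap.mulLeft k (L s) ∘ₗ P)
    (hGL : ∀ h a m, G h (L a m) = L a (G h m)) {r : ℕ}
    (φ : MultilinearMap k (fun _ : Fin r => A) M) (h : H) :
    diagonalAct act P G (r + 1) h (leftTerm L φ) = leftTerm L (diagonalAct act P G r h φ) := by
  ext a
  have twist_eq : evalAt a ∘ₗ twist act G (r + 1) (leftTerm L φ) =
      sweedler ((L ∘ₗ act.flip (a 0)).compl₂ (evalAt (Fin.tail a) ∘ₗ twist act G r φ)) :=
    LinearMap.ext fun x => twist_leftTerm hGL φ x a
  have regroup : P.compl₂ (sweedler ((L ∘ₗ act.flip (a 0)).compl₂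
        (evalAt (Fin.tail a) ∘ₗ twist act G r φ))) =
      sweedler ∘ₗ (((LinearMap.mul k (Module.End k M)).compl₁₂ P (L ∘ₗ act.flip (a 0))).compr₂
        (LinearMap.lcomp k M (evalAt (Fin.tail a) ∘ₗ twist act G r φ))) := by
    ext x y
    simp [sweedler_repr _ (Coalgebra.Repr.arbitrary k y)]
  rw [leftTerm_apply, diagonalAct_apply, diagonalAct_apply, ← LinearMap.comp_apply,
    comp_sweedler, twist_eq, regroup, sweedler_coassoc, ← comp_sweedler, hPL]
  congr 2

theorem diagonalAct_contractMap
    (hact : ∀ a b : A, toConv (act.flip (a * b)) = toConv (act.flip a) * toConv (act.flip b))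
    {r : ℕ} (j : Fin r) (φ : MultilinearMap k (fun _ : Fin r => A) M) (h : H) :
    diagonalAct act P G (r + 1) h (contractMap j φ) =
      contractMap j (diagonalAct act P G r h φ) := by
  ext a
  rw [contractMap_apply, diagonalAct_apply, diagonalAct_apply]
  congr 3
  ext x
  exact twist_contractMap hact j φ x a

theorem diagonalAct_rightTerm
    (hGR : ∀ s, sweedler ((LinearMap.mul k (Module.End k M)).flip.compl₁₂ (R ∘ₗ act.flip s) G) =
      LinearMap.mulLeft k (R s) ∘ₗ G)
    (hPR : ∀ h a m, P h (R a m) = R a (P h m)) {r : ℕ}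
    (φ : MultilinearMap k (fun _ : Fin r => A) M) (h : H) :
    diagonalAct act P G (r + 1) h (rightTerm R φ) = rightTerm R (diagonalAct act P G r h φ) := by
  ext a
  rw [rightTerm_apply, diagonalAct_apply, diagonalAct_apply, ← LinearMap.comp_apply,
    comp_sweedler]
  congr 2
  ext x y
  change P x (twist act G (r + 1) _ y a) = R _ (P x (twist act G r φ y _))
  rw [twist_rightTerm hGR, hPR]

theorem diagonalAct_hochschildD
    (hact : ∀ a b : A, toConv (act.flip (a * b)) = toConv (act.flip a) * toConv (act.flip b))
    (hPL : ∀ s, sweedler ((LinearMap.mul k (Module.End k M)).compl₁₂ P (L ∘ₗ act.flip s)) =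
      LinearMap.mulLeft k (L s) ∘ₗ P)
    (hGR : ∀ s, sweedler ((LinearMap.mul k (Module.End k M)).flip.compl₁₂ (R ∘ₗ act.flip s) G) =
      LinearMap.mulLeft k (R s) ∘ₗ G)
    (hGL : ∀ h a m, G h (L a m) = L a (G h m)) (hPR : ∀ h a m, P h (R a m) = R a (P h m))
    {r : ℕ} (φ : MultilinearMap k (fun _ : Fin r => A) M) (h : H) :
    diagonalAct act P G (r + 1) h (hochschildD L R r φ) =
      hochschildD L R r (diagonalAct act P G r h φ) := by
  simp only [hochschildD_eq_terms, map_add, map_sum, map_smul, diagonalAct_leftTerm hPL hGL,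
    diagonalAct_contractMap hact, diagonalAct_rightTerm hGR hPR]

theorem twist_compMultilinearMap {N : Type*} [AddCommGroup N] [Module k N]
    {G' : H →ₗ[k] Module.End k N} (g : M →ₗ[k] N) (hG : ∀ h m, g (G h m) = G' h (g m)) {r : ℕ}
    (φ : MultilinearMap k (fun _ : Fin r => A) M) (h : H) (a : Fin r → A) :
    twist act G' r (g.compMultilinearMap φ) h a = g (twist act G r φ h a) := by
  induction r generalizing h with
  | zero => simp [twist_zero, hG]
  | succ r ih =>
    rw [twist_succ, twist_succ, ← LinearMap.comp_apply, comp_sweedler]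
    congr 2
    ext x y
    exact ih (φ.curryLeft (act x (a 0))) y (Fin.tail a)

theorem diagonalAct_compMultilinearMap {N : Type*} [AddCommGroup N] [Module k N]
    {P' G' : H →ₗ[k] Module.End k N} (g : M →ₗ[k] N) (hP : ∀ h m, g (P h m) = P' h (g m))
    (hG : ∀ h m, g (G h m) = G' h (g m)) {r : ℕ}
    (φ : MultilinearMap k (fun _ : Fin r => A) M) (h : H) :
    diagonalAct act P' G' r h (g.compMultilinearMap φ) =
      g.compMultilinearMap (diagonalAct act P G r h φ) := by
  ext a
  rw [LinearMap.compMultilinearMap_apply, diagonalAct_apply, diagonalAct_apply,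
    ← LinearMap.comp_apply, comp_sweedler]
  congr 2
  ext x y
  change P' x (twist act G' r _ y a) = g (P x (twist act G r φ y a))
  rw [twist_compMultilinearMap g hG, hP]

end TwistComplex

section TwistChange

variable {k A C M : Type*} [CommRing k] [Ring A] [Algebra k A] [AddCommGroup C] [Module k C]
  [Coalgebra k C] [AddCommGroup M] [Module k M]

theorem ofConv_mul {B : Type*} [Ring B] [Algebra k B] (u v : WithConv (C →ₗ[k] B)) :
    (u * v).ofConv = sweedler ((LinearMap.mul k B).compl₁₂ u.ofConv v.ofConv) := by
  ext c
  rw [sweedler_repr _ (Coalgebra.Repr.arbitrary k c)]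
  exact (Coalgebra.Repr.arbitrary k c).convMul_apply u v

/-- Multiplication of the first argument of a cochain by `s` from the left. A cochain without
arguments is an element `m` of `M`, which is sent to `m s`. -/
def insertLeft (R : A →ₗ[k] Module.End k M) : ∀ r : ℕ,
    MultilinearMap k (fun _ : Fin r => A) M → A →ₗ[k] MultilinearMap k (fun _ : Fin r => A) M
  | 0, φ => (postComp 0).flip φ ∘ₗ R
  | _ + 1, φ => mulFirst φ

/-- Cochains that are balanced over `T` between consecutive arguments and right linear over `T` in
the last one: whenever some arguments are filled in, an element of `T` can be moved from the right
end of these to the left end of the remaining ones. -/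
def IsBalanced (R : A →ₗ[k] Module.End k M) (T : Set A) : ∀ r : ℕ,
    MultilinearMap k (fun _ : Fin r => A) M → Prop
  | 0, _ => True
  | r + 1, φ => ∀ x, IsBalanced R T r (φ.curryLeft x) ∧
      ∀ s ∈ T, insertLeft R r (φ.curryLeft x) s = φ.curryLeft (x * s)

theorem twist_eq_sweedler_insertLeft {R : A →ₗ[k] Module.End k M} {T : Set A}
    {α β : C →ₗ[k] A →ₗ[k] A} {G₁ G₂ : C →ₗ[k] Module.End k M} {F : C →ₗ[k] A}
    (hFT : ∀ c, F c ∈ T)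
    (hF : ∀ a, toConv (α.flip a) * toConv F = toConv F * toConv (β.flip a))
    (hG : G₁ = sweedler ((LinearMap.mul k (Module.End k M)).flip.compl₁₂ (R ∘ₗ F) G₂))
    {r : ℕ} (φ : MultilinearMap k (fun _ : Fin r => A) M) (hφ : IsBalanced R T r φ) (c : C)
    (a : Fin r → A) :
    twist α G₁ r φ c a =
      sweedler ((twist β G₂ r).compr₂ (evalAt a) ∘ₗ insertLeft R r φ ∘ₗ F) c := by
  induction r generalizing c with
  | zero =>
    rw [twist_zero, hG]
    simp only [sweedler_repr _ (Coalgebra.Repr.arbitrary k c), LinearMap.sum_apply]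
    rfl
  | succ r ih =>
    let B := (twist β G₂ r ∘ₗ φ.curryLeft).compr₂ (evalAt (Fin.tail a))
    have move_past_first : ((twist α G₁ r ∘ₗ φ.curryLeft).compr₂ (evalAt (Fin.tail a))) ∘ₗ
        α.flip (a 0) = sweedler ∘ₗ ((LinearMap.mul k A).compl₁₂ (α.flip (a 0)) F).compr₂ B := by
      ext x y
      change twist α G₁ r (φ.curryLeft (α x (a 0))) y (Fin.tail a) = sweedler _ y
      rw [ih _ (hφ _).1]
      congr 2
      ext z w
      change twist β G₂ r (insertLeft R r (φ.curryLeft (α x (a 0))) (F z)) w _ =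
        twist β G₂ r (φ.curryLeft (α x (a 0) * F z)) w _
      rw [(hφ _).2 _ (hFT z)]
    have expand_first : (twist β G₂ (r + 1)).compr₂ (evalAt a) ∘ₗ insertLeft R (r + 1) φ ∘ₗ F =
        sweedler ∘ₗ ((LinearMap.mul k A).compl₁₂ F (β.flip (a 0))).compr₂ B := by
      ext x y
      change twist β G₂ (r + 1) (mulFirst φ (F x)) y a = _
      rw [twist_succ]
      congr 2
    have commute_F := congrArg ofConv (hF (a 0))
    rw [ofConv_mul, ofConv_mul] at commute_F
    rw [twist_succ, move_past_first, expand_first, sweedler_coassoc, sweedler_coassoc,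
      ← comp_sweedler, ← comp_sweedler, commute_F]

end TwistChange

section TwistMul

section Coalgebra

variable {k A H M : Type*} [CommRing k] [Ring A] [Algebra k A] [AddCommGroup H] [Module k H]
  [Coalgebra k H] [AddCommGroup M] [Module k M] (act : H →ₗ[k] A →ₗ[k] A)
  (G : H →ₗ[k] Module.End k M)

/-- The map `h ⊗ l ↦ G(h) G(l)`, which compares a weak left action with an honest one. -/
def pairing : H ⊗[k] H →ₗ[k] Module.End k M :=
  TensorProduct.lift ((LinearMap.mul k (Module.End k M)).compl₁₂ G G)

/-- The map `h ⊗ l ↦ G(l) G(h)`, which compares a weak right action with an honest one. -/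
def pairingRev : H ⊗[k] H →ₗ[k] Module.End k M :=
  TensorProduct.lift ((LinearMap.mul k (Module.End k M)).flip.compl₁₂ G G)

theorem sweedler_tmul {D V : Type*} [AddCommGroup D] [Module k D] [Coalgebra k D] [AddCommGroup V]
    [Module k V] (β : H ⊗[k] D →ₗ[k] H ⊗[k] D →ₗ[k] V) {h : H} {d : D} {ι κ : Type*}
    (r : Coalgebra.Repr k h ι) (s : Coalgebra.Repr k d κ) :
    sweedler β (h ⊗ₜ d) = ∑ i ∈ r.index, ∑ j ∈ s.index,
      β (r.left i ⊗ₜ s.left j) (r.right i ⊗ₜ s.right j) := by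
  rw [sweedler_apply, TensorProduct.comul_tmul, ← r.eq, ← s.eq]
  simp [TensorProduct.sum_tmul, TensorProduct.tmul_sum, Finset.sum_comm (s := r.index)]

theorem twist_succ_curryLeft {r : ℕ} (φ : MultilinearMap k (fun _ : Fin (r + 1) => A) M) {h : H}
    (x : A) {ι : Type*} (s : Coalgebra.Repr k h ι) :
    (twist act G (r + 1) φ h).curryLeft x =
      ∑ i ∈ s.index, twist act G r (φ.curryLeft (act (s.left i) x)) (s.right i) := by
  ext a
  rw [MultilinearMap.curryLeft_apply, twist_succ, sweedler_repr _ s]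
  simp [evalAt]

theorem twist_twist {r : ℕ} (φ : MultilinearMap k (fun _ : Fin r => A) M) (h l : H)
    (a : Fin r → A) :
    twist act G r (twist act G r φ h) l a = twist (pairing act) (pairingRev G) r φ (h ⊗ₜ l) a := by
  induction r generalizing h l with
  | zero => rfl
  | succ r ih =>
    have s := Coalgebra.Repr.arbitrary k h
    have t := Coalgebra.Repr.arbitrary k l
    rw [twist_succ, twist_succ, sweedler_tmul _ s t, sweedler_repr _ t, Finset.sum_comm]
    refine Finset.sum_congr rfl fun j _ => ?_
    change twist act G r ((twist act G (r + 1) φ h).curryLeft (act (t.left j) (a 0))) (t.right j)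
      (Fin.tail a) = _
    rw [twist_succ_curryLeft _ _ _ _ s, map_sum, LinearMap.sum_apply, sum_apply]
    exact Finset.sum_congr rfl fun i _ => ih _ _ _ _

variable {act G} {P : H →ₗ[k] Module.End k M}

theorem diagonalAct_diagonalAct (hGP : ∀ h l m, G h (P l m) = P l (G h m)) {r : ℕ}
    (φ : MultilinearMap k (fun _ : Fin r => A) M) (h l : H) (a : Fin r → A) :
    diagonalAct act P G r l (diagonalAct act P G r h φ) a =
      sweedler ((pairingRev P).compl₂ (evalAt a ∘ₗ twist (pairing act) (pairingRev G) r φ))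
        (h ⊗ₜ l) := by
  have s := Coalgebra.Repr.arbitrary k h
  have t := Coalgebra.Repr.arbitrary k l
  have inner_eq : diagonalAct act P G r h φ =
      ∑ i ∈ s.index, postComp r (P (s.left i)) (twist act G r φ (s.right i)) := by
    ext b
    rw [diagonalAct_apply, sweedler_repr _ s, sum_apply]
    rfl
  rw [inner_eq, map_sum, sum_apply, sweedler_tmul _ s t]
  refine Finset.sum_congr rfl fun i _ => ?_
  rw [diagonalAct_apply, sweedler_repr _ t]
  refine Finset.sum_congr rfl fun j _ => ?_
  change P _ (twist act G r (postComp r _ _) _ a) = P _ (P _ (twist _ _ r φ _ a))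
  rw [twist_postComp _ fun x m => hGP x _ m, twist_twist]

end Coalgebra

variable {k A H M : Type*} [CommRing k] [Ring A] [Algebra k A] [Ring H] [Bialgebra k H]
  [AddCommGroup M] [Module k M] {act : H →ₗ[k] A →ₗ[k] A} {G P : H →ₗ[k] Module.End k M}

theorem sweedler_mul {V : Type*} [AddCommGroup V] [Module k V] (β : H →ₗ[k] H →ₗ[k] V) {h l : H}
    {ι κ : Type*} (r : Coalgebra.Repr k h ι) (s : Coalgebra.Repr k l κ) :
    sweedler β (h * l) = ∑ i ∈ r.index, ∑ j ∈ s.index,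
      β (r.left i * s.left j) (r.right i * s.right j) := by
  rw [sweedler_repr _ (r.mul s)]
  exact Finset.sum_product _ _ _

theorem twist_comp_mul {r : ℕ} (φ : MultilinearMap k (fun _ : Fin r => A) M) (h l : H)
    (a : Fin r → A) :
    twist (act ∘ₗ LinearMap.mul' k H) (G ∘ₗ LinearMap.mul' k H) r φ (h ⊗ₜ l) a =
      twist act G r φ (h * l) a := by
  induction r generalizing h l with
  | zero => rfl
  | succ r ih =>
    have s := Coalgebra.Repr.arbitrary k h
    have t := Coalgebra.Repr.arbitrary k l
    rw [twist_succ, twist_succ, sweedler_tmul _ s t, sweedler_mul _ s t]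
    exact Finset.sum_congr rfl fun i _ => Finset.sum_congr rfl fun j _ => ih _ _ _ _

theorem diagonalAct_mul_apply {r : ℕ} (φ : MultilinearMap k (fun _ : Fin r => A) M) (h l : H)
    (a : Fin r → A) :
    diagonalAct act P G r (h * l) φ a =
      sweedler ((P ∘ₗ LinearMap.mul' k H).compl₂ (evalAt a ∘ₗ
        twist (act ∘ₗ LinearMap.mul' k H) (G ∘ₗ LinearMap.mul' k H) r φ)) (h ⊗ₜ l) := by
  rw [diagonalAct_apply, sweedler_mul _ (.arbitrary k h) (.arbitrary k l),
    sweedler_tmul _ (.arbitrary k h) (.arbitrary k l)]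
  refine Finset.sum_congr rfl fun i _ => Finset.sum_congr rfl fun j _ => ?_
  change P _ (twist act G r φ _ a) = P _ (twist _ _ r φ _ a)
  rw [twist_comp_mul, LinearMap.mul'_apply]

theorem diagonalAct_mul {L R : A →ₗ[k] Module.End k M} {T : Set A} {f : H ⊗[k] H →ₗ[k] A}
    (hfT : ∀ c, f c ∈ T)
    (hf : ∀ a, toConv ((pairing act).flip a) * toConv f =
      toConv f * toConv ((act ∘ₗ LinearMap.mul' k H).flip a))
    (hG : pairingRev G = sweedler ((LinearMap.mul k (Module.End k M)).flip.compl₁₂ (R ∘ₗ f)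
      (G ∘ₗ LinearMap.mul' k H)))
    (hP : sweedler ((LinearMap.mul k (Module.End k M)).compl₁₂ (pairingRev P) (L ∘ₗ f)) =
      P ∘ₗ LinearMap.mul' k H)
    (hGL : ∀ h a m, G h (L a m) = L a (G h m)) (hGP : ∀ h l m, G h (P l m) = P l (G h m))
    {r : ℕ} (φ : MultilinearMap k (fun _ : Fin r => A) M) (hφ : IsBalanced R T r φ)
    (hφL : ∀ s ∈ T, insertLeft R r φ s = postComp r (L s) φ) (h l : H) :
    diagonalAct act P G r (h * l) φ = diagonalAct act P G r l (diagonalAct act P G r h φ) := by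
  ext a
  let τ := evalAt a ∘ₗ twist (act ∘ₗ LinearMap.mul' k H) (G ∘ₗ LinearMap.mul' k H) r φ
  have twist_eq : evalAt a ∘ₗ twist (pairing act) (pairingRev G) r φ =
      sweedler ((L ∘ₗ f).compl₂ τ) := by
    refine LinearMap.ext fun c => ?_
    refine (twist_eq_sweedler_insertLeft hfT hf hG φ hφ c a).trans ?_
    congr 2
    refine LinearMap.ext fun x => LinearMap.ext fun y => ?_
    change twist _ _ r (insertLeft R r φ (f x)) y a = L (f x) (twist _ _ r φ y a)
    rw [hφL _ (hfT x), twist_postComp]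
    exact fun z m => hGL _ _ _
  have regroup : (pairingRev P).compl₂ (sweedler ((L ∘ₗ f).compl₂ τ)) =
      sweedler ∘ₗ (((LinearMap.mul k (Module.End k M)).compl₁₂ (pairingRev P) (L ∘ₗ f)).compr₂
        (LinearMap.lcomp k M τ)) := by
    refine LinearMap.ext fun x => LinearMap.ext fun y => ?_
    simp [sweedler_repr _ (Coalgebra.Repr.arbitrary k y)]
  rw [diagonalAct_diagonalAct hGP, diagonalAct_mul_apply, twist_eq, regroup, sweedler_coassoc,
    ← comp_sweedler, hP]
  congr 2

theorem sweedler_one {V : Type*} [AddCommGroup V] [Module k V] (β : H →ₗ[k] H →ₗ[k] V) :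
    sweedler β 1 = β 1 1 := by
  rw [sweedler_apply, Bialgebra.comul_one, Algebra.TensorProduct.one_def, TensorProduct.lift.tmul]

theorem twist_one (hact : ∀ a, act 1 a = a) (hG : ∀ m, G 1 m = m) {r : ℕ}
    (φ : MultilinearMap k (fun _ : Fin r => A) M) (a : Fin r → A) : twist act G r φ 1 a = φ a := by
  induction r with
  | zero => rw [twist_zero, hG]
  | succ r ih =>
    rw [twist_succ, sweedler_one]
    change twist act G r (φ.curryLeft (act 1 (a 0))) 1 (Fin.tail a) = _
    rw [ih, hact, MultilinearMap.curryLeft_apply, Fin.cons_self_tail]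

theorem diagonalAct_one (hact : ∀ a, act 1 a = a) (hG : ∀ m, G 1 m = m) (hP : ∀ m, P 1 m = m)
    {r : ℕ} (φ : MultilinearMap k (fun _ : Fin r => A) M) : diagonalAct act P G r 1 φ = φ := by
  ext a
  rw [diagonalAct_apply, sweedler_one]
  change P 1 (twist act G r φ 1 a) = φ a
  rw [hP, twist_one hact hG]

end TwistMul

section RelBalanced

variable {k A M : Type*} [CommRing k] [Ring A] [Algebra k A] [AddCommGroup M] [Module k M]
  {S : Subalgebra k A} {L R : A →ₗ[k] Module.End k M}

theorem cons_mul_tail {n : ℕ} (s : A) (a : Fin (n + 1) → A) :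
    Fin.cons (s * a 0) (Fin.tail a) = Function.update a 0 (s * a 0) := by
  rw [← Fin.update_cons_zero (a 0), Fin.cons_self_tail]

theorem isBalanced_of_balanced {r : ℕ} {φ : MultilinearMap k (fun _ : Fin r => A) M}
    (hb : ∀ i j : Fin r, (j : ℕ) = i + 1 → ∀ s ∈ S, ∀ a : Fin r → A,
      φ (Function.update a i (a i * s)) = φ (Function.update a j (s * a j)))
    (hr : ∀ i : Fin r, (i : ℕ) + 1 = r → ∀ s ∈ S, ∀ a : Fin r → A,
      φ (Function.update a i (a i * s)) = R s (φ a)) : IsBalanced R (S : Set A) r φ := by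
  induction r with
  | zero => trivial
  | succ r ih =>
    refine fun x => ⟨ih (fun i j hij s hs a => ?_) (fun i hi s hs a => ?_), fun s hs => ?_⟩
    · simpa only [← Fin.cons_update, Fin.cons_succ, MultilinearMap.curryLeft_apply] using
        hb i.succ j.succ (by simpa using hij) s hs (Fin.cons x a)
    · simpa only [← Fin.cons_update, Fin.cons_succ, MultilinearMap.curryLeft_apply] using
        hr i.succ (by simpa using hi) s hs (Fin.cons x a)
    · ext a
      cases r with
      | zero =>
        have map_mul_right := hr 0 rfl s hs (Fin.cons x a)
        simp only [Fin.update_cons_zero, Fin.cons_zero] at map_mul_right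
        exact map_mul_right.symm
      | succ r =>
        have balanced := hb 0 (Fin.succ 0) rfl s hs (Fin.cons x a)
        simp only [Fin.cons_zero, Fin.update_cons_zero, Fin.cons_succ,
          ← Fin.cons_update] at balanced
        change φ (Fin.cons x (Fin.cons (s * a 0) (Fin.tail a))) = φ (Fin.cons (x * s) a)
        rw [balanced, cons_mul_tail]

theorem IsRelCochain.isBalanced {r : ℕ} {φ : MultilinearMap k (fun _ : Fin r => A) M}
    (h : IsRelCochain S L R φ) : IsBalanced R (S : Set A) r φ :=
  isBalanced_of_balanced h.balanced h.map_right

theorem IsRelCochain.insertLeft_eq {r : ℕ} {φ : MultilinearMap k (fun _ : Fin r => A) M}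
    (h : IsRelCochain S L R φ) {s : A} (hs : s ∈ (S : Set A)) :
    insertLeft R r φ s = postComp r (L s) φ := by
  ext a
  cases r with
  | zero => exact (h.central rfl s hs a).symm
  | succ r =>
    change φ (Fin.cons (s * a 0) (Fin.tail a)) = L s (φ a)
    rw [cons_mul_tail, h.map_left 0 rfl s hs a]

end RelBalanced

section Convolution

variable {k B C D H N : Type*} [CommRing k] [Ring B] [Algebra k B] [AddCommGroup C] [Module k C]
  [Coalgebra k C] [AddCommGroup D] [Module k D] [Coalgebra k D] [Ring H] [Bialgebra k H]
  [AddCommGroup N] [Module k N]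

theorem convMul_tmul (u v : WithConv (C ⊗[k] D →ₗ[k] B)) {c : C} {d : D} {ι κ : Type*}
    (r : Coalgebra.Repr k c ι) (s : Coalgebra.Repr k d κ) :
    (u * v).ofConv (c ⊗ₜ d) = ∑ i ∈ r.index, ∑ j ∈ s.index,
      u.ofConv (r.left i ⊗ₜ s.left j) * v.ofConv (r.right i ⊗ₜ s.right j) := by
  rw [ofConv_mul, sweedler_tmul _ r s]
  rfl

theorem convOne_tmul (c : C) (d : D) : (1 : WithConv (C ⊗[k] D →ₗ[k] B)).ofConv (c ⊗ₜ d) =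
    algebraMap k B (Coalgebra.counit (R := k) c * Coalgebra.counit (R := k) d) := by
  rw [mul_comm]
  rfl

theorem convMul_comp_mul (u v : WithConv (H →ₗ[k] B)) :
    toConv ((u * v).ofConv ∘ₗ LinearMap.mul' k H) =
      toConv (u.ofConv ∘ₗ LinearMap.mul' k H) * toConv (v.ofConv ∘ₗ LinearMap.mul' k H) :=
  ofConv_injective (LinearMap.convMul_comp_coalgHom_distrib u v (Bialgebra.mulCoalgHom k H))

theorem convOne_comp_mul :
    toConv ((1 : WithConv (H →ₗ[k] B)).ofConv ∘ₗ LinearMap.mul' k H) = 1 :=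
  ofConv_injective <| TensorProduct.ext' fun h l => by
    rw [convOne_tmul, ← Bialgebra.counit_mul]
    rfl

theorem counit_smulRight_comp_mul (b : B) :
    (Coalgebra.counit (R := k) (A := H)).smulRight b ∘ₗ LinearMap.mul' k H =
      (Coalgebra.counit (R := k) (A := H ⊗[k] H)).smulRight b :=
  TensorProduct.ext' fun h l => by simp [mul_comm]

theorem sum_counit_smul_left {c : C} {ι : Type*} (r : Coalgebra.Repr k c ι) :
    ∑ i ∈ r.index, Coalgebra.counit (R := k) (r.right i) • r.left i = c := by
  have sum_tmul := congrArg (TensorProduct.rid k C) (Coalgebra.sum_tmul_counit_eq r)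
  simpa only [map_sum, TensorProduct.rid_tmul, one_smul] using sum_tmul

theorem mul_counit_smulRight (u : WithConv (C →ₗ[k] B)) (b : B) :
    u * toConv ((Coalgebra.counit (R := k) (A := C)).smulRight b) =
      toConv (LinearMap.mulRight k b ∘ₗ u.ofConv) := by
  refine ofConv_injective <| LinearMap.ext fun c => ?_
  have r := Coalgebra.Repr.arbitrary k c
  rw [ofConv_mul, sweedler_repr _ r]
  change _ = u.ofConv c * b
  conv_rhs => rw [← sum_counit_smul_left r, map_sum, Finset.sum_mul]
  refine Finset.sum_congr rfl fun i _ => ?_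
  rw [map_smul, smul_mul_assoc]
  exact mul_smul_comm _ _ _

/-- The action of the convolution algebra `Hom(C, B)` on `Hom(C, N)`, for `N` with a left action
`L` of `B`: `(u ζ)(c) = u(c⁽¹⁾) ζ(c⁽²⁾)`. -/
def convAct (L : B →ₗ[k] Module.End k N) (u : WithConv (C →ₗ[k] B)) :
    (C →ₗ[k] N) →ₗ[k] C →ₗ[k] N where
  toFun ζ := sweedler ((L ∘ₗ u.ofConv).compl₂ ζ)
  map_add' ζ ξ := by rw [← map_add]; congr 1; ext; simp
  map_smul' a ζ := by rw [RingHom.id_apply, ← map_smul]; congr 1; ext; simp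

theorem convAct_repr (L : B →ₗ[k] Module.End k N) (u : WithConv (C →ₗ[k] B)) (ζ : C →ₗ[k] N)
    {c : C} {ι : Type*} (r : Coalgebra.Repr k c ι) :
    convAct L u ζ c = ∑ i ∈ r.index, L (u.ofConv (r.left i)) (ζ (r.right i)) :=
  sweedler_repr _ r

theorem convAct_tmul (L : B →ₗ[k] Module.End k N) (u : WithConv (C ⊗[k] D →ₗ[k] B))
    (ζ : C ⊗[k] D →ₗ[k] N) {c : C} {d : D} {ι κ : Type*} (r : Coalgebra.Repr k c ι)
    (s : Coalgebra.Repr k d κ) : convAct L u ζ (c ⊗ₜ d) = ∑ i ∈ r.index, ∑ j ∈ s.index,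
      L (u.ofConv (r.left i ⊗ₜ s.left j)) (ζ (r.right i ⊗ₜ s.right j)) :=
  sweedler_tmul _ r s

theorem convAct_comp_mul (L : B →ₗ[k] Module.End k N) (u : WithConv (H →ₗ[k] B)) (ζ : H →ₗ[k] N) :
    convAct L u ζ ∘ₗ LinearMap.mul' k H =
      convAct L (toConv (u.ofConv ∘ₗ LinearMap.mul' k H)) (ζ ∘ₗ LinearMap.mul' k H) :=
  TensorProduct.ext' fun x y => by
    rw [convAct_tmul _ _ _ (.arbitrary k x) (.arbitrary k y)]
    exact sweedler_mul ((L ∘ₗ u.ofConv).compl₂ ζ) _ _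

theorem convAct_mul {L : B →ₗ[k] Module.End k N} (hL : ∀ b c n, L (b * c) n = L b (L c n))
    (u v : WithConv (C →ₗ[k] B)) (ζ : C →ₗ[k] N) :
    convAct L (u * v) ζ = convAct L u (convAct L v ζ) := by
  have regroup : (L ∘ₗ u.ofConv).compl₂ (convAct L v ζ) = sweedler ∘ₗ
      (((LinearMap.mul k B).compl₁₂ u.ofConv v.ofConv).compr₂ (LinearMap.lcomp k N ζ ∘ₗ L)) := by
    refine LinearMap.ext fun x => LinearMap.ext fun y => ?_
    rw [LinearMap.compl₂_apply, convAct_repr _ _ _ (.arbitrary k y)]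
    change _ = sweedler _ y
    rw [sweedler_repr _ (.arbitrary k y)]
    simp [hL]
  change _ = sweedler _
  rw [regroup, sweedler_coassoc, ← comp_sweedler, ← ofConv_mul]
  rfl

theorem convAct_counit_smulRight {L : B →ₗ[k] Module.End k N} (u : WithConv (C →ₗ[k] B)) (n : N) :
    convAct L u ((Coalgebra.counit (R := k) (A := C)).smulRight n) = L.flip n ∘ₗ u.ofConv := by
  refine LinearMap.ext fun c => ?_
  have r := Coalgebra.Repr.arbitrary k c
  rw [convAct_repr _ _ _ r]
  conv_rhs => rw [← sum_counit_smul_left r, map_sum]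
  exact Finset.sum_congr rfl fun i _ => by simp

theorem convAct_one {L : B →ₗ[k] Module.End k N} (hL : ∀ n, L 1 n = n) (ζ : C →ₗ[k] N) :
    convAct L 1 ζ = ζ := by
  refine LinearMap.ext fun c => ?_
  have r := Coalgebra.Repr.arbitrary k c
  rw [convAct_repr _ _ _ r]
  conv_rhs => rw [← Coalgebra.sum_counit_smul r, map_sum]
  refine Finset.sum_congr rfl fun i _ => ?_
  change L (algebraMap k B (Coalgebra.counit (r.left i))) _ = _
  rw [Algebra.algebraMap_eq_smul_one, map_smul, LinearMap.smul_apply, hL, map_smul]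

end Convolution

namespace CrossedProduct

variable {k A H : Type*} [CommRing k] [Ring A] [Algebra k A] [Ring H] [HopfAlgebra k H]
  (X : CrossedProduct k A H)

theorem inclA_one : X.inclA 1 = 1 := rfl

theorem gamma_one : X.gamma 1 = 1 := rfl

/-- The inclusion `a ↦ a # 1` as an algebra homomorphism. -/
def inclAlgHom : A →ₐ[k] X.E := AlgHom.ofLinearMap X.inclA X.inclA_one X.inclA_mul

theorem inclA_injective : Function.Injective X.inclA :=
  Function.LeftInverse.injective (g := fun x => TensorProduct.rid k A
    ((Coalgebra.counit (R := k) (A := H)).lTensor A x)) fun a => by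
      change TensorProduct.rid k A ((Coalgebra.counit (R := k) (A := H)).lTensor A (a ⊗ₜ 1)) = a
      rw [LinearMap.lTensor_tmul, Bialgebra.counit_one, TensorProduct.rid_tmul, one_smul]

theorem inclA_comp_ofConv_mul {C : Type*} [AddCommGroup C] [Module k C] [Coalgebra k C]
    (u v : WithConv (C →ₗ[k] A)) : toConv (X.inclA ∘ₗ (u * v).ofConv) =
      toConv (X.inclA ∘ₗ u.ofConv) * toConv (X.inclA ∘ₗ v.ofConv) :=
  ofConv_injective <| LinearMap.algHom_comp_convMul_distrib X.inclAlgHom u v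

theorem gammaInv_mul (hu : IsUnit (toConv X.gamma)) : toConv X.gammaInv * toConv X.gamma = 1 :=
  Ring.inverse_mul_cancel _ hu

theorem mul_gammaInv (hu : IsUnit (toConv X.gamma)) : toConv X.gamma * toConv X.gammaInv = 1 :=
  Ring.mul_inverse_cancel _ hu

theorem sum_gammaInv_mul (hu : IsUnit (toConv X.gamma)) {h : H} {ι : Type*}
    (r : Coalgebra.Repr k h ι) : ∑ i ∈ r.index, X.gammaInv (r.left i) * X.gamma (r.right i) =
      algebraMap k X.E (Coalgebra.counit h) :=
  (r.convMul_apply (toConv X.gammaInv) (toConv X.gamma)).symm.trans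
    (by rw [X.gammaInv_mul hu]; rfl)

theorem gammaInv_one (hu : IsUnit (toConv X.gamma)) : X.gammaInv 1 = 1 := by
  have inv_mul_at_one := congrArg (fun g => g.ofConv 1) (X.gammaInv_mul hu)
  rw [ofConv_mul, sweedler_one] at inv_mul_at_one
  simpa [X.gamma_one] using inv_mul_at_one

/-- The map `h ⊗ l ↦ γ(h) γ(l)`, in the convolution algebra of `H ⊗ H`. -/
def gammaGamma : WithConv (H ⊗[k] H →ₗ[k] X.E) :=
  toConv (TensorProduct.lift ((LinearMap.mul k X.E).compl₁₂ X.gamma X.gamma))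

/-- The map `h ⊗ l ↦ γ(h l)`, in the convolution algebra of `H ⊗ H`. -/
def gammaMul : WithConv (H ⊗[k] H →ₗ[k] X.E) := toConv (X.gamma ∘ₗ LinearMap.mul' k H)

/-- The map `h ⊗ l ↦ γ⁻¹(h l)`, in the convolution algebra of `H ⊗ H`. -/
def gammaInvMul : WithConv (H ⊗[k] H →ₗ[k] X.E) := toConv (X.gammaInv ∘ₗ LinearMap.mul' k H)

/-- The map `h ⊗ l ↦ γ⁻¹(l) γ⁻¹(h)`, in the convolution algebra of `H ⊗ H`. -/
def gammaInvGammaInv : WithConv (H ⊗[k] H →ₗ[k] X.E) :=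
  toConv (TensorProduct.lift ((LinearMap.mul k X.E).flip.compl₁₂ X.gammaInv X.gammaInv))

/-- The cocycle `f`, with values in the crossed product. -/
def cocycleE : WithConv (H ⊗[k] H →ₗ[k] X.E) := toConv (X.inclA ∘ₗ X.f)

theorem gammaGamma_eq : X.gammaGamma = X.cocycleE * X.gammaMul := by
  refine ofConv_injective <| TensorProduct.ext' fun h l => ?_
  rw [convMul_tmul _ _ (.arbitrary k h) (.arbitrary k l)]
  exact X.gamma_mul_gamma _ _

theorem gammaMul_mul_gammaInvMul (hu : IsUnit (toConv X.gamma)) :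
    X.gammaMul * X.gammaInvMul = 1 := by
  have comp_mul := convMul_comp_mul (toConv X.gamma) (toConv X.gammaInv)
  rw [X.mul_gammaInv hu, convOne_comp_mul] at comp_mul
  exact comp_mul.symm

theorem gammaInvGammaInv_mul_gammaGamma (hu : IsUnit (toConv X.gamma)) :
    X.gammaInvGammaInv * X.gammaGamma = 1 := by
  refine ofConv_injective <| TensorProduct.ext' fun h l => ?_
  have s := Coalgebra.Repr.arbitrary k h
  have t := Coalgebra.Repr.arbitrary k l
  have reassoc (i j) : X.gammaInvGammaInv.ofConv (s.left i ⊗ₜ t.left j) *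
      X.gammaGamma.ofConv (s.right i ⊗ₜ t.right j) = X.gammaInv (t.left j) *
        (X.gammaInv (s.left i) * X.gamma (s.right i)) * X.gamma (t.right j) := by
    change X.gammaInv _ * X.gammaInv _ * (X.gamma _ * X.gamma _) = _
    simp only [mul_assoc]
  rw [convMul_tmul _ _ s t, convOne_tmul, Finset.sum_comm]
  simp only [reassoc, ← Finset.sum_mul, ← Finset.mul_sum, X.sum_gammaInv_mul hu s]
  simp only [← Algebra.commutes, mul_assoc]
  rw [← Finset.mul_sum, X.sum_gammaInv_mul hu t, map_mul]

theorem gammaInvGammaInv_mul_cocycleE (hu : IsUnit (toConv X.gamma)) :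
    X.gammaInvGammaInv * X.cocycleE = X.gammaInvMul :=
  left_inv_eq_right_inv
    (by rw [mul_assoc, ← gammaGamma_eq, X.gammaInvGammaInv_mul_gammaGamma hu])
    (X.gammaMul_mul_gammaInvMul hu)

theorem gamma_mul_inclA_repr {h : H} {ι : Type*} (r : Coalgebra.Repr k h ι) (a : A) :
    X.gamma h * X.inclA a =
      ∑ i ∈ r.index, X.inclA (X.act (r.left i) a) * X.gamma (r.right i) := by
  rw [gamma_mul_inclA, sweedler_repr _ r]
  rfl

theorem gammaGamma_mul_const (a : A) : X.gammaGamma *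
      toConv ((Coalgebra.counit (R := k) (A := H ⊗[k] H)).smulRight (X.inclA a)) =
    toConv (X.inclA ∘ₗ (pairing X.act).flip a) * X.gammaGamma := by
  refine ofConv_injective <| TensorProduct.ext' fun h l => ?_
  have s := Coalgebra.Repr.arbitrary k h
  have t := Coalgebra.Repr.arbitrary k l
  rw [mul_counit_smulRight, convMul_tmul _ _ s t]
  change X.gamma h * X.gamma l * X.inclA a = _
  rw [mul_assoc, X.gamma_mul_inclA_repr t, Finset.mul_sum, Finset.sum_comm]
  refine Finset.sum_congr rfl fun j _ => ?_
  rw [← mul_assoc, X.gamma_mul_inclA_repr s, Finset.sum_mul]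
  exact Finset.sum_congr rfl fun i _ => mul_assoc _ _ _

theorem gammaMul_mul_const (a : A) : X.gammaMul *
      toConv ((Coalgebra.counit (R := k) (A := H ⊗[k] H)).smulRight (X.inclA a)) =
    toConv (X.inclA ∘ₗ (X.act ∘ₗ LinearMap.mul' k H).flip a) * X.gammaMul := by
  have comp_mul := congrArg (fun u => toConv (u.ofConv ∘ₗ LinearMap.mul' k H)) (X.conv_eq a)
  simp only [convMul_comp_mul, counit_smulRight_comp_mul] at comp_mul
  exact comp_mul.symm

/-- `(aˡ)ʰ f = f aʰˡ`: multiplying `γ(h) γ(l) = f(h, l) γ(h l)` by `a` on the right and moving `a`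
past both sides yields this identity times the invertible `γ(h l)`. -/
theorem act_act_mul_cocycle (hu : IsUnit (toConv X.gamma)) (a : A) :
    toConv ((pairing X.act).flip a) * toConv X.f =
      toConv X.f * toConv ((X.act ∘ₗ LinearMap.mul' k H).flip a) := by
  have moved := X.gammaGamma_mul_const a
  rw [gammaGamma_eq, mul_assoc, gammaMul_mul_const, ← mul_assoc, ← mul_assoc] at moved
  have cancelled := congrArg (· * X.gammaInvMul) moved
  simp only [mul_assoc, X.gammaMul_mul_gammaInvMul hu, mul_one] at cancelled
  have in_E := (X.inclA_comp_ofConv_mul (toConv X.f) _).trans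
    (cancelled.trans (X.inclA_comp_ofConv_mul _ (toConv X.f)).symm)
  exact ofConv_injective <| LinearMap.ext fun c =>
    X.inclA_injective (LinearMap.congr_fun (toConv_injective in_E.symm) c)

end CrossedProduct

section TotalComplex

variable {k H : Type*} [CommRing k] [Ring H] [HopfAlgebra k H]

section Bar

variable {N N' : Type*} [AddCommGroup N] [Module k N] [AddCommGroup N'] [Module k N']
  {ρ : H →ₗ[k] Module.End k N} {ρ' : H →ₗ[k] Module.End k N'}

theorem isActionPair_counit (hρ : ∀ h l x, ρ (h * l) x = ρ l (ρ h x)) :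
    IsActionPair ((Coalgebra.counit (R := k) (A := H)).smulRight (1 : Module.End k N)) ρ where
  left_mul a b n := by simpa [mul_smul] using smul_comm _ _ _
  right_mul := hρ
  comm a b n := by simp

theorem barD_barD (hρ : ∀ h l x, ρ (h * l) x = ρ l (ρ h x)) (s : ℕ)
    (φ : MultilinearMap k (fun _ : Fin s => H) N) : barD ρ (s + 1) (barD ρ s φ) = 0 :=
  hochschildD_hochschildD (isActionPair_counit hρ) s φ

theorem barD_compMultilinearMap {g : N →ₗ[k] N'} (hg : ∀ h x, g (ρ h x) = ρ' h (g x)) (s : ℕ)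
    (φ : MultilinearMap k (fun _ : Fin s => H) N) :
    barD ρ' s (g.compMultilinearMap φ) = g.compMultilinearMap (barD ρ s φ) :=
  hochschildD_compMultilinearMap g (by simp) hg s φ

theorem barD_contractLast {K : (H →ₗ[k] N) →ₗ[k] N} (hK : ∀ h ξ, K (homRight h ξ) = ρ h (K ξ))
    {s : ℕ} {φ : MultilinearMap k (fun _ : Fin (s + 1) => H) N}
    (hKφ : (K ∘ₗ ρ.flip).compMultilinearMap φ = φ) (hφ : barD ρ (s + 1) φ = 0) :
    barD ρ s ((-1 : k) ^ (s + 1) • contractLast K s φ) = φ :=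
  hochschildD_contractLast (fun h ξ => map_smul K (Coalgebra.counit h) ξ) hK hKφ hφ

end Bar

variable {C C' : ℕ → Type*} [∀ r, AddCommGroup (C r)] [∀ r, Module k (C r)]
  [∀ r, AddCommGroup (C' r)] [∀ r, Module k (C' r)]
  {d : ∀ r, C r →ₗ[k] C (r + 1)} {ρ : ∀ r, H →ₗ[k] Module.End k (C r)}
  {d' : ∀ r, C' r →ₗ[k] C' (r + 1)} {ρ' : ∀ r, H →ₗ[k] Module.End k (C' r)}

theorem totD_zero_succ {n s : ℕ} (h : 0 + (s + 1) = n + 1) (x : TotCochain k H C n) :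
    totD d ρ n x ⟨(0, s + 1), h⟩ = barD (ρ 0) s (x ⟨(0, s), by omega⟩) := by
  change 0 + (-1 : k) ^ 0 • barD (ρ 0) s (x ⟨(0, s), by omega⟩) = _
  rw [pow_zero, one_smul, zero_add]

theorem totD_succ_zero {n r : ℕ} (h : r + 1 + 0 = n + 1) (x : TotCochain k H C n) :
    totD d ρ n x ⟨(r + 1, 0), h⟩ = (d r).compMultilinearMap (x ⟨(r, 0), by omega⟩) :=
  add_zero _

theorem totD_succ_succ {n r s : ℕ} (h : r + 1 + (s + 1) = n + 1) (x : TotCochain k H C n) :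
    totD d ρ n x ⟨(r + 1, s + 1), h⟩ = (d r).compMultilinearMap (x ⟨(r, s + 1), by omega⟩) +
      (-1 : k) ^ (r + 1) • barD (ρ (r + 1)) s (x ⟨(r + 1, s), by omega⟩) := rfl

/-- The map of total complexes induced by maps of the coefficients. -/
def totMap (k H : Type*) [CommRing k] [Ring H] [HopfAlgebra k H] {C C' : ℕ → Type*}
    [∀ r, AddCommGroup (C r)] [∀ r, Module k (C r)]
    [∀ r, AddCommGroup (C' r)] [∀ r, Module k (C' r)] (g : ∀ r, C r →ₗ[k] C' r) (n : ℕ) :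
    TotCochain k H C n →ₗ[k] TotCochain k H C' n :=
  LinearMap.pi fun p => (g p.1.1).compMultilinearMapₗ k ∘ₗ LinearMap.proj p

theorem totMap_apply (g : ∀ r, C r →ₗ[k] C' r) (n : ℕ) (x : TotCochain k H C n)
    (p : {p : ℕ × ℕ // p.1 + p.2 = n}) :
    totMap k H g n x p = (g p.1.1).compMultilinearMap (x p) := rfl

theorem totD_totMap {g : ∀ r, C r →ₗ[k] C' r} (hd : ∀ r x, g (r + 1) (d r x) = d' r (g r x))
    (hρ : ∀ r h x, g r (ρ r h x) = ρ' r h (g r x)) (n : ℕ) (x : TotCochain k H C n) :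
    totD d' ρ' n (totMap k H g n x) = totMap k H g (n + 1) (totD d ρ n x) := by
  have hor (r s) (φ : MultilinearMap k (fun _ : Fin s => H) (C r)) :
      (d' r).compMultilinearMap ((g r).compMultilinearMap φ) =
        (g (r + 1)).compMultilinearMap ((d r).compMultilinearMap φ) := by
    ext
    simp [hd]
  funext ⟨⟨r, s⟩, h⟩
  rcases r with _ | r <;> rcases s with _ | s
  · omega
  · simp only [totMap_apply, totD_zero_succ, barD_compMultilinearMap (hρ 0)]
  · simp only [totMap_apply, totD_succ_zero, hor]
  · simp only [totMap_apply, totD_succ_succ, hor, barD_compMultilinearMap (hρ (r + 1)),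
      LinearMap.compMultilinearMap_add, LinearMap.compMultilinearMap_smul]

theorem totD_totD (hC : IsRightModuleComplex d ρ) (n : ℕ) (x : TotCochain k H C n) :
    totD d ρ (n + 1) (totD d ρ n x) = 0 := by
  have hor_hor (r s) (φ : MultilinearMap k (fun _ : Fin s => H) (C r)) :
      (d (r + 1)).compMultilinearMap ((d r).compMultilinearMap φ) = 0 := by
    ext
    simp [hC.d_comp_d]
  have ver_hor (r s) (φ : MultilinearMap k (fun _ : Fin s => H) (C r)) :
      barD (ρ (r + 1)) s ((d r).compMultilinearMap φ) = (d r).compMultilinearMap (barD (ρ r) s φ) :=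
    barD_compMultilinearMap (hC.d_act r) s φ
  have ver_ver (r s) (φ : MultilinearMap k (fun _ : Fin s => H) (C r)) :
      barD (ρ r) (s + 1) (barD (ρ r) s φ) = 0 :=
    barD_barD (hC.act_mul r) s φ
  have hor_neg (r s) (φ : MultilinearMap k (fun _ : Fin s => H) (C r)) :
      (d r).compMultilinearMap (-φ) = -(d r).compMultilinearMap φ :=
    map_neg ((d r).compMultilinearMapₗ k) φ
  funext ⟨⟨r, s⟩, h⟩
  rcases r with _ | _ | r <;> rcases s with _ | _ | s <;> try omega
  all_goals simp [totD_zero_succ, totD_succ_zero, totD_succ_succ, hor_hor, hor_neg, ver_hor,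
    ver_ver, LinearMap.compMultilinearMap_add, LinearMap.compMultilinearMap_smul, pow_succ]

theorem compMultilinearMap_eq_zero_of_totD_eq_zero {n : ℕ} {x : TotCochain k H C n}
    (hx : totD d ρ n x = 0) {r : ℕ} (hr : ∀ p, r < p.1.1 → x p = 0) {s : ℕ} (h : r + s = n) :
    (d r).compMultilinearMap (x ⟨(r, s), h⟩) = 0 := by
  rcases s with _ | s
  · exact (totD_succ_zero _ x).symm.trans (congrFun hx ⟨(r + 1, 0), by omega⟩)
  · have component := congrFun hx ⟨(r + 1, s + 1), by omega⟩
    rw [totD_succ_succ, hr ⟨(r + 1, s), _⟩ (Nat.lt_succ_self r)] at component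
    simpa using component

/-- The cochain of the total complex with components `φ` in `Hom_k(H^{⊗ n}, C⁰)` and zero in the
other columns. The equation for `s` avoids casts along `0 + n = n`. -/
def ofColumnZero {n : ℕ} (φ : ∀ s, 0 + s = n → MultilinearMap k (fun _ : Fin s => H) (C 0)) :
    TotCochain k H C n
  | ⟨(0, s), h⟩ => φ s h
  | ⟨(_ + 1, _), _⟩ => 0

theorem totD_ofColumnZero {n : ℕ}
    {φ : ∀ s, 0 + s = n → MultilinearMap k (fun _ : Fin s => H) (C 0)}
    (hφ : ∀ s h, (d 0).compMultilinearMap (φ s h) = 0) :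
    totD d ρ n (ofColumnZero φ) = ofColumnZero fun
      | 0, h => by omega
      | s + 1, h => barD (ρ 0) s (φ s (by omega)) := by
  funext ⟨⟨r, s⟩, h⟩
  rcases r with _ | _ | r <;> rcases s with _ | s
  · omega
  · exact totD_zero_succ h _
  · exact (totD_succ_zero h _).trans (hφ _ _)
  · rw [totD_succ_succ]
    simp [ofColumnZero, hφ]
  · rw [totD_succ_zero]
    simp [ofColumnZero]
  · rw [totD_succ_succ]
    simp [ofColumnZero]

theorem exists_totD_eq_of_column_zero {K : (H →ₗ[k] C 0) →ₗ[k] C 0} (hKd : ∀ ξ, d 0 (K ξ) = 0)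
    (hKρ : ∀ h ξ, K (homRight h ξ) = ρ 0 h (K ξ)) (hK : ∀ x, d 0 x = 0 → K ((ρ 0).flip x) = x)
    {n : ℕ} {x : TotCochain k H C (n + 1)} (hx : totD d ρ (n + 1) x = 0)
    (h0 : ∀ p, 0 < p.1.1 → x p = 0) : ∃ y, totD d ρ n y = x := by
  have hor {s} (h : 0 + s = n + 1) := compMultilinearMap_eq_zero_of_totD_eq_zero hx h0 h
  have ver {s} (h : 0 + (s + 1) = n + 1) : barD (ρ 0) (s + 1) (x ⟨(0, s + 1), h⟩) = 0 :=
    (totD_zero_succ _ x).symm.trans (congrFun hx ⟨(0, s + 2), by omega⟩)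
  have K_ρ {s} (h : 0 + s = n + 1) :
      (K ∘ₗ (ρ 0).flip).compMultilinearMap (x ⟨(0, s), h⟩) = x ⟨(0, s), h⟩ := by
    ext b
    exact hK _ (DFunLike.congr_fun (hor h) b)
  refine ⟨ofColumnZero fun s h => (-1 : k) ^ (s + 1) • contractLast K s (x ⟨(0, s + 1), by omega⟩),
    ?_⟩
  rw [totD_ofColumnZero fun s h => by ext b; simp [contractLast_apply, hKd]]
  funext ⟨⟨r, s⟩, h⟩
  rcases r with _ | r
  · rcases s with _ | s
    · omega
    · exact barD_contractLast hKρ (K_ρ h) (ver h)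
  · exact (h0 _ r.succ_pos).symm

theorem exists_sub_totD_eq_zero {t : ∀ r, C (r + 1) →ₗ[k] C r}
    (ht : ∀ r x, d (r + 1) x = 0 → d r (t r x) = x) {n j : ℕ} {x : TotCochain k H C (n + 1)}
    (hx : totD d ρ (n + 1) x = 0) (hj : ∀ p, j + 1 < p.1.1 → x p = 0) :
    ∃ y, ∀ p, j < p.1.1 → (x - totD d ρ n y) p = 0 := by
  let y : TotCochain k H C n := fun p =>
    (t p.1.1).compMultilinearMap (x ⟨(p.1.1 + 1, p.1.2), by have := p.2; omega⟩)
  have d_y {r s} (h : r + 1 + s = n + 1) (hr : j < r + 1) :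
      (d r).compMultilinearMap (y ⟨(r, s), by omega⟩) = x ⟨(r + 1, s), h⟩ := by
    have hor := compMultilinearMap_eq_zero_of_totD_eq_zero hx
      (fun p hp => hj p (Nat.lt_of_le_of_lt hr hp)) h
    ext b
    exact ht r _ (DFunLike.congr_fun hor b)
  refine ⟨y, fun ⟨⟨r, s⟩, h⟩ hr => ?_⟩
  rcases r with _ | r
  · exact absurd hr (Nat.not_lt_zero j)
  rcases s with _ | s
  · rw [Pi.sub_apply, totD_succ_zero, d_y h hr, sub_self]
  · have hy : y ⟨(r + 1, s), by omega⟩ = 0 := by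
      change (t (r + 1)).compMultilinearMap (x ⟨(r + 1 + 1, s), _⟩) = 0
      rw [hj ⟨(r + 1 + 1, s), _⟩ (Nat.succ_lt_succ hr), LinearMap.compMultilinearMap_zero]
    rw [Pi.sub_apply, totD_succ_succ, d_y h hr, hy, map_zero, smul_zero, add_zero, sub_self]

theorem totD_exact (hC : IsRightModuleComplex d ρ) {t : ∀ r, C (r + 1) →ₗ[k] C r}
    (ht : ∀ r x, d (r + 1) x = 0 → d r (t r x) = x) {K : (H →ₗ[k] C 0) →ₗ[k] C 0}
    (hKd : ∀ ξ, d 0 (K ξ) = 0) (hKρ : ∀ h ξ, K (homRight h ξ) = ρ 0 h (K ξ))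
    (hK : ∀ x, d 0 x = 0 → K ((ρ 0).flip x) = x) (n : ℕ) :
    Function.Exact (totD d ρ n) (totD d ρ (n + 1)) := by
  have exists_of_support (j : ℕ) : ∀ x : TotCochain k H C (n + 1), totD d ρ (n + 1) x = 0 →
      (∀ p, j < p.1.1 → x p = 0) → ∃ y, totD d ρ n y = x := by
    induction j with
    | zero => exact fun x => exists_totD_eq_of_column_zero hKd hKρ hK
    | succ j ih =>
      intro x hx hj
      obtain ⟨y, hy⟩ := exists_sub_totD_eq_zero ht hx hj
      obtain ⟨z, hz⟩ := ih (x - totD d ρ n y) (by rw [map_sub, hx, totD_totD hC, sub_zero]) hy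
      exact ⟨z + y, by rw [map_add, hz, sub_add_cancel]⟩
  refine fun x => ⟨fun hx => ?_, ?_⟩
  · exact exists_of_support (n + 1) x hx fun p hp => by have := p.2; omega
  · rintro ⟨y, rfl⟩
    exact totD_totD hC n y

theorem totD_zero_eq_zero_iff {x : TotCochain k H C 0} :
    totD d ρ 0 x = 0 ↔ d 0 (x ⟨(0, 0), rfl⟩ 0) = 0 ∧
      ∀ h, ρ 0 h (x ⟨(0, 0), rfl⟩ 0) = Coalgebra.counit (R := k) h • x ⟨(0, 0), rfl⟩ 0 := by
  have apply_eq (b : Fin 0 → H) : x ⟨(0, 0), rfl⟩ b = x ⟨(0, 0), rfl⟩ 0 :=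
    congrArg _ (Subsingleton.elim b 0)
  have ver (b : Fin 1 → H) : barD (ρ 0) 0 (x ⟨(0, 0), rfl⟩) b =
      Coalgebra.counit (R := k) (b 0) • x ⟨(0, 0), rfl⟩ 0 - ρ 0 (b 0) (x ⟨(0, 0), rfl⟩ 0) := by
    simp [barD, hochschildD_apply, apply_eq, sub_eq_add_neg]
  constructor
  · intro hx
    constructor
    · have hor := congrFun hx ⟨(1, 0), rfl⟩
      rw [totD_succ_zero] at hor
      exact DFunLike.congr_fun hor 0
    · intro h
      have ver_zero := congrFun hx ⟨(0, 1), rfl⟩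
      rw [totD_zero_succ] at ver_zero
      exact (sub_eq_zero.mp ((ver fun _ => h).symm.trans (DFunLike.congr_fun ver_zero _))).symm
  · rintro ⟨hor, hρ⟩
    funext ⟨⟨r, s⟩, h⟩
    rcases r with _ | r <;> rcases s with _ | s
    · omega
    · obtain rfl : s = 0 := by omega
      rw [totD_zero_succ]
      ext b
      rw [ver, hρ, sub_self]
      rfl
    · obtain rfl : r = 0 := by omega
      rw [totD_succ_zero]
      ext b
      rw [LinearMap.compMultilinearMap_apply, apply_eq, hor]
      rfl
    · omega

end TotalComplex

section Bimodules

variable {k B N : Type*} [CommRing k] [Ring B] [Algebra k B] [AddCommGroup N] [Module k N]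
  {L R : B →ₗ[k] Module.End k N}

/-- `L` and `R` are the left and right actions of a `B`-bimodule structure on `N` with `k` acting
in the same way on both sides. -/
structure IsBimodule (L R : B →ₗ[k] Module.End k N) : Prop extends IsActionPair L R where
  left_one : ∀ n, L 1 n = n
  right_one : ∀ n, R 1 n = n

theorem isBimodule_leftMul_rightMul [Module B N] [Module Bᵐᵒᵖ N] [IsScalarTower k B N]
    [IsScalarTower k Bᵐᵒᵖ N] [SMulCommClass B Bᵐᵒᵖ N] :
    IsBimodule (leftMul k B N) (rightMul k B N) where
  left_mul a b n := mul_smul a b n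
  right_mul a b n := mul_smul (MulOpposite.op b) (MulOpposite.op a) n
  comm a b n := smul_comm a (MulOpposite.op b) n
  left_one n := one_smul B n
  right_one n := one_smul Bᵐᵒᵖ n

theorem IsBimodule.hom (h : IsBimodule L R) :
    IsBimodule (homLeft (C := B) L) (homRight (k := k) (B := B) (N := N)) where
  left_mul a b n := by ext; simp [h.left_mul]
  right_mul a b n := by ext; simp [mul_assoc]
  comm a b n := by ext; simp
  left_one n := by ext; simp [h.left_one]
  right_one n := by ext; simp

/-- The action induced on the quotient by a stable submodule. -/
def quotAct (W : Submodule k N) (L : B →ₗ[k] Module.End k N) (hW : ∀ b, W ≤ W.comap (L b)) :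
    B →ₗ[k] Module.End k (N ⧸ W) where
  toFun b := W.mapQ W (L b) (hW b)
  map_add' a b := by ext; simp
  map_smul' c b := by ext; simp

theorem quotAct_mkQ (W : Submodule k N) (L : B →ₗ[k] Module.End k N)
    (hW : ∀ b, W ≤ W.comap (L b)) (b : B) (n : N) :
    quotAct W L hW b (W.mkQ n) = W.mkQ (L b n) := rfl

theorem IsBimodule.quot (h : IsBimodule L R) (W : Submodule k N)
    (hL : ∀ b, W ≤ W.comap (L b)) (hR : ∀ b, W ≤ W.comap (R b)) :
    IsBimodule (quotAct W L hL) (quotAct W R hR) where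
  left_mul a b := W.mkQ_surjective.forall.mpr fun n => by simp only [quotAct_mkQ, h.left_mul]
  right_mul a b := W.mkQ_surjective.forall.mpr fun n => by simp only [quotAct_mkQ, h.right_mul]
  comm a b := W.mkQ_surjective.forall.mpr fun n => by simp only [quotAct_mkQ, h.comm]
  left_one := W.mkQ_surjective.forall.mpr fun n => by simp only [quotAct_mkQ, h.left_one]
  right_one := W.mkQ_surjective.forall.mpr fun n => by simp only [quotAct_mkQ, h.right_one]

/-- The center `{m | b m = m b for all b}` of a bimodule. -/
def center (L R : B →ₗ[k] Module.End k N) : Submodule k N where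
  carrier := {m | ∀ b, L b m = R b m}
  add_mem' {m n} hm hn b := by rw [map_add, map_add, hm, hn]
  zero_mem' b := by rw [map_zero, map_zero]
  smul_mem' c m hm b := by rw [map_smul, map_smul, hm]

theorem evalAt_zero_injective :
    Function.Injective (evalAt (k := k) (M := N) (0 : Fin 0 → B)) := by
  intro φ ψ h
  ext c
  rw [Subsingleton.elim c 0]
  exact h

theorem hochschildD_zero_eq_zero_iff {φ : MultilinearMap k (fun _ : Fin 0 => B) N} :
    hochschildD L R 0 φ = 0 ↔ φ 0 ∈ center L R := by
  have apply_eq (c : Fin 0 → B) : φ c = φ 0 := congrArg φ (Subsingleton.elim c 0)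
  have d_apply (b : Fin 1 → B) : hochschildD L R 0 φ b = L (b 0) (φ 0) - R (b 0) (φ 0) := by
    simp [hochschildD_apply, apply_eq, sub_eq_add_neg]
  constructor
  · intro hφ b
    have := DFunLike.congr_fun hφ fun _ => b
    rwa [d_apply, zero_apply, sub_eq_zero] at this
  · intro hφ
    ext b
    rw [d_apply, hφ, sub_self, zero_apply]

theorem map_ker_hochschildD_zero (L R : B →ₗ[k] Module.End k N) :
    (LinearMap.ker (hochschildD L R 0)).map (evalAt (0 : Fin 0 → B)) = center L R := by
  ext m
  constructor
  · rintro ⟨φ, hφ, rfl⟩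
    exact hochschildD_zero_eq_zero_iff.mp hφ
  · exact fun hm => ⟨MultilinearMap.constOfIsEmpty k _ m, hochschildD_zero_eq_zero_iff.mpr hm, rfl⟩

/-- The map `ξ ↦ (x ↦ ξ(x)(1))`, which gives the contracting homotopy of the Hochschild complex of
a coinduced bimodule. -/
def evalOne : (B →ₗ[k] (B →ₗ[k] N)) →ₗ[k] (B →ₗ[k] N) where
  toFun ξ := ξ.flip 1
  map_add' _ _ := rfl
  map_smul' _ _ := rfl

theorem evalOne_flip_homRight (ξ : B →ₗ[k] N) : evalOne ((homRight (k := k)).flip ξ) = ξ := by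
  ext x
  exact congrArg ξ (mul_one x)

theorem IsBimodule.hochschildD_hom_exact (h : IsBimodule L R) (n : ℕ) :
    Function.Exact (hochschildD (homLeft (C := B) L) homRight n)
      (hochschildD (homLeft L) homRight (n + 1)) := by
  intro φ
  constructor
  · intro hφ
    refine ⟨_, hochschildD_contractLast (K := evalOne) (fun _ _ => rfl) (fun _ _ => rfl) ?_ hφ⟩
    ext b : 1
    exact evalOne_flip_homRight (φ b)
  · rintro ⟨ψ, rfl⟩
    exact hochschildD_hochschildD h.hom.toIsActionPair n ψ

end Bimodules

section Coinduction

variable {k B N : Type*} [CommRing k] [Ring B] [Algebra k B] [AddCommGroup N] [Module k N]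
  {L R : B →ₗ[k] Module.End k N}

theorem homLeft_flip (h : IsBimodule L R) (b : B) (m : N) :
    homLeft L b (R.flip m) = R.flip (L b m) := by
  ext x
  exact h.comm b x m

theorem homRight_flip (h : IsBimodule L R) (b : B) (m : N) :
    homRight (k := k) b (R.flip m) = R.flip (R b m) := by
  ext x
  exact h.right_mul b x m

/-- The cokernel of the embedding `R.flip : m ↦ (x ↦ m x)` of `N` into the coinduced bimodule
`Hom(B, N)`. -/
abbrev Coker (R : B →ₗ[k] Module.End k N) := (B →ₗ[k] N) ⧸ LinearMap.range R.flip

/-- The left action of `B` on the cokernel of `N → Hom(B, N)`. -/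
def cokerLeft (h : IsBimodule L R) : B →ₗ[k] Module.End k (Coker R) :=
  quotAct (LinearMap.range R.flip) (homLeft L) fun b => by
    rintro _ ⟨m, rfl⟩
    exact ⟨L b m, (homLeft_flip h b m).symm⟩

/-- The right action of `B` on the cokernel of `N → Hom(B, N)`. -/
def cokerRight (h : IsBimodule L R) : B →ₗ[k] Module.End k (Coker R) :=
  quotAct (LinearMap.range R.flip) homRight fun b => by
    rintro _ ⟨m, rfl⟩
    exact ⟨R b m, (homRight_flip h b m).symm⟩

theorem IsBimodule.coker (h : IsBimodule L R) : IsBimodule (cokerLeft h) (cokerRight h) :=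
  h.hom.quot _ _ _

theorem mkQ_flip (m : N) : (LinearMap.range R.flip).mkQ (R.flip m) = 0 :=
  (Submodule.Quotient.mk_eq_zero _).mpr ⟨m, rfl⟩

/-- The section `n ↦ n - R.flip (ρ n)` of `Hom(B, N) → Coker R` given by a retraction `ρ` of
`R.flip`. -/
def cokerSection (ρ : (B →ₗ[k] N) →ₗ[k] N) (hρ : ∀ m, ρ (R.flip m) = m) :
    Coker R →ₗ[k] (B →ₗ[k] N) :=
  (LinearMap.range R.flip).liftQ (.id - R.flip ∘ₗ ρ) (by
    rintro _ ⟨m, rfl⟩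
    simp [hρ])

section Section

variable {ρ : (B →ₗ[k] N) →ₗ[k] N} (hρ : ∀ m, ρ (R.flip m) = m)

theorem flip_add_cokerSection_mkQ (n : B →ₗ[k] N) :
    R.flip (ρ n) + cokerSection ρ hρ ((LinearMap.range R.flip).mkQ n) = n :=
  add_sub_cancel (R.flip (ρ n)) n

theorem mkQ_cokerSection (x : Coker R) :
    (LinearMap.range R.flip).mkQ (cokerSection ρ hρ x) = x := by
  obtain ⟨n, rfl⟩ := Submodule.mkQ_surjective _ x
  nth_rewrite 2 [← flip_add_cokerSection_mkQ hρ n]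
  rw [map_add, mkQ_flip, zero_add]

theorem cokerSection_comm {f : Module.End k (B →ₗ[k] N)} {g : Module.End k N}
    {f' : Module.End k (Coker R)}
    (hf : ∀ n, f' ((LinearMap.range R.flip).mkQ n) = (LinearMap.range R.flip).mkQ (f n))
    (hg : ∀ m, f (R.flip m) = R.flip (g m)) (hρg : ∀ n, ρ (f n) = g (ρ n)) (x : Coker R) :
    cokerSection ρ hρ (f' x) = f (cokerSection ρ hρ x) := by
  obtain ⟨n, rfl⟩ := Submodule.mkQ_surjective _ x
  change cokerSection ρ hρ (f' ((LinearMap.range R.flip).mkQ n)) = f (n - R.flip (ρ n))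
  rw [hf, map_sub, hg, ← hρg]
  rfl

end Section

theorem hochschild_splitExact (h : IsBimodule L R) {ρ : (B →ₗ[k] N) →ₗ[k] N}
    (hρ : ∀ m, ρ (R.flip m) = m) :
    SplitExact (hochschildD L R) (hochschildD (homLeft L) homRight)
      (hochschildD (cokerLeft h) (cokerRight h))
      (fun _ => R.flip.compMultilinearMapₗ k)
      (fun _ => (LinearMap.range R.flip).mkQ.compMultilinearMapₗ k)
      (fun _ => ρ.compMultilinearMapₗ k)
      (fun _ => (cokerSection ρ hρ).compMultilinearMapₗ k) where
  i_d n x := hochschildD_compMultilinearMap _ (fun b m => (homLeft_flip h b m).symm)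
    (fun b m => (homRight_flip h b m).symm) n x
  p_d n x := hochschildD_compMultilinearMap _ (fun _ _ => rfl) (fun _ _ => rfl) n x
  p_i n x := by ext c : 1; exact mkQ_flip (x c)
  r_i n x := by ext c : 1; exact hρ (x c)
  p_t n x := by ext c : 1; exact mkQ_cokerSection hρ (x c)
  split n x := by ext c : 1; exact flip_add_cokerSection_mkQ hρ (x c)

end Coinduction

section Separable

variable {k S B N : Type*} [CommRing k] [Ring S] [Algebra k S] [Ring B] [Algebra k B]
  [AddCommGroup N] [Module k N] {L R : B →ₗ[k] Module.End k N} {j : S →ₐ[k] B}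

/-- The map `n ↦ ∑ n(eᵢ) fᵢ`, where `e = ∑ eᵢ ⊗ fᵢ`. For a separability idempotent `e` of `S` it
is an `S`-bilinear retraction of `R.flip : N → Hom(B, N)`. -/
def sepRetract (j : S →ₐ[k] B) (R : B →ₗ[k] Module.End k N) (e : S ⊗[k] S) :
    (B →ₗ[k] N) →ₗ[k] N where
  toFun n := TensorProduct.lift ((R.flip ∘ₗ n ∘ₗ j.toLinearMap).compl₂ j.toLinearMap) e
  map_add' n m := by
    rw [← LinearMap.add_apply]
    congr 1
    ext
    simp
  map_smul' c n := by
    rw [RingHom.id_apply, ← LinearMap.smul_apply]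
    congr 1
    ext
    simp

@[simp] theorem sepRetract_zero (n : B →ₗ[k] N) : sepRetract j R 0 n = 0 :=
  map_zero (TensorProduct.lift ((R.flip ∘ₗ n ∘ₗ j.toLinearMap).compl₂ j.toLinearMap))

@[simp] theorem sepRetract_add (e e' : S ⊗[k] S) (n : B →ₗ[k] N) :
    sepRetract j R (e + e') n = sepRetract j R e n + sepRetract j R e' n :=
  map_add (TensorProduct.lift ((R.flip ∘ₗ n ∘ₗ j.toLinearMap).compl₂ j.toLinearMap)) e e'

@[simp] theorem sepRetract_tmul (s t : S) (n : B →ₗ[k] N) :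
    sepRetract j R (s ⊗ₜ t) n = R (j t) (n (j s)) := rfl

theorem sepRetract_flip (h : IsBimodule L R) (e : S ⊗[k] S) (m : N) :
    sepRetract j R e (R.flip m) = R (j (LinearMap.mul' k S e)) m := by
  induction e with
  | zero => simp
  | add e e' he he' => simp [he, he']
  | tmul s t => simp [h.right_mul]

theorem sepRetract_homLeft (h : IsBimodule L R) (e : S ⊗[k] S) (b : B) (n : B →ₗ[k] N) :
    sepRetract j R e (homLeft L b n) = L b (sepRetract j R e n) := by
  induction e with
  | zero => simp
  | add e e' he he' => simp [he, he']
  | tmul s t => simp [h.comm]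

theorem sepRetract_homRight (e : S ⊗[k] S) (s : S) (n : B →ₗ[k] N) :
    sepRetract j R e (homRight (j s) n) = sepRetract j R ((s ⊗ₜ 1) * e) n := by
  induction e with
  | zero => simp
  | add e e' he he' => simp [he, he', mul_add]
  | tmul t u => simp

theorem right_sepRetract (h : IsBimodule L R) (e : S ⊗[k] S) (s : S) (n : B →ₗ[k] N) :
    R (j s) (sepRetract j R e n) = sepRetract j R (e * (1 ⊗ₜ s)) n := by
  induction e with
  | zero => simp
  | add e e' he he' => simp [he, he', add_mul]
  | tmul t u => simp [h.right_mul]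

theorem exists_retraction_of_isSeparableAlgebra (h : IsBimodule L R)
    (hsep : IsSeparableAlgebra k S) (j : S →ₐ[k] B) :
    ∃ ρ : (B →ₗ[k] N) →ₗ[k] N, (∀ m, ρ (R.flip m) = m) ∧
      (∀ b n, ρ (homLeft L b n) = L b (ρ n)) ∧
      ∀ s n, ρ (homRight (j s) n) = R (j s) (ρ n) := by
  obtain ⟨e, mul_e, e_comm⟩ := hsep
  refine ⟨sepRetract j R e, fun m => ?_, sepRetract_homLeft h e, fun s n => ?_⟩
  · rw [sepRetract_flip h, mul_e, map_one, h.right_one]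
  · rw [sepRetract_homRight, e_comm, right_sepRetract h]

end Separable

section RelCochains

variable {k A N N' : Type*} [CommRing k] [Ring A] [Algebra k A] [AddCommGroup N] [Module k N]
  [AddCommGroup N'] [Module k N'] {S : Subalgebra k A} {L R : A →ₗ[k] Module.End k N}
  {L' R' : A →ₗ[k] Module.End k N'}

theorem IsRelCochain.compMultilinearMap (g : N →ₗ[k] N')
    (hL : ∀ s ∈ S, ∀ n, g (L s n) = L' s (g n)) (hR : ∀ s ∈ S, ∀ n, g (R s n) = R' s (g n)) {r : ℕ}
    {φ : MultilinearMap k (fun _ : Fin r => A) N} (h : IsRelCochain S L R φ) :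
    IsRelCochain S L' R' (g.compMultilinearMap φ) where
  map_left i hi s hs a := by
    simp only [LinearMap.compMultilinearMap_apply, h.map_left i hi s hs, hL s hs]
  map_right i hi s hs a := by
    simp only [LinearMap.compMultilinearMap_apply, h.map_right i hi s hs, hR s hs]
  balanced i j hij s hs a := by
    simp only [LinearMap.compMultilinearMap_apply, h.balanced i j hij s hs]
  normalized i a ha := by
    simp only [LinearMap.compMultilinearMap_apply, h.normalized i a ha, map_zero]
  central hr s hs a := by
    simp only [LinearMap.compMultilinearMap_apply, ← hL s hs, h.central hr s hs, hR s hs]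

theorem IsRelCochain.contractLast {K : (A →ₗ[k] N) →ₗ[k] N'}
    (hL : ∀ s ∈ S, ∀ ξ, K (homLeft L s ξ) = L' s (K ξ))
    (hR : ∀ s ∈ S, ∀ ξ, K (homRight s ξ) = R' s (K ξ)) {r : ℕ}
    {φ : MultilinearMap k (fun _ : Fin (r + 1) => A) N} (h : IsRelCochain S L R φ) :
    IsRelCochain S L' R' (contractLast K r φ) where
  map_left i hi s hs a := by
    rw [contractLast_apply, contractLast_apply, ← hL s hs]
    congr 1
    ext x
    have map_mul_left := h.map_left i.castSucc hi s hs (Fin.snoc a x)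
    simp only [Fin.snoc_castSucc, ← Fin.snoc_update] at map_mul_left
    exact map_mul_left
  map_right i hi s hs a := by
    rw [contractLast_apply, contractLast_apply, ← hR s hs]
    congr 1
    ext x
    have balanced := h.balanced i.castSucc (Fin.last r) hi.symm s hs (Fin.snoc a x)
    simp only [Fin.snoc_castSucc, ← Fin.snoc_update, Fin.snoc_last,
      Fin.update_snoc_last] at balanced
    exact balanced
  balanced i j hij s hs a := by
    rw [contractLast_apply, contractLast_apply]
    congr 1
    ext x
    have balanced := h.balanced i.castSucc j.castSucc hij s hs (Fin.snoc a x)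
    simp only [Fin.snoc_castSucc, ← Fin.snoc_update] at balanced
    exact balanced
  normalized i a ha := by
    have curry_eq_zero : φ.curryRight a = 0 :=
      LinearMap.ext fun x => h.normalized i.castSucc _ (by simpa using ha)
    rw [contractLast_apply, curry_eq_zero, map_zero]
  central hr s hs a := by
    subst hr
    rw [contractLast_apply, ← hL s hs, ← hR s hs]
    congr 1
    ext x
    have map_mul_left := h.map_left 0 rfl s hs (Fin.snoc a x)
    have update_eq (y : A) : Function.update (Fin.snoc a x : Fin 1 → A) 0 y =
      (Fin.snoc a y : Fin 1 → A) := Fin.update_snoc_last (n := 0) _ _ _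
    rw [update_eq] at map_mul_left
    exact map_mul_left.symm

variable (S L R) in
/-- The module `Hom_{S^e}(Ã^r, N)` of normalized `S`-relative cochains, for an arbitrary pair of
actions `L`, `R` of `A` on `N`. -/
def relCochains (r : ℕ) : Submodule k (MultilinearMap k (fun _ : Fin r => A) N) where
  carrier := {φ | IsRelCochain S L R φ}
  add_mem' {φ ψ} hφ hψ :=
    ⟨fun i hi s hs a => by simp [hφ.map_left i hi s hs a, hψ.map_left i hi s hs a],
      fun i hi s hs a => by simp [hφ.map_right i hi s hs a, hψ.map_right i hi s hs a],
      fun i j hij s hs a => by simp [hφ.balanced i j hij s hs a, hψ.balanced i j hij s hs a],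
      fun i a ha => by simp [hφ.normalized i a ha, hψ.normalized i a ha],
      fun h s hs a => by simp [hφ.central h s hs a, hψ.central h s hs a]⟩
  zero_mem' := ⟨by simp, by simp, by simp, by simp, by simp⟩
  smul_mem' c φ hφ :=
    ⟨fun i hi s hs a => by simp [hφ.map_left i hi s hs a],
      fun i hi s hs a => by simp [hφ.map_right i hi s hs a],
      fun i j hij s hs a => by simp [hφ.balanced i j hij s hs a],
      fun i a ha => by simp [hφ.normalized i a ha],
      fun h s hs a => by simp [hφ.central h s hs a]⟩

end RelCochains

namespace CrossedProduct

variable {k A H : Type*} [CommRing k] [Ring A] [Algebra k A] [Ring H] [HopfAlgebra k H]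
  (X : CrossedProduct k A H) {N N' : Type*} [AddCommGroup N] [Module k N] [AddCommGroup N']
  [Module k N'] (S : Subalgebra k A)

section Complex

variable (L R : X.E →ₗ[k] Module.End k N)

/-- The module `Hom_{S^e}(Ã^r, N)` for an `E`-bimodule `N` with actions `L` and `R`. This is
`X.RelCochain` with the actions as variables, so that it applies to coinduced bimodules and their
quotients without putting instances on these. -/
abbrev RelCochains (r : ℕ) : Type _ := relCochains S (L ∘ₗ X.inclA) (R ∘ₗ X.inclA) r

variable {L R}

theorem isActionPair_inclA (h : IsBimodule L R) :
    IsActionPair (L ∘ₗ X.inclA) (R ∘ₗ X.inclA) where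
  left_mul a b n := by simp [inclA_mul, h.left_mul]
  right_mul a b n := by simp [inclA_mul, h.right_mul]
  comm a b n := by simp [h.comm]

/-- The coboundary `b` of the complex `Hom_{S^e}(Ã^*, N)`. -/
def relCoboundary (h : IsBimodule L R) (r : ℕ) :
    X.RelCochains S L R r →ₗ[k] X.RelCochains S L R (r + 1) :=
  (hochschildD (L ∘ₗ X.inclA) (R ∘ₗ X.inclA) r).restrict fun _ hφ =>
    IsRelCochain.hochschildD (X.isActionPair_inclA h).left_mul (X.isActionPair_inclA h).right_mul
      (X.isActionPair_inclA h).comm hφ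

theorem sweedler_gammaInv_act (h : IsBimodule L R) (s : A) :
    sweedler ((LinearMap.mul k (Module.End k N)).compl₁₂ (L ∘ₗ X.gammaInv)
      ((L ∘ₗ X.inclA) ∘ₗ X.act.flip s)) =
      LinearMap.mulLeft k ((L ∘ₗ X.inclA) s) ∘ₗ (L ∘ₗ X.gammaInv) := by
  ext c m
  have in_E := congrArg (fun g => L (g c) m) (X.sweedler_gammaInv s)
  simpa [sweedler_repr _ (Coalgebra.Repr.arbitrary k c), h.left_mul] using in_E

theorem sweedler_act_gamma (h : IsBimodule L R) (s : A) :
    sweedler ((LinearMap.mul k (Module.End k N)).flip.compl₁₂ ((R ∘ₗ X.inclA) ∘ₗ X.act.flip s)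
      (R ∘ₗ X.gamma)) = LinearMap.mulLeft k ((R ∘ₗ X.inclA) s) ∘ₗ (R ∘ₗ X.gamma) := by
  ext c m
  have in_E := congrArg (fun x => R x m) (X.gamma_mul_inclA c s)
  simpa [sweedler_repr _ (Coalgebra.Repr.arbitrary k c), h.right_mul] using in_E.symm

theorem pairingRev_gamma (h : IsBimodule L R) :
    pairingRev (R ∘ₗ X.gamma) =
      sweedler ((LinearMap.mul k (Module.End k N)).flip.compl₁₂ ((R ∘ₗ X.inclA) ∘ₗ X.f)
        ((R ∘ₗ X.gamma) ∘ₗ LinearMap.mul' k H)) := by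
  have pairing_eq : pairingRev (R ∘ₗ X.gamma) = R ∘ₗ X.gammaGamma.ofConv :=
    TensorProduct.ext' fun x y => LinearMap.ext fun m => (h.right_mul _ _ m).symm
  rw [pairing_eq, gammaGamma_eq, ofConv_mul, comp_sweedler]
  congr 1
  exact LinearMap.ext fun c => LinearMap.ext fun c' => LinearMap.ext fun m =>
    h.right_mul (X.cocycleE.ofConv c) (X.gammaMul.ofConv c') m

theorem sweedler_pairingRev_gammaInv (h : IsBimodule L R) (hu : IsUnit (toConv X.gamma)) :
    sweedler ((LinearMap.mul k (Module.End k N)).compl₁₂ (pairingRev (L ∘ₗ X.gammaInv))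
      ((L ∘ₗ X.inclA) ∘ₗ X.f)) = (L ∘ₗ X.gammaInv) ∘ₗ LinearMap.mul' k H := by
  have in_E := congrArg (fun u => L ∘ₗ u.ofConv) (X.gammaInvGammaInv_mul_cocycleE hu)
  simp only [ofConv_mul, comp_sweedler] at in_E
  refine Eq.trans (congrArg sweedler ?_) in_E
  refine TensorProduct.ext' fun x y => LinearMap.ext fun c => LinearMap.ext fun m => ?_
  change L _ (L _ (L _ m)) = L (X.gammaInv y * X.gammaInv x * _) m
  rw [h.left_mul, h.left_mul]
  rfl

variable {S}

/-- The right action of `H` on `Hom_{S^e}(Ã^r, N)`,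
`(φ · h)(a₁, …, aᵣ) = γ⁻¹(h⁽¹⁾) φ(a₁^{h⁽²⁾}, …, aᵣ^{h⁽ʳ⁺¹⁾}) γ(h⁽ʳ⁺²⁾)`. -/
def relAction (h : IsBimodule L R) (hS : ∀ h, ∀ s ∈ S, X.act h s ∈ S) (r : ℕ) :
    H →ₗ[k] Module.End k (X.RelCochains S L R r) where
  toFun x := (diagonalAct X.act (L ∘ₗ X.gammaInv) (R ∘ₗ X.gamma) r x).restrict fun _ hφ =>
    IsRelCochain.diagonalAct X.act_mul hS (fun s _ => X.sweedler_gammaInv_act h s)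
      (fun s _ => X.sweedler_act_gamma h s) (fun _ _ _ => (h.comm _ _ _).symm)
      (fun _ _ _ => h.comm _ _ _) hφ x
  map_add' _ _ := by ext; simp; rfl
  map_smul' _ _ := by ext; simp; rfl

theorem f_mem (hf : ∀ h l : H, X.f (h ⊗ₜ l) ∈ S) (c : H ⊗[k] H) : X.f c ∈ S := by
  induction c with
  | zero => rw [map_zero]; exact S.zero_mem
  | add c c' hc hc' => rw [map_add]; exact S.add_mem hc hc'
  | tmul x y => exact hf x y

theorem relComplex_isRightModuleComplex (h : IsBimodule L R)
    (hS : ∀ h, ∀ s ∈ S, X.act h s ∈ S) (hu : IsUnit (toConv X.gamma))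
    (hf : ∀ h l : H, X.f (h ⊗ₜ l) ∈ S) :
    IsRightModuleComplex (X.relCoboundary S h) (X.relAction h hS) where
  d_comp_d r φ := Subtype.ext (hochschildD_hochschildD (X.isActionPair_inclA h) r φ.1)
  act_one r φ := Subtype.ext <| diagonalAct_one X.one_act
    (fun m => by rw [LinearMap.comp_apply, gamma_one, h.right_one])
    (fun m => by rw [LinearMap.comp_apply, X.gammaInv_one hu, h.left_one]) φ.1
  act_mul r x y φ := Subtype.ext <| diagonalAct_mul (T := (S : Set A)) (X.f_mem hf)
    (X.act_act_mul_cocycle hu) (X.pairingRev_gamma h) (X.sweedler_pairingRev_gammaInv h hu)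
    (fun _ _ _ => (h.comm _ _ _).symm) (fun _ _ _ => (h.comm _ _ _).symm) φ.1 φ.2.isBalanced
    (fun _ hs => φ.2.insertLeft_eq hs) x y
  d_act r x φ := Subtype.ext (diagonalAct_hochschildD X.act_mul (X.sweedler_gammaInv_act h)
    (X.sweedler_act_gamma h) (fun _ _ _ => (h.comm _ _ _).symm) (fun _ _ _ => h.comm _ _ _) φ.1
    x).symm

end Complex

section Functoriality

variable {S} {L R : X.E →ₗ[k] Module.End k N} {L' R' : X.E →ₗ[k] Module.End k N'}

/-- The map of relative cochains induced by an `S`-bimodule map of the coefficients. -/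
def relMap (g : N →ₗ[k] N') (hL : ∀ s ∈ S, ∀ n, g (L (X.inclA s) n) = L' (X.inclA s) (g n))
    (hR : ∀ s ∈ S, ∀ n, g (R (X.inclA s) n) = R' (X.inclA s) (g n)) (r : ℕ) :
    X.RelCochains S L R r →ₗ[k] X.RelCochains S L' R' r :=
  (g.compMultilinearMapₗ k).restrict fun _ hφ => IsRelCochain.compMultilinearMap g hL hR hφ

theorem relMap_relCoboundary (h : IsBimodule L R) (h' : IsBimodule L' R') (g : N →ₗ[k] N')
    (hL : ∀ b n, g (L b n) = L' b (g n)) (hR : ∀ b n, g (R b n) = R' b (g n)) (r : ℕ)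
    (φ : X.RelCochains S L R r) :
    X.relMap g (fun _ _ => hL _) (fun _ _ => hR _) (r + 1) (X.relCoboundary S h r φ) =
      X.relCoboundary S h' r (X.relMap g (fun _ _ => hL _) (fun _ _ => hR _) r φ) :=
  Subtype.ext (hochschildD_compMultilinearMap (L := L ∘ₗ X.inclA) (R := R ∘ₗ X.inclA)
    (L' := L' ∘ₗ X.inclA) (R' := R' ∘ₗ X.inclA) g (fun _ => hL _) (fun _ => hR _) r φ.1).symm

theorem relMap_relAction (h : IsBimodule L R) (h' : IsBimodule L' R')
    (hS : ∀ h, ∀ s ∈ S, X.act h s ∈ S) (g : N →ₗ[k] N')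
    (hL : ∀ b n, g (L b n) = L' b (g n)) (hR : ∀ b n, g (R b n) = R' b (g n)) (r : ℕ) (y : H)
    (φ : X.RelCochains S L R r) :
    X.relMap g (fun _ _ => hL _) (fun _ _ => hR _) r (X.relAction h hS r y φ) =
      X.relAction h' hS r y (X.relMap g (fun _ _ => hL _) (fun _ _ => hR _) r φ) :=
  Subtype.ext (diagonalAct_compMultilinearMap (P := L ∘ₗ X.gammaInv) (G := R ∘ₗ X.gamma)
    (P' := L' ∘ₗ X.gammaInv) (G' := R' ∘ₗ X.gamma) g (fun _ => hL _) (fun _ => hR _) φ.1 y).symm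

end Functoriality

end CrossedProduct

section DegreeZero

namespace CrossedProduct

variable {k A H : Type*} [CommRing k] [Ring A] [Algebra k A] [Ring H] [HopfAlgebra k H]
  (X : CrossedProduct k A H) {N : Type*} [AddCommGroup N] [Module k N] {S : Subalgebra k A}
  {L R : X.E →ₗ[k] Module.End k N}

theorem mem_center_iff (h : IsBimodule L R) (m : N) : m ∈ center L R ↔
    m ∈ center (L ∘ₗ X.inclA) (R ∘ₗ X.inclA) ∧ L.flip m ∘ₗ X.gamma = R.flip m ∘ₗ X.gamma := by
  refine ⟨fun hm => ⟨fun a => hm _, LinearMap.ext fun y => hm _⟩, fun ⟨commA, comm_gamma⟩ b => ?_⟩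
  suffices L.flip m = R.flip m from LinearMap.congr_fun this b
  refine TensorProduct.ext' (M := A) (N := H) fun a y => ?_
  rw [← X.inclA_mul_gamma]
  change L _ m = R _ m
  rw [h.left_mul, h.right_mul]
  exact (congrArg _ (LinearMap.congr_fun comm_gamma y)).trans <|
    (h.comm _ _ m).trans (congrArg _ (commA a))

theorem convAct_gammaInv_eq_iff (h : IsBimodule L R) (hu : IsUnit (toConv X.gamma)) (m : N) :
    convAct L (toConv X.gammaInv) (R.flip m ∘ₗ X.gamma) =
        (Coalgebra.counit (R := k) (A := H)).smulRight m ↔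
      L.flip m ∘ₗ X.gamma = R.flip m ∘ₗ X.gamma := by
  have gamma_act : convAct L (toConv X.gamma) ((Coalgebra.counit (R := k)).smulRight m) =
      L.flip m ∘ₗ X.gamma := convAct_counit_smulRight _ m
  constructor
  · intro invariant
    rw [← gamma_act, ← invariant, ← convAct_mul h.left_mul, X.mul_gammaInv hu,
      convAct_one h.left_one]
  · intro comm_gamma
    rw [← comm_gamma, ← gamma_act, ← convAct_mul h.left_mul, X.gammaInv_mul hu,
      convAct_one h.left_one]

theorem relAction_zero_apply (h : IsBimodule L R) (hS : ∀ h, ∀ s ∈ S, X.act h s ∈ S)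
    (φ : X.RelCochains S L R 0) (y : H) (a : Fin 0 → A) :
    (X.relAction h hS 0 y φ).1 a =
      convAct L (toConv X.gammaInv) (R.flip (φ.1 a) ∘ₗ X.gamma) y := by
  rw [convAct_repr _ _ _ (.arbitrary k y)]
  change diagonalAct _ _ _ 0 y φ.1 a = _
  rw [diagonalAct_apply, sweedler_repr _ (.arbitrary k y)]
  rfl

theorem relAction_zero_eq_counit_smul_iff (h : IsBimodule L R)
    (hS : ∀ h, ∀ s ∈ S, X.act h s ∈ S) (hu : IsUnit (toConv X.gamma))
    (φ : X.RelCochains S L R 0) :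
    (∀ y, X.relAction h hS 0 y φ = Coalgebra.counit (R := k) y • φ) ↔
      L.flip (φ.1 0) ∘ₗ X.gamma = R.flip (φ.1 0) ∘ₗ X.gamma := by
  rw [← X.convAct_gammaInv_eq_iff h hu, LinearMap.ext_iff]
  refine forall_congr' fun y => ?_
  rw [← X.relAction_zero_apply h hS φ y 0]
  exact ⟨fun invariant => congrArg (fun ψ => ψ.1 0) invariant,
    fun invariant => Subtype.ext (evalAt_zero_injective invariant)⟩

variable (L R) in
/-- The value, in `N`, of a total cochain of degree `0`. -/
def evalTot : TotCochain k H (fun r => X.RelCochains S L R r) 0 →ₗ[k] N :=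
  evalAt (0 : Fin 0 → A) ∘ₗ (relCochains S (L ∘ₗ X.inclA) (R ∘ₗ X.inclA) 0).subtype ∘ₗ
    evalAt (0 : Fin 0 → H) ∘ₗ LinearMap.proj (⟨(0, 0), rfl⟩ : {p : ℕ × ℕ // p.1 + p.2 = 0})

theorem evalTot_injective : Function.Injective (X.evalTot (S := S) L R) := by
  intro x y hxy
  funext p
  rcases p with ⟨⟨_ | r, _ | s⟩, hp⟩
  · exact evalAt_zero_injective (Subtype.ext (evalAt_zero_injective hxy))
  all_goals omega

theorem relCoboundary_zero_eq_zero_iff (h : IsBimodule L R) {φ : X.RelCochains S L R 0} :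
    X.relCoboundary S h 0 φ = 0 ↔ φ.1 0 ∈ center (L ∘ₗ X.inclA) (R ∘ₗ X.inclA) :=
  Subtype.ext_iff.trans hochschildD_zero_eq_zero_iff

theorem totD_zero_eq_zero_iff_mem_center (h : IsBimodule L R) (hS : ∀ h, ∀ s ∈ S, X.act h s ∈ S)
    (hu : IsUnit (toConv X.gamma)) (x : TotCochain k H (fun r => X.RelCochains S L R r) 0) :
    totD (X.relCoboundary S h) (X.relAction h hS) 0 x = 0 ↔
      X.evalTot L R x ∈ center L R := by
  rw [totD_zero_eq_zero_iff, X.relCoboundary_zero_eq_zero_iff,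
    X.relAction_zero_eq_counit_smul_iff h hS hu, X.mem_center_iff h]
  rfl

theorem map_ker_totD_zero (h : IsBimodule L R) (hS : ∀ h, ∀ s ∈ S, X.act h s ∈ S)
    (hu : IsUnit (toConv X.gamma)) :
    (LinearMap.ker (totD (X.relCoboundary S h) (X.relAction h hS) 0)).map (X.evalTot L R) =
      center L R := by
  ext m
  constructor
  · rintro ⟨x, hx, rfl⟩
    exact (X.totD_zero_eq_zero_iff_mem_center h hS hu x).mp hx
  · intro hm
    let φ : X.RelCochains S L R 0 := ⟨MultilinearMap.constOfIsEmpty k _ m,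
      fun i => i.elim0, fun i => i.elim0, fun i => i.elim0, fun i => i.elim0, fun _ s _ _ => hm _⟩
    exact ⟨Pi.single ⟨(0, 0), rfl⟩ (MultilinearMap.constOfIsEmpty k _ φ),
      (X.totD_zero_eq_zero_iff_mem_center h hS hu _).mpr hm, rfl⟩

end CrossedProduct

end DegreeZero

section CoinducedCoefficients

namespace CrossedProduct

variable {k A H : Type*} [CommRing k] [Ring A] [Algebra k A] [Ring H] [HopfAlgebra k H]
  (X : CrossedProduct k A H) {N : Type*} [AddCommGroup N] [Module k N] (S : Subalgebra k A)
  (L : X.E →ₗ[k] Module.End k N)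

/-- The relative cochains with values in the coinduced bimodule `Hom(E, N)`. -/
abbrev CoindCochains (r : ℕ) : Type _ := X.RelCochains S (homLeft (C := X.E) L) homRight r

variable {S L}

theorem linearMap_E_ext {n n' : X.E →ₗ[k] N}
    (h : ∀ a y, n (X.inclA a * X.gamma y) = n' (X.inclA a * X.gamma y)) : n = n' :=
  TensorProduct.ext' (M := A) (N := H) fun a y => by
    have eq_at := h a y
    rw [X.inclA_mul_gamma] at eq_at
    exact eq_at

section Rows

/-- The map `ξ ↦ (a # y ↦ ξ(a)(1 # y))`, which gives the contracting homotopy of the rows for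
coinduced coefficients. -/
def evalGamma : (A →ₗ[k] (X.E →ₗ[k] N)) →ₗ[k] (X.E →ₗ[k] N) where
  toFun ξ := (TensorProduct.lift (LinearMap.lcomp k N X.gamma ∘ₗ ξ) : A ⊗[k] H →ₗ[k] N)
  map_add' _ _ := TensorProduct.ext' fun _ _ => rfl
  map_smul' _ _ := TensorProduct.ext' fun _ _ => rfl

theorem evalGamma_apply (ξ : A →ₗ[k] (X.E →ₗ[k] N)) (a : A) (y : H) :
    X.evalGamma ξ (X.inclA a * X.gamma y) = ξ a (X.gamma y) := by
  rw [X.inclA_mul_gamma]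
  rfl

theorem evalGamma_homLeft (b : A) (ξ : A →ₗ[k] (X.E →ₗ[k] N)) :
    X.evalGamma (homLeft (homLeft L ∘ₗ X.inclA) b ξ) =
      (homLeft (C := X.E) L ∘ₗ X.inclA) b (X.evalGamma ξ) := by
  refine X.linearMap_E_ext fun a y => ?_
  rw [evalGamma_apply]
  exact (congrArg (L (X.inclA b)) (X.evalGamma_apply ξ a y)).symm

theorem evalGamma_homRight (b : A) (ξ : A →ₗ[k] (X.E →ₗ[k] N)) :
    X.evalGamma (homRight b ξ) = (homRight ∘ₗ X.inclA) b (X.evalGamma ξ) := by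
  refine X.linearMap_E_ext fun a y => ?_
  change _ = X.evalGamma ξ (X.inclA b * _)
  rw [← mul_assoc, ← X.inclA_mul, evalGamma_apply, evalGamma_apply]
  rfl

theorem evalGamma_flip (n : X.E →ₗ[k] N) :
    X.evalGamma ((homRight (k := k) (B := X.E) (N := N) ∘ₗ X.inclA).flip n) = n :=
  X.linearMap_E_ext fun a y => X.evalGamma_apply _ a y

/-- The contracting homotopy of the rows of the double complex with coinduced coefficients. -/
def rowContraction (r : ℕ) : X.CoindCochains S L (r + 1) →ₗ[k] X.CoindCochains S L r :=
  ((-1 : k) ^ (r + 1) • contractLast X.evalGamma r).restrict fun _ hφ =>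
    Submodule.smul_mem (relCochains S (homLeft L ∘ₗ X.inclA) (homRight ∘ₗ X.inclA) r) _
      (IsRelCochain.contractLast (fun s _ => X.evalGamma_homLeft s)
        (fun s _ => X.evalGamma_homRight s) hφ)

theorem relCoboundary_rowContraction {R : X.E →ₗ[k] Module.End k N} (h : IsBimodule L R) (r : ℕ)
    (φ : X.CoindCochains S L (r + 1)) (hφ : X.relCoboundary S h.hom (r + 1) φ = 0) :
    X.relCoboundary S h.hom r (X.rowContraction r φ) = φ :=
  Subtype.ext <| hochschildD_contractLast X.evalGamma_homLeft X.evalGamma_homRight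
    (MultilinearMap.ext fun _ => X.evalGamma_flip _) (congrArg Subtype.val hφ)

end Rows

section Column

variable (L) in
/-- The extension of a map `w : H → N` to the `A`-linear map `a # y ↦ a w(y)` on `E`. -/
def extendA : (H →ₗ[k] N) →ₗ[k] (X.E →ₗ[k] N) where
  toFun w := (TensorProduct.lift ((L ∘ₗ X.inclA).compl₂ w) : A ⊗[k] H →ₗ[k] N)
  map_add' _ _ := TensorProduct.ext' fun a _ => map_add (L (X.inclA a)) _ _
  map_smul' _ _ := TensorProduct.ext' fun a _ => map_smul (L (X.inclA a)) _ _

theorem extendA_apply (w : H →ₗ[k] N) (a : A) (y : H) :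
    X.extendA L w (X.inclA a * X.gamma y) = L (X.inclA a) (w y) := by
  rw [X.inclA_mul_gamma]
  rfl

variable {R : X.E →ₗ[k] Module.End k N}

theorem extendA_comp_gamma (h : IsBimodule L R) (w : H →ₗ[k] N) :
    X.extendA L w ∘ₗ X.gamma = w := by
  ext y
  have apply_one_mul := X.extendA_apply (L := L) w 1 y
  rwa [inclA_one, one_mul, h.left_one] at apply_one_mul

theorem extendA_mem_center (h : IsBimodule L R) (w : H →ₗ[k] N) :
    X.extendA L w ∈ center (homLeft L ∘ₗ X.inclA) (homRight ∘ₗ X.inclA) := by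
  refine fun a => X.linearMap_E_ext fun b y => ?_
  change L _ (X.extendA L w _) = X.extendA L w (X.inclA a * _)
  rw [← mul_assoc, ← X.inclA_mul, extendA_apply, extendA_apply, X.inclA_mul, h.left_mul]

theorem eq_extendA {n : X.E →ₗ[k] N}
    (hn : n ∈ center (homLeft L ∘ₗ X.inclA) (homRight ∘ₗ X.inclA)) :
    n = X.extendA L (n ∘ₗ X.gamma) := by
  refine X.linearMap_E_ext fun a y => ?_
  rw [extendA_apply]
  exact (LinearMap.congr_fun (hn a) (X.gamma y)).symm

/-- Since `γ(y) γ(l) = f(y⁽¹⁾, l⁽¹⁾) γ(y⁽²⁾ l⁽²⁾)`, the cocycle on the left is absorbed by `γ`. -/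
theorem extendA_convAct_gamma_mul (h : IsBimodule L R) (ζ : H →ₗ[k] N) (y l : H) :
    X.extendA L (convAct L (toConv X.gamma) ζ) (X.gamma y * X.gamma l) =
      convAct L (toConv X.gamma)
        ((convAct L (toConv X.gamma) ∘ₗ (homRight (k := k)).flip ζ).flip l) y := by
  have r := Coalgebra.Repr.arbitrary k y
  have s := Coalgebra.Repr.arbitrary k l
  have cocycle_act : convAct L X.cocycleE (convAct L (toConv X.gamma) ζ ∘ₗ LinearMap.mul' k H) =
      convAct L X.gammaGamma (ζ ∘ₗ LinearMap.mul' k H) := by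
    rw [convAct_comp_mul, gammaGamma_eq, convAct_mul h.left_mul]
    rfl
  have apply_cocycle := (convAct_tmul L X.cocycleE _ r s).symm.trans
    (LinearMap.congr_fun cocycle_act (y ⊗ₜ l))
  rw [convAct_tmul L X.gammaGamma _ r s] at apply_cocycle
  rw [X.gamma_mul_gamma r s, convAct_repr _ _ _ r]
  simp only [map_sum, X.extendA_apply]
  refine apply_cocycle.trans (Finset.sum_congr rfl fun i _ => ?_)
  have act_left := congrArg (L (X.gamma (r.left i))) (convAct_repr L (toConv X.gamma)
    ((homRight (k := k)).flip ζ (r.right i)) s)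
  rw [map_sum] at act_left
  exact (Finset.sum_congr rfl fun j _ => h.left_mul (X.gamma (r.left i)) (X.gamma (s.left j))
    (ζ (r.right i * s.right j))).trans act_left.symm

theorem coind_cocycle_zero_ext (h : IsBimodule L R) {φ ψ : X.CoindCochains S L 0}
    (hφ : X.relCoboundary S h.hom 0 φ = 0) (hψ : X.relCoboundary S h.hom 0 ψ = 0)
    (eq_gamma : φ.1 0 ∘ₗ X.gamma = ψ.1 0 ∘ₗ X.gamma) : φ = ψ := by
  rw [relCoboundary_zero_eq_zero_iff] at hφ hψ
  refine Subtype.ext (evalAt_zero_injective ?_)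
  change φ.1 0 = ψ.1 0
  rw [X.eq_extendA hφ, X.eq_extendA hψ, eq_gamma]

theorem coind_relAction_zero_apply (h : IsBimodule L R) (hS : ∀ h, ∀ s ∈ S, X.act h s ∈ S)
    (φ : X.CoindCochains S L 0) (y : H) (z : X.E) :
    (X.relAction h.hom hS 0 y φ).1 0 z =
      convAct L (toConv X.gammaInv) (φ.1 0 ∘ₗ LinearMap.mulRight k z ∘ₗ X.gamma) y := by
  have r := Coalgebra.Repr.arbitrary k y
  rw [X.relAction_zero_apply h.hom hS φ y, convAct_repr _ _ _ r, convAct_repr _ _ _ r,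
    LinearMap.sum_apply]
  rfl

/-- The retraction `ξ ↦ (1 # y ↦ γ(y⁽¹⁾) ξ(y⁽²⁾)(1))` exhibiting the cocycles in column `0`, for
coinduced coefficients, as a coinduced `H`-module. -/
def columnContraction (h : IsBimodule L R) :
    (H →ₗ[k] X.CoindCochains S L 0) →ₗ[k] X.CoindCochains S L 0 :=
  LinearMap.codRestrict _
    ((MultilinearMap.constLinearEquivOfIsEmpty k k (fun _ : Fin 0 => A) _).toLinearMap ∘ₗ
      X.extendA L ∘ₗ convAct L (toConv X.gamma) ∘ₗ
        LinearMap.compRight k (LinearMap.applyₗ (1 : X.E) ∘ₗ evalAt (0 : Fin 0 → A) ∘ₗ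
          Submodule.subtype _))
    fun _ => ⟨fun i => i.elim0, fun i => i.elim0, fun i => i.elim0, fun i => i.elim0,
      fun _ s _ _ => X.extendA_mem_center h _ s⟩

theorem columnContraction_comp_gamma (h : IsBimodule L R) (ξ : H →ₗ[k] X.CoindCochains S L 0) :
    (X.columnContraction h ξ).1 0 ∘ₗ X.gamma = convAct L (toConv X.gamma)
      (LinearMap.applyₗ (1 : X.E) ∘ₗ evalAt (0 : Fin 0 → A) ∘ₗ Submodule.subtype _ ∘ₗ ξ) :=
  X.extendA_comp_gamma h _

theorem relCoboundary_columnContraction (h : IsBimodule L R)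
    (ξ : H →ₗ[k] X.CoindCochains S L 0) :
    X.relCoboundary S h.hom 0 (X.columnContraction h ξ) = 0 :=
  (X.relCoboundary_zero_eq_zero_iff h.hom).mpr (X.extendA_mem_center h _)

theorem columnContraction_homRight (h : IsBimodule L R) (hS : ∀ h, ∀ s ∈ S, X.act h s ∈ S)
    (hu : IsUnit (toConv X.gamma)) (hf : ∀ h l : H, X.f (h ⊗ₜ l) ∈ S) (y : H)
    (ξ : H →ₗ[k] X.CoindCochains S L 0) :
    X.columnContraction h (homRight (k := k) (N := X.CoindCochains S L 0) y ξ) =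
      X.relAction h.hom hS 0 y (X.columnContraction h ξ) := by
  refine X.coind_cocycle_zero_ext h (X.relCoboundary_columnContraction h _) ?_ ?_
  · rw [(X.relComplex_isRightModuleComplex h.hom hS hu hf).d_act,
      X.relCoboundary_columnContraction h, map_zero]
  · refine LinearMap.ext fun l => ?_
    let ζ : H →ₗ[k] N :=
      LinearMap.applyₗ (1 : X.E) ∘ₗ evalAt (0 : Fin 0 → A) ∘ₗ Submodule.subtype _ ∘ₗ ξ
    have twisted : (X.columnContraction h ξ).1 0 ∘ₗ LinearMap.mulRight k (X.gamma l) ∘ₗ X.gamma =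
        convAct L (toConv X.gamma)
          ((convAct L (toConv X.gamma) ∘ₗ (homRight (k := k)).flip ζ).flip l) :=
      LinearMap.ext fun y => X.extendA_convAct_gamma_mul h ζ y l
    rw [columnContraction_comp_gamma, LinearMap.comp_apply, X.coind_relAction_zero_apply h hS,
      twisted, ← convAct_mul h.left_mul, X.gammaInv_mul hu, convAct_one h.left_one]
    rfl

theorem columnContraction_flip (h : IsBimodule L R) (hS : ∀ h, ∀ s ∈ S, X.act h s ∈ S)
    (hu : IsUnit (toConv X.gamma)) (φ : X.CoindCochains S L 0)
    (hφ : X.relCoboundary S h.hom 0 φ = 0) :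
    X.columnContraction h ((X.relAction h.hom hS 0).flip φ) = φ := by
  refine X.coind_cocycle_zero_ext h (X.relCoboundary_columnContraction h _) hφ ?_
  have action_at_one : LinearMap.applyₗ (1 : X.E) ∘ₗ evalAt (0 : Fin 0 → A) ∘ₗ
      Submodule.subtype _ ∘ₗ (X.relAction h.hom hS 0).flip φ =
        convAct L (toConv X.gammaInv) (φ.1 0 ∘ₗ X.gamma) := by
    refine LinearMap.ext fun y => (X.coind_relAction_zero_apply h hS φ y 1).trans ?_
    rw [LinearMap.mulRight_one, LinearMap.id_comp]
  rw [columnContraction_comp_gamma, action_at_one, ← convAct_mul h.left_mul, X.mul_gammaInv hu,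
    convAct_one h.left_one]

end Column

theorem totD_coind_exact {R : X.E →ₗ[k] Module.End k N} (h : IsBimodule L R)
    (hS : ∀ h, ∀ s ∈ S, X.act h s ∈ S) (hu : IsUnit (toConv X.gamma))
    (hf : ∀ h l : H, X.f (h ⊗ₜ l) ∈ S) (n : ℕ) :
    Function.Exact (totD (X.relCoboundary S h.hom) (X.relAction h.hom hS) n)
      (totD (X.relCoboundary S h.hom) (X.relAction h.hom hS) (n + 1)) :=
  totD_exact (X.relComplex_isRightModuleComplex h.hom hS hu hf) (X.relCoboundary_rowContraction h)
    (X.relCoboundary_columnContraction h) (X.columnContraction_homRight h hS hu hf)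
    (X.columnContraction_flip h hS hu) n

end CrossedProduct

end CoinducedCoefficients

section Subquotients

variable {k V N : Type*} [CommRing k] [AddCommGroup V] [Module k V] [AddCommGroup N] [Module k N]

/-- The isomorphism of subquotients `W / U ≃ Z / Y` induced by an injective map under which `W` has
image `Z` and `U` has image `Y`. -/
def subquotientEquiv {ev : V →ₗ[k] N} (hev : Function.Injective ev) {W U : Submodule k V}
    {Z Y : Submodule k N} (hUW : U ≤ W) (hW : W.map ev = Z) (hU : U.map ev = Y) :
    (W ⧸ U.submoduleOf W) ≃ₗ[k] (Z ⧸ Y.submoduleOf Z) :=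
  Submodule.Quotient.equiv _ _ (W.equivMapOfInjective ev hev ≪≫ₗ LinearEquiv.ofEq _ _ hW) <| by
    subst hW hU
    ext ⟨x, hx⟩
    constructor
    · rintro ⟨y, hy, hyx⟩
      exact ⟨y.1, hy, congrArg Subtype.val hyx⟩
    · rintro ⟨y, hy, hyx⟩
      exact ⟨⟨y, hUW hy⟩, hy, Subtype.ext hyx⟩

variable {C' C C'' : ℕ → Type*}
  [∀ n, AddCommGroup (C' n)] [∀ n, Module k (C' n)] [∀ n, AddCommGroup (C n)]
  [∀ n, Module k (C n)] [∀ n, AddCommGroup (C'' n)] [∀ n, Module k (C'' n)]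
  {d' : ∀ n, C' n →ₗ[k] C' (n + 1)} {d : ∀ n, C n →ₗ[k] C (n + 1)}
  {d'' : ∀ n, C'' n →ₗ[k] C'' (n + 1)} {i : ∀ n, C' n →ₗ[k] C n} {p : ∀ n, C n →ₗ[k] C'' n}
  {r : ∀ n, C n →ₗ[k] C' n} {t : ∀ n, C'' n →ₗ[k] C n}

/-- The cohomology in degree `0`, for `0`-cocycles realized as a submodule `Z` of `N`. -/
def cohomologyZeroEquiv {ev : C 0 →ₗ[k] N} (hev : Function.Injective ev) {Z : Submodule k N}
    (hZ : (LinearMap.ker (d 0)).map ev = Z) :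
    Cohomology d 0 ≃ₗ[k] Z ⧸ (⊥ : Submodule k N).submoduleOf Z :=
  subquotientEquiv hev bot_le hZ (Submodule.map_bot _)

/-- The connecting isomorphism out of degree `0`, for `0`-cocycles of the middle and of the right
complex realized as submodules `Z` of `V` and `Z''` of `N`. -/
def SplitExact.shiftZeroEquiv (h : SplitExact d' d d'' i p r t)
    (hC : ∀ n, Function.Exact (d n) (d (n + 1))) {ev : C 0 →ₗ[k] V} {ev'' : C'' 0 →ₗ[k] N}
    {q : V →ₗ[k] N} (hev'' : Function.Injective ev'') (hq : ev'' ∘ₗ p 0 = q ∘ₗ ev)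
    {Z : Submodule k V} {Z'' : Submodule k N} (hZ : (LinearMap.ker (d 0)).map ev = Z)
    (hZ'' : (LinearMap.ker (d'' 0)).map ev'' = Z'') :
    Cohomology d' 1 ≃ₗ[k] Z'' ⧸ (Z.map q).submoduleOf Z'' :=
  h.shiftEquiv (fun n => (hC n).apply_apply_eq_zero) (hC 0) ≪≫ₗ subquotientEquiv hev''
    (Submodule.map_le_iff_le_comap.mpr fun x hx => by
      rw [Submodule.mem_comap, LinearMap.mem_ker, h.p_d, LinearMap.mem_ker.mp hx, map_zero])
    hZ'' (by rw [← hZ, ← Submodule.map_comp, ← Submodule.map_comp, hq])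

end Subquotients

theorem SplitExact.tot {k H : Type*} [CommRing k] [Ring H] [HopfAlgebra k H] {C' C C'' : ℕ → Type*}
    [∀ n, AddCommGroup (C' n)] [∀ n, Module k (C' n)] [∀ n, AddCommGroup (C n)]
    [∀ n, Module k (C n)] [∀ n, AddCommGroup (C'' n)] [∀ n, Module k (C'' n)]
    {d' : ∀ n, C' n →ₗ[k] C' (n + 1)} {d : ∀ n, C n →ₗ[k] C (n + 1)}
    {d'' : ∀ n, C'' n →ₗ[k] C'' (n + 1)} {i : ∀ n, C' n →ₗ[k] C n} {p : ∀ n, C n →ₗ[k] C'' n}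
    {r : ∀ n, C n →ₗ[k] C' n} {t : ∀ n, C'' n →ₗ[k] C n}
    {ρ' : ∀ r, H →ₗ[k] Module.End k (C' r)} {ρ : ∀ r, H →ₗ[k] Module.End k (C r)}
    {ρ'' : ∀ r, H →ₗ[k] Module.End k (C'' r)} (h : SplitExact d' d d'' i p r t)
    (hi : ∀ n y x, i n (ρ' n y x) = ρ n y (i n x))
    (hp : ∀ n y x, p n (ρ n y x) = ρ'' n y (p n x)) :
    SplitExact (totD d' ρ') (totD d ρ) (totD d'' ρ'') (totMap k H i) (totMap k H p) (totMap k H r)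
      (totMap k H t) where
  i_d := totD_totMap (fun n x => (h.i_d n x).symm) hi
  p_d := totD_totMap (fun n x => (h.p_d n x).symm) hp
  p_i _ _ := funext fun _ => MultilinearMap.ext fun _ => h.p_i _ _
  r_i _ _ := funext fun _ => MultilinearMap.ext fun _ => h.r_i _ _
  p_t _ _ := funext fun _ => MultilinearMap.ext fun _ => h.p_t _ _
  split _ _ := funext fun _ => MultilinearMap.ext fun _ => h.split _ _

namespace CrossedProduct

section Comparison

variable {k A H N : Type*} [CommRing k] [Ring A] [Algebra k A] [Ring H] [HopfAlgebra k H]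
  (X : CrossedProduct k A H) [AddCommGroup N] [Module k N] {S : Subalgebra k A}
  {L R : X.E →ₗ[k] Module.End k N}

theorem rel_splitExact (h : IsBimodule L R) {ρ : (X.E →ₗ[k] N) →ₗ[k] N}
    (hρ : ∀ m, ρ (R.flip m) = m) (hL : ∀ b n, ρ (homLeft L b n) = L b (ρ n))
    (hR : ∀ s ∈ S, ∀ n, ρ (homRight (X.inclA s) n) = R (X.inclA s) (ρ n)) :
    SplitExact (X.relCoboundary S h) (X.relCoboundary S h.hom) (X.relCoboundary S h.coker)
      (X.relMap R.flip (fun _ _ m => (homLeft_flip h _ m).symm)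
        (fun _ _ m => (homRight_flip h _ m).symm))
      (X.relMap (LinearMap.range R.flip).mkQ (fun _ _ _ => rfl) (fun _ _ _ => rfl))
      (X.relMap ρ (fun _ _ => hL _) hR)
      (X.relMap (cokerSection ρ hρ)
        (fun _ _ => cokerSection_comm hρ (fun _ => rfl) (homLeft_flip h _) (hL _))
        (fun _ hs => cokerSection_comm hρ (fun _ => rfl) (homRight_flip h _) (hR _ hs))) where
  i_d n φ := (X.relMap_relCoboundary h h.hom R.flip (fun _ _ => (homLeft_flip h _ _).symm)
    (fun _ _ => (homRight_flip h _ _).symm) n φ).symm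
  p_d n φ := (X.relMap_relCoboundary h.hom h.coker _ (fun _ _ => rfl) (fun _ _ => rfl) n φ).symm
  p_i _ _ := Subtype.ext <| MultilinearMap.ext fun _ => mkQ_flip _
  r_i _ _ := Subtype.ext <| MultilinearMap.ext fun _ => hρ _
  p_t _ _ := Subtype.ext <| MultilinearMap.ext fun _ => mkQ_cokerSection hρ _
  split _ _ := Subtype.ext <| MultilinearMap.ext fun _ => flip_add_cokerSection_mkQ hρ _

/-- Both complexes have the center of `N` as their cohomology in degree `0`. -/
def cohomologyEquivZero (h : IsBimodule L R) (hS : ∀ h, ∀ s ∈ S, X.act h s ∈ S)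
    (hu : IsUnit (toConv X.gamma)) : Cohomology (hochschildD L R) 0 ≃ₗ[k]
      HopfCohomology (X.relCoboundary S h) (X.relAction h hS) 0 :=
  cohomologyZeroEquiv evalAt_zero_injective (map_ker_hochschildD_zero L R) ≪≫ₗ
    (cohomologyZeroEquiv X.evalTot_injective (X.map_ker_totD_zero h hS hu)).symm

theorem exists_splitExact (h : IsBimodule L R) (hS : ∀ h, ∀ s ∈ S, X.act h s ∈ S)
    (hsep : IsSeparableAlgebra k S) :
    (∃ r t, SplitExact (hochschildD L R) (hochschildD (homLeft L) homRight)
      (hochschildD (cokerLeft h) (cokerRight h)) (fun _ => R.flip.compMultilinearMapₗ k)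
      (fun _ => (LinearMap.range R.flip).mkQ.compMultilinearMapₗ k) r t) ∧
    ∃ r t, SplitExact (totD (X.relCoboundary S h) (X.relAction h hS))
      (totD (X.relCoboundary S h.hom) (X.relAction h.hom hS))
      (totD (X.relCoboundary S h.coker) (X.relAction h.coker hS))
      (totMap k H (X.relMap R.flip (fun _ _ m => (homLeft_flip h _ m).symm)
        (fun _ _ m => (homRight_flip h _ m).symm)))
      (totMap k H (X.relMap (LinearMap.range R.flip).mkQ (fun _ _ _ => rfl) (fun _ _ _ => rfl)))
      r t := by
  obtain ⟨ρ, hρ, hL, hR⟩ :=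
    exists_retraction_of_isSeparableAlgebra h hsep (X.inclAlgHom.comp S.val)
  exact ⟨⟨_, _, hochschild_splitExact h hρ⟩, _, _,
    (X.rel_splitExact h hρ hL fun s hs => hR ⟨s, hs⟩).tot
      (X.relMap_relAction h h.hom hS R.flip (fun _ _ => (homLeft_flip h _ _).symm)
        (fun _ _ => (homRight_flip h _ _).symm))
      (X.relMap_relAction h.hom h.coker hS _ (fun _ _ => rfl) (fun _ _ => rfl))⟩

theorem nonempty_cohomologyEquiv_one (h : IsBimodule L R) (hS : ∀ h, ∀ s ∈ S, X.act h s ∈ S)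
    (hu : IsUnit (toConv X.gamma)) (hsep : IsSeparableAlgebra k S)
    (hf : ∀ h l : H, X.f (h ⊗ₜ l) ∈ S) :
    Nonempty (Cohomology (hochschildD L R) 1 ≃ₗ[k]
      HopfCohomology (X.relCoboundary S h) (X.relAction h hS) 1) := by
  obtain ⟨⟨_, _, hochschild⟩, _, _, total⟩ := X.exists_splitExact h hS hsep
  exact ⟨hochschild.shiftZeroEquiv h.hochschildD_hom_exact (ev := evalAt 0)
      (q := (LinearMap.range R.flip).mkQ) evalAt_zero_injective rfl
      (map_ker_hochschildD_zero _ _) (map_ker_hochschildD_zero _ _) ≪≫ₗ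
    (total.shiftZeroEquiv (X.totD_coind_exact h hS hu hf) (ev := X.evalTot _ _)
      X.evalTot_injective rfl (X.map_ker_totD_zero h.hom hS hu)
      (X.map_ker_totD_zero h.coker hS hu)).symm⟩

theorem nonempty_cohomologyEquiv_succ (h : IsBimodule L R) (hS : ∀ h, ∀ s ∈ S, X.act h s ∈ S)
    (hu : IsUnit (toConv X.gamma)) (hsep : IsSeparableAlgebra k S)
    (hf : ∀ h l : H, X.f (h ⊗ₜ l) ∈ S) {n : ℕ}
    (equiv_coker : Cohomology (hochschildD (cokerLeft h) (cokerRight h)) (n + 1) ≃ₗ[k]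
      HopfCohomology (X.relCoboundary S h.coker) (X.relAction h.coker hS) (n + 1)) :
    Nonempty (Cohomology (hochschildD L R) (n + 2) ≃ₗ[k]
      HopfCohomology (X.relCoboundary S h) (X.relAction h hS) (n + 2)) := by
  obtain ⟨⟨_, _, hochschild⟩, _, _, total⟩ := X.exists_splitExact h hS hsep
  exact ⟨hochschild.shiftSuccEquiv h.hochschildD_hom_exact n ≪≫ₗ equiv_coker ≪≫ₗ
    (total.shiftSuccEquiv (X.totD_coind_exact h hS hu hf) n).symm⟩

end Comparison

/-- The induction passes from `N` to `Coker R`, a quotient of `Hom(E, N)`, so it needs a universe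
for `N` that is closed under this operation. -/
theorem nonempty_cohomologyEquiv_of_universe.{u, v, w} {k : Type*} {A : Type u} {H : Type v}
    [CommRing k] [Ring A] [Algebra k A] [Ring H] [HopfAlgebra k H] (X : CrossedProduct k A H)
    {S : Subalgebra k A} (hS : ∀ h, ∀ s ∈ S, X.act h s ∈ S) (hu : IsUnit (toConv X.gamma))
    (hsep : IsSeparableAlgebra k S) (hf : ∀ h l : H, X.f (h ⊗ₜ l) ∈ S) (n : ℕ)
    {N : Type (max u v w)} [AddCommGroup N] [Module k N] {L R : X.E →ₗ[k] Module.End k N}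
    (h : IsBimodule L R) :
    Nonempty (Cohomology (hochschildD L R) (n + 1) ≃ₗ[k]
      HopfCohomology (X.relCoboundary S h) (X.relAction h hS) (n + 1)) := by
  induction n generalizing N with
  | zero => exact X.nonempty_cohomologyEquiv_one h hS hu hsep hf
  | succ n ih =>
    obtain ⟨equiv_coker⟩ := ih h.coker
    exact X.nonempty_cohomologyEquiv_succ h hS hu hsep hf equiv_coker

theorem nonempty_cohomologyEquiv {k A H N : Type*} [CommRing k] [Ring A] [Algebra k A] [Ring H]
    [HopfAlgebra k H] (X : CrossedProduct k A H) [AddCommGroup N] [Module k N]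
    {S : Subalgebra k A} {L R : X.E →ₗ[k] Module.End k N} (h : IsBimodule L R)
    (hS : ∀ h, ∀ s ∈ S, X.act h s ∈ S) (hu : IsUnit (toConv X.gamma))
    (hsep : IsSeparableAlgebra k S) (hf : ∀ h l : H, X.f (h ⊗ₜ l) ∈ S) (n : ℕ) :
    Nonempty (Cohomology (hochschildD L R) n ≃ₗ[k]
      HopfCohomology (X.relCoboundary S h) (X.relAction h hS) n) := by
  rcases n with _ | _ | n
  · exact ⟨X.cohomologyEquivZero h hS hu⟩
  · exact X.nonempty_cohomologyEquiv_one h hS hu hsep hf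
  · obtain ⟨equiv_coker⟩ := X.nonempty_cohomologyEquiv_of_universe hS hu hsep hf n h.coker
    exact X.nonempty_cohomologyEquiv_succ h hS hu hsep hf equiv_coker

end CrossedProduct

end

end HopfCrossed

theorem theorem3p2p5p1 {k A H M : Type*} [CommRing k] [Ring A] [Algebra k A] [Ring H]
    [HopfAlgebra k H] (X : HopfCrossed.CrossedProduct k A H)
    [AddCommGroup M] [Module k M] [Module X.E M] [Module X.Eᵐᵒᵖ M]
    [IsScalarTower k X.E M] [IsScalarTower k X.Eᵐᵒᵖ M] [SMulCommClass X.E X.Eᵐᵒᵖ M]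
    -- the cocycle is convolution invertible
    (hinv : IsUnit (WithConv.toConv X.f))
    -- `S` is a separable subalgebra of `A`, stable under the weak action
    (S : Subalgebra k A) (hsep : HopfCrossed.IsSeparableAlgebra k S)
    (hS : ∀ h : H, ∀ s ∈ S, X.act h s ∈ S)
    -- the cocycle takes its values in `S`
    (hf : ∀ h l : H, X.f (h ⊗ₜ l) ∈ S) :
    IsUnit (WithConv.toConv X.gamma) ∧
    HopfCrossed.IsRightModuleComplex (X.relD M S) (X.relAct M S hS) ∧
    ∀ n : ℕ, Nonempty (HopfCrossed.HochschildCohomology k X.E M n ≃ₗ[k]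
      HopfCrossed.HopfCohomology (X.relD M S) (X.relAct M S hS) n) := by
  have hu := X.isUnit_gamma hinv
  exact ⟨hu, X.relComplex_isRightModuleComplex HopfCrossed.isBimodule_leftMul_rightMul hS hu hf,
    X.nonempty_cohomologyEquiv HopfCrossed.isBimodule_leftMul_rightMul hS hu hsep hf⟩
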